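/- Let $K$ be an imaginary quadratic field with exactly $w_K=2$ roots of unity, let $h$ be its class number, and let $\mathfrak p_1,\mathfrak p_2,\mathfrak p_3$ be three distinct principal maximal ideals of $\mathcal O_K$ with $N\mathfrak p_i\equiv 3 \pmod 4$. Put $\mathfrak m=\mathfrak p_1\mathfrak p_2\mathfrak p_3$. Then $$\mathrm{Tor}(\Delta_{\mathfrak m}/U(\mathfrak m))\cong(\mathbb Z/2\mathbb Z)^h\qquad\text{and}\qquad \mathrm{Tor}(\mathcal A_{\mathfrak m})\neq 0 .$$ Here $\mathrm{Tor}$ is the torsion subgroup, and the objects are the following. For a nonzero integral ideal $\mathfrak n$ of $K$, let $I_{\mathfrak n}$ be the group of fractional ideals prime to $\mathfrak n$, $\mathcal R_{\mathfrak n}\subset I_{\mathfrak n}$ the subgroup of principal ideals $x\mathcal O_K$ with $x\equiv 1 \bmod^\times\mathfrak n$ and $x$ positive at all real places (a condition that is empty for imaginary quadratic $K$), and $G_{\mathfrak n}=I_{\mathfrak n}/\mathcal R_{\mathfrak n}$ the ray class group, which the Artin map identifies with $\mathrm{Gal}(K_{\mathfrak n}/K)$, $K_{\mathfrak n}$ being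 the ray class field. For $\mathfrak n\mid\mathfrak n'$ there is a canonical surjection $G_{\mathfrak n'}\to G_{\mathfrak n}$ (restriction of automorphisms); let $s(K_{\mathfrak n'}/K_{\mathfrak n})$ be the sum of the elements of its kernel. For a maximal ideal $\mathfrak p\nmid\mathfrak n$ let $(\mathfrak p,K_{\mathfrak n}/K)\in G_{\mathfrak n}$ be its Frobenius, i.e. the class of $\mathfrak p$. Let $\Delta$ be the free abelian group on the disjoint union of the $G_{\mathfrak n}$, over all nonzero integral ideals $\mathfrak n$, and let $\Delta_{\mathfrak m}$ be the subgroup generated by the $\sigma\in G_{\mathfrak n}$ with $\mathfrak n\mid\mathfrak m$. For $\mathfrak n$, a maximal ideal $\mathfrak p$, $e\ge 1$, $\sigma\in G_{\mathfrak n}$ and a lift $\tilde\sigma\in G_{\mathfrak n\mathfrak p^e}$ of $\sigma$, put $$S(\mathfrak n,\mathfrak p^e,\sigma)=\begin{cases}\sigma-s(K_{\mathfrak n\mathfrak p^e}/K_{\mathfrak n})\tilde\sigma&\text{if }\mathfrak p\mid\mathfrak n,\\ (1-(\mathfrak p,K_{\mathfrak n}/K)^{-1})\sigma-s(K_{\mathfrak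 n\mathfrak p^e}/K_{\mathfrak n})\tilde\sigma&\text{if }\mathfrak p\nmid\mathfrak n.\end{cases}$$ Then $U(\mathfrak m)\subset\Delta_{\mathfrak m}$ is the subgroup generated by the $S(\mathfrak n,\mathfrak p^e,\sigma)$ with $\mathfrak n\mathfrak p^e\mid\mathfrak m$. For nonzero integral ideals write $\mathfrak a\sim_{\mathfrak n}\mathfrak b$ if $\gcd(\mathfrak a,\mathfrak n)=\gcd(\mathfrak b,\mathfrak n)$ and $\mathfrak b\mathfrak a^{-1}\in\mathcal R_{\mathfrak n'}$, where $\mathfrak n'\gcd(\mathfrak a,\mathfrak n)=\mathfrak n$. The universal ordinary distribution $\mathcal A$ is the free abelian group on symbols $[\mathfrak c]$, for $\mathfrak c$ a fractional ideal of $K$, modulo the relations $$[\mathfrak a\mathfrak u^{-1}]=\sum_{\mathfrak b\in w}[\mathfrak b\mathfrak v^{-1}]$$ for all nonzero integral ideals $\mathfrak a,\mathfrak u,\mathfrak v$ with $\mathfrak u\mid\mathfrak v$, where $w$ is any system of representatives, modulo $\sim_{\mathfrak v}$, of the integral ideals $\mathfrak b$ with $\mathfrak b\sim_{\mathfrak u}\mathfrak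 a$. The group $\mathcal A_{\mathfrak m}$ of level $\mathfrak m$ is the subgroup of $\mathcal A$ generated by the classes of the $[\mathfrak a\mathfrak m^{-1}]$, $\mathfrak a$ a nonzero integral ideal. -/

import Mathlib

open scoped nonZeroDivisors NumberField
open IsDedekindDomain

noncomputable section

namespace UnivDist

variable (K : Type*) [Field K] [NumberField K]

/-- The monoid of nonzero integral ideals of `K`. -/
abbrev IntIdeal : Type _ := (Ideal (𝓞 K))⁰

/-- The group of (nonzero) fractional ideals of `K`. -/
abbrev FracIdeal : Type _ := (FractionalIdeal (𝓞 K)⁰ K)ˣ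

variable {K}

/-- A nonzero integral ideal, viewed as a fractional ideal. -/
def toFrac : IntIdeal K →* FracIdeal K := FractionalIdeal.mk0 K

/-- A maximal ideal, viewed as a nonzero integral ideal. -/
def ofPrime (p : HeightOneSpectrum (𝓞 K)) : IntIdeal K :=
  ⟨p.asIdeal, mem_nonZeroDivisors_of_ne_zero p.ne_bot⟩

/-! ### Ray class groups -/

/-- The group `I_n` of fractional ideals of `K` that are prime to `n`. -/
def primeTo (n : IntIdeal K) : Subgroup (FracIdeal K) where
  carrier := {I | ∀ v : HeightOneSpectrum (𝓞 K), v.asIdeal ∣ (n : Ideal (𝓞 K)) →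
    FractionalIdeal.count K v (I : FractionalIdeal (𝓞 K)⁰ K) = 0}
  one_mem' := fun v _ => by simpa using FractionalIdeal.count_one K v
  mul_mem' := fun {I J} hI hJ v hv => by
    rw [Units.val_mul, FractionalIdeal.count_mul K v I.ne_zero J.ne_zero, hI v hv, hJ v hv,
      add_zero]
  inv_mem' := fun {I} hI v hv => by
    rw [Units.val_inv_eq_inv_val, FractionalIdeal.count_inv, hI v hv, neg_zero]

/-- The group of `x ∈ Kˣ` with `x ≡ 1 mod^× n` and `σ(x) > 0` for every real embedding `σ` of `K`.
The multiplicative congruence says that `x = a / b` with `a`, `b` integers of `K` such that `b` is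
prime to `n` and `a ≡ b mod n`. -/
def rayUnits (n : IntIdeal K) : Subgroup Kˣ where
  carrier := {x | (∃ a b : 𝓞 K, b ≠ 0 ∧ IsCoprime (Ideal.span {b}) (n : Ideal (𝓞 K)) ∧
      a - b ∈ (n : Ideal (𝓞 K)) ∧ (x : K) = (a : K) / (b : K)) ∧
    ∀ σ : K →+* ℝ, 0 < σ x}
  one_mem' := ⟨⟨1, 1, one_ne_zero, by
      rw [Ideal.span_singleton_one, ← Ideal.one_eq_top]; exact isCoprime_one_left,
      by simp, by simp⟩, fun σ => by simp⟩
  mul_mem' := by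
    rintro x y ⟨⟨a, b, hb, hc, hab, hx⟩, hσ⟩ ⟨⟨a', b', hb', hc', hab', hy⟩, hσ'⟩
    refine ⟨⟨a * a', b * b', mul_ne_zero hb hb', ?_, ?_, ?_⟩, fun σ => ?_⟩
    · rw [← Ideal.span_singleton_mul_span_singleton]
      exact hc.mul_left hc'
    · have h : a * a' - b * b' = a' * (a - b) + b * (a' - b') := by ring
      rw [h]
      exact Ideal.add_mem _ (Ideal.mul_mem_left _ _ hab) (Ideal.mul_mem_left _ _ hab')
    · rw [Units.val_mul, hx, hy]
      push_cast
      exact div_mul_div_comm _ _ _ _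
    · rw [Units.val_mul, map_mul]
      exact mul_pos (hσ σ) (hσ' σ)
  inv_mem' := by
    rintro x ⟨⟨a, b, hb, hc, hab, hx⟩, hσ⟩
    have ha : a ≠ 0 := by
      rintro rfl
      exact x.ne_zero (by rw [hx]; simp)
    refine ⟨⟨b, a, ha, ?_, ?_, ?_⟩, fun σ => ?_⟩
    · rw [Ideal.isCoprime_iff_exists] at hc ⊢
      obtain ⟨i, hi, j, hj, hij⟩ := hc
      obtain ⟨c, rfl⟩ := Ideal.mem_span_singleton'.1 hi
      refine ⟨c * a, Ideal.mem_span_singleton'.2 ⟨c, rfl⟩, j - c * (a - b),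
        Ideal.sub_mem _ hj (Ideal.mul_mem_left _ _ hab), ?_⟩
      rw [← hij]; ring
    · rw [← neg_sub]; exact neg_mem hab
    · rw [Units.val_inv_eq_inv_val, hx, inv_div]
    · rw [Units.val_inv_eq_inv_val, map_inv₀]
      exact inv_pos.2 (hσ σ)

/-- The group `R_n` of principal ideals `x 𝓞_K` with `x ≡ 1 mod^× n` and `x` positive at the
real places. -/
def ray (n : IntIdeal K) : Subgroup (FracIdeal K) :=
  (rayUnits n).map (toPrincipalIdeal (𝓞 K) K)

/-- The group `G_n = I_n / R_n`, that is, the Galois group over `K` of the ray class field `K_n`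
modulo `n` and the real places, by the Artin isomorphism. -/
abbrev RayClassGroup (n : IntIdeal K) : Type _ :=
  primeTo n ⧸ (ray n).subgroupOf (primeTo n)

lemma primeTo_anti {n n' : IntIdeal K} (h : n ∣ n') : primeTo n' ≤ primeTo n := by
  intro I hI v hv
  obtain ⟨c, rfl⟩ := h
  exact hI v (by rw [Submonoid.coe_mul]; exact Dvd.dvd.mul_right hv _)

lemma ray_anti {n n' : IntIdeal K} (h : n ∣ n') : ray n' ≤ ray n := by
  obtain ⟨c, rfl⟩ := h
  have hle : ((n * c : IntIdeal K) : Ideal (𝓞 K)) ≤ n := by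
    rw [Submonoid.coe_mul]; exact Ideal.mul_le_left
  refine Subgroup.map_mono ?_
  rintro x ⟨⟨a, b, hb, hc, hab, hx⟩, hσ⟩
  refine ⟨⟨a, b, hb, ?_, hle hab, hx⟩, hσ⟩
  rw [Submonoid.coe_mul] at hc
  exact hc.of_mul_right_left

/-- The canonical map `G_{n'} → G_n` for `n ∣ n'`, that is, restriction of automorphisms
from `K_{n'}` to `K_n`. -/
def res {n n' : IntIdeal K} (h : n ∣ n') : RayClassGroup n' →* RayClassGroup n :=
  QuotientGroup.map _ _ (Subgroup.inclusion (primeTo_anti h)) (fun _ hx => ray_anti h hx)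

lemma ofPrime_mem_primeTo {n : IntIdeal K} {p : HeightOneSpectrum (𝓞 K)} (h : ¬ ofPrime p ∣ n) :
    toFrac (ofPrime p) ∈ primeTo n := by
  intro v hv
  refine FractionalIdeal.count_maximal_coprime K v (w := p) ?_
  rintro rfl
  obtain ⟨c, hc⟩ := hv
  refine h ⟨⟨c, mem_nonZeroDivisors_of_ne_zero ?_⟩, Subtype.ext hc⟩
  rintro rfl
  exact nonZeroDivisors.coe_ne_zero n (by rw [hc]; exact mul_zero _)

/-- The Frobenius `(p, K_n / K)` of a maximal ideal `p ∤ n`, that is, the class of `p`. -/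
def frob {n : IntIdeal K} {p : HeightOneSpectrum (𝓞 K)} (h : ¬ ofPrime p ∣ n) : RayClassGroup n :=
  QuotientGroup.mk ⟨toFrac (ofPrime p), ofPrime_mem_primeTo h⟩

/-! ### The groups `Δ`, `Δ_m` and `U(m)` -/

variable (K) in
/-- The free abelian group `Δ` on the disjoint union of the groups `G_n`. -/
abbrev Delta : Type _ := (Σ n : IntIdeal K, RayClassGroup n) →₀ ℤ

/-- The basis element of `Δ` given by `σ ∈ G_n`. -/
def symb {n : IntIdeal K} (σ : RayClassGroup n) : Delta K := Finsupp.single ⟨n, σ⟩ 1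

/-- The element `s(K_{n'} / K_n) τ` of `Δ`, for `n ∣ n'` and `τ ∈ G_{n'}`: the sum of the `g τ`
with `g` in the (finite) kernel of `G_{n'} → G_n`. -/
def normSum {n n' : IntIdeal K} (h : n ∣ n') (τ : RayClassGroup n') : Delta K :=
  ∑ᶠ g : (res h).ker, symb ((g : RayClassGroup n') * τ)

open Classical in
/-- The element `S(n, p^e, σ)` of `Δ`, computed with a lift `τ ∈ G_{n p^e}` of `σ ∈ G_n`:
`σ - s(K_{n p^e} / K_n) τ` if `p ∣ n`, and
`σ - (p, K_n / K)⁻¹ σ - s(K_{n p^e} / K_n) τ` if `p ∤ n`. -/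
def relS (n : IntIdeal K) (p : HeightOneSpectrum (𝓞 K)) (e : ℕ) (σ : RayClassGroup n)
    (τ : RayClassGroup (n * ofPrime p ^ e)) : Delta K :=
  if h : ofPrime p ∣ n then
    symb σ - normSum (Dvd.intro _ rfl) τ
  else
    symb σ - symb ((frob h)⁻¹ * σ) - normSum (Dvd.intro _ rfl) τ

/-- The subgroup `Δ_m` of `Δ` generated by the `σ ∈ G_n` with `n ∣ m`. -/
def DeltaLevel (m : IntIdeal K) : AddSubgroup (Delta K) :=
  AddSubgroup.closure {x | ∃ (n : IntIdeal K) (σ : RayClassGroup n), n ∣ m ∧ x = symb σ}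

/-- The subgroup `U(m)` of `Δ_m` generated by the `S(n, p^e, σ)` with `e ≥ 1` and `n p^e ∣ m`. -/
def ULevel (m : IntIdeal K) : AddSubgroup (Delta K) :=
  AddSubgroup.closure {x | ∃ (n : IntIdeal K) (p : HeightOneSpectrum (𝓞 K)) (e : ℕ)
    (σ : RayClassGroup n) (τ : RayClassGroup (n * ofPrime p ^ e)),
    1 ≤ e ∧ n * ofPrime p ^ e ∣ m ∧ res (Dvd.intro _ rfl) τ = σ ∧ x = relS n p e σ τ}

/-! ### The universal ordinary distribution -/

/-- The relation `a ∼_n b` on nonzero integral ideals: `gcd(a, n) = gcd(b, n)` and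
`b a⁻¹ ∈ R_{n'}`, where `n' gcd(a, n) = n`. -/
def RayEquiv (n a b : IntIdeal K) : Prop :=
  (a : Ideal (𝓞 K)) ⊔ n = (b : Ideal (𝓞 K)) ⊔ n ∧
    ∃ n' : IntIdeal K, (n' : Ideal (𝓞 K)) * ((a : Ideal (𝓞 K)) ⊔ n) = n ∧
      toFrac b * (toFrac a)⁻¹ ∈ ray n'

/-- For `u ∣ v`, the finite set `w` is a system of representatives of the inverse image, under the
map from `∼_v`-classes to `∼_u`-classes, of the `∼_u`-class of `a`. -/
def IsRepSystem (u v a : IntIdeal K) (w : Finset (IntIdeal K)) : Prop :=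
  (∀ b ∈ w, RayEquiv u a b) ∧ ∀ c, RayEquiv u a c → ∃! b, b ∈ w ∧ RayEquiv v c b

variable (K) in
/-- The subgroup of the free abelian group on the fractional ideals that is generated by the
distribution relations `[a u⁻¹] - ∑_{b ∈ w} [b v⁻¹]`, for `u ∣ v` and `w` a system of
representatives of the inverse image of the class of `a` modulo `∼_u`. -/
def distRel : AddSubgroup (FracIdeal K →₀ ℤ) :=
  AddSubgroup.closure {x | ∃ (a u v : IntIdeal K) (w : Finset (IntIdeal K)),
    u ∣ v ∧ IsRepSystem u v a w ∧
    x = Finsupp.single (toFrac a * (toFrac u)⁻¹) 1 -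
      ∑ b ∈ w, Finsupp.single (toFrac b * (toFrac v)⁻¹) 1}

variable (K) in
/-- The universal ordinary distribution on `K`. -/
abbrev UnivOrdDist : Type _ := (FracIdeal K →₀ ℤ) ⧸ distRel K

/-- The group of level `m` of the universal ordinary distribution: the image of the subgroup
generated by the symbols `[a m⁻¹]`, for `a` a nonzero integral ideal. -/
def level (m : IntIdeal K) : AddSubgroup (UnivOrdDist K) :=
  (AddSubgroup.closure {x : FracIdeal K →₀ ℤ | ∃ a : IntIdeal K,
    x = Finsupp.single (toFrac a * (toFrac m)⁻¹) 1}).map (QuotientAddGroup.mk' (distRel K))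

end UnivDist

end

/-!
The units of `𝓞 K` are `1` and `-1`, so the ray class group `G` of level `m` is an extension of the
ideal class group by the quotient of `A 0 × A 1 × A 2`, `A i = (𝓞 K / p i)ˣ`, by the simultaneous
sign change (`PrimeTriple.theta`). As the norms are `3` modulo `4`, the group `A i` is the product
of the group `{1, e i}` of signs and a subgroup `B i` of odd order, and `e 0 * e 1 * e 2` acts
trivially on everything.

*Torsion elements.* Fix an ideal class, and let `s` be the sum of the translates, by
`B 0 × B 1 × B 2`, of an element of level `m` above it. The norm relations express `(1 + e i) s` as
twice an element of lower level. Since `2 = (1 + e 2) + (1 + e 0) - e 0 (1 + e 1)` on these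
elements, `2 s = 2 w` with `w` of lower level, and `s - w` is killed by `2` in `Δ_m / U(m)`
(`LevelSystem.exists_torsion`). The number of elements of level `m` in each ideal class is well
defined modulo `2` on `Δ_m / U(m)`, because each `A i` has even order, and it is odd for `s - w`
(`PrimeTriple.parity`). So these elements, one for each ideal class, are independent over `ZMod 2`.

*There is no further torsion.* Eliminating with the norm relations shows that `Δ_m / U(m)` is
generated by the elements `s - w` and by at most `|G|` others (`LevelSystem.z_mem`,
`card_genIndex_le`, `PrimeTriple.card_rayClassGroup`). On the other hand it maps to the group
algebra `ℚ[G]` (`PrimeTriple.toGroupAlg`), and the image spans, by a computation with the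
idempotents of the trivial characters of the `A i`. Hence the images of the other generators are
linearly independent, and a torsion element is a combination of the elements `s - w` alone
(`mem_of_map_eq_zero`, `PrimeTriple.nonempty_torsion_equiv`).

*The universal distribution.* Sending the class of an ideal `a` modulo `n` to `[a n⁻¹]` defines a
homomorphism from `Δ_m / U(m)` to the group of level `m` (`deltaToDist`). The function that sends a
fractional ideal to `1` if the primes in its denominator are exactly the three given ones, and to
`0` otherwise, satisfies the distribution relations modulo `2` (`denIndicator_prime_step`). It takes
the value `1` on the image of `s - w`, which is therefore a nonzero torsion element
(`PrimeTriple.torsion_level_ne_bot`).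
-/

set_option linter.unusedSectionVars false

noncomputable section

namespace UnivDist

section

variable {K : Type*} [Field K] [NumberField K]

/-! ### Orders at primes -/

lemma IntIdeal.ne_bot (I : IntIdeal K) : (I : Ideal (𝓞 K)) ≠ ⊥ := nonZeroDivisors.coe_ne_zero I

/-- The exponent of the maximal ideal `q` in the factorization of `I`. -/
def ord (q : HeightOneSpectrum (𝓞 K)) (I : IntIdeal K) : ℕ :=
  multiplicity q.asIdeal (I : Ideal (𝓞 K))

lemma finiteMultiplicity (q : HeightOneSpectrum (𝓞 K)) (I : IntIdeal K) :
    FiniteMultiplicity q.asIdeal (I : Ideal (𝓞 K)) :=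
  FiniteMultiplicity.of_prime_left q.prime I.ne_bot

lemma count_toFrac (q : HeightOneSpectrum (𝓞 K)) (I : IntIdeal K) :
    FractionalIdeal.count K q (toFrac I : FractionalIdeal (𝓞 K)⁰ K) = ord q I := by
  classical
  have h : ((toFrac I : FracIdeal K) : FractionalIdeal (𝓞 K)⁰ K) = (I : Ideal (𝓞 K)) := rfl
  rw [h, FractionalIdeal.count_coe K q I.ne_bot, ord,
    ← HeightOneSpectrum.count_normalizedFactors_eq_multiplicity I.ne_bot,
    Ideal.count_associates_factors_eq I.ne_bot q.isPrime q.ne_bot]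

lemma ord_mul (q : HeightOneSpectrum (𝓞 K)) (I J : IntIdeal K) :
    ord q (I * J) = ord q I + ord q J :=
  multiplicity_mul q.prime (finiteMultiplicity q (I * J))

lemma ord_one (q : HeightOneSpectrum (𝓞 K)) : ord q (1 : IntIdeal K) = 0 := by
  have := ord_mul q (1 : IntIdeal K) 1
  rw [mul_one] at this; omega

lemma pow_dvd_iff_le_ord {q : HeightOneSpectrum (𝓞 K)} {I : IntIdeal K} {k : ℕ} :
    q.asIdeal ^ k ∣ (I : Ideal (𝓞 K)) ↔ k ≤ ord q I :=
  (finiteMultiplicity q I).pow_dvd_iff_le_multiplicity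

lemma asIdeal_dvd_iff {q : HeightOneSpectrum (𝓞 K)} {I : IntIdeal K} :
    q.asIdeal ∣ (I : Ideal (𝓞 K)) ↔ 1 ≤ ord q I := by
  rw [← pow_dvd_iff_le_ord, pow_one]

lemma coe_dvd_coe {I J : IntIdeal K} : (I : Ideal (𝓞 K)) ∣ (J : Ideal (𝓞 K)) ↔ I ∣ J := by
  constructor
  · rintro ⟨c, hc⟩
    refine ⟨⟨c, mem_nonZeroDivisors_of_ne_zero ?_⟩, Subtype.ext hc⟩
    rintro rfl
    exact J.ne_bot (by rw [hc, mul_zero]; rfl)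
  · rintro ⟨c, rfl⟩
    exact ⟨c, rfl⟩

lemma dvd_iff_le {I J : IntIdeal K} : I ∣ J ↔ (J : Ideal (𝓞 K)) ≤ I := by
  rw [← coe_dvd_coe, Ideal.dvd_iff_le]

lemma ofPrime_dvd_iff {q : HeightOneSpectrum (𝓞 K)} {I : IntIdeal K} :
    ofPrime q ∣ I ↔ 1 ≤ ord q I := by
  rw [← asIdeal_dvd_iff, ← coe_dvd_coe]; rfl

lemma ord_ofPrime_self (q : HeightOneSpectrum (𝓞 K)) : ord q (ofPrime q) = 1 := by
  have := count_toFrac q (ofPrime q)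
  have h2 := FractionalIdeal.count_self (K := K) (v := q)
  have h : ((toFrac (ofPrime q) : FracIdeal K) : FractionalIdeal (𝓞 K)⁰ K) = q.asIdeal := rfl
  rw [h, h2] at this
  exact_mod_cast this.symm

lemma ord_ofPrime_of_ne {q r : HeightOneSpectrum (𝓞 K)} (h : q ≠ r) : ord q (ofPrime r) = 0 := by
  have := count_toFrac q (ofPrime r)
  have h2 := FractionalIdeal.count_maximal_coprime K q (w := r) h.symm
  have h : ((toFrac (ofPrime r) : FracIdeal K) : FractionalIdeal (𝓞 K)⁰ K) = r.asIdeal := rfl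
  rw [h, h2] at this
  exact_mod_cast this.symm

lemma frac_ext {I J : FracIdeal K} (h : ∀ q : HeightOneSpectrum (𝓞 K),
    FractionalIdeal.count K q (I : FractionalIdeal (𝓞 K)⁰ K) =
      FractionalIdeal.count K q (J : FractionalIdeal (𝓞 K)⁰ K)) : I = J := by
  apply Units.ext
  rw [← FractionalIdeal.finprod_heightOneSpectrum_factorization' K I.ne_zero,
    ← FractionalIdeal.finprod_heightOneSpectrum_factorization' K J.ne_zero]
  simp_rw [h]

lemma toFrac_injective : Function.Injective (toFrac : IntIdeal K → FracIdeal K) := by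
  intro I J h
  apply Subtype.ext
  have : ((toFrac I : FracIdeal K) : FractionalIdeal (𝓞 K)⁰ K) = (toFrac J : FracIdeal K) := by
    rw [h]
  exact FractionalIdeal.coeIdeal_injective this

lemma intIdeal_ext {I J : IntIdeal K} (h : ∀ q, ord q I = ord q J) : I = J :=
  toFrac_injective (frac_ext fun q => by rw [count_toFrac, count_toFrac, h])

/-- The greatest common divisor of two nonzero integral ideals. -/
def supI (a b : IntIdeal K) : IntIdeal K :=
  ⟨(a : Ideal (𝓞 K)) ⊔ b, mem_nonZeroDivisors_of_ne_zero fun h =>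
    a.ne_bot (le_bot_iff.1 (le_sup_left.trans h.le))⟩

lemma coe_supI (a b : IntIdeal K) : (supI a b : Ideal (𝓞 K)) = (a : Ideal (𝓞 K)) ⊔ b := rfl

lemma ord_supI (q : HeightOneSpectrum (𝓞 K)) (a b : IntIdeal K) :
    ord q (supI a b) = min (ord q a) (ord q b) :=
  HeightOneSpectrum.multiplicity_sup q a.ne_bot b.ne_bot

lemma dvd_iff_ord {I J : IntIdeal K} : I ∣ J ↔ ∀ q, ord q I ≤ ord q J := by
  constructor
  · rintro ⟨c, rfl⟩ q
    rw [ord_mul]; omega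
  · intro h
    have : supI I J = I := intIdeal_ext fun q => by rw [ord_supI]; exact min_eq_left (h q)
    rw [dvd_iff_le, ← congrArg (fun x : IntIdeal K => (x : Ideal (𝓞 K))) this]
    exact le_sup_right

lemma sup_eq_sup_iff {a b u : IntIdeal K} :
    (a : Ideal (𝓞 K)) ⊔ u = (b : Ideal (𝓞 K)) ⊔ u ↔
      ∀ q, min (ord q a) (ord q u) = min (ord q b) (ord q u) := by
  constructor
  · intro h q
    rw [← ord_supI, ← ord_supI]
    congr 1
    exact Subtype.ext h
  · intro h
    exact congrArg (fun x : IntIdeal K => (x : Ideal (𝓞 K)))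
      (intIdeal_ext fun q => by rw [ord_supI, ord_supI, h] : supI a u = supI b u)

lemma isCoprime_iff_ord {I n : IntIdeal K} : IsCoprime (I : Ideal (𝓞 K)) (n : Ideal (𝓞 K)) ↔
    ∀ q, ofPrime q ∣ n → ord q I = 0 := by
  rw [Ideal.isCoprime_iff_sup_eq]
  constructor
  · intro h q hq
    have h1 : supI I n = 1 := Subtype.ext (by rw [coe_supI, h]; exact Ideal.one_eq_top.symm)
    have := ord_supI q I n
    rw [h1, ord_one] at this
    have := ofPrime_dvd_iff.1 hq
    omega
  · intro h
    have h1 : supI I n = 1 := intIdeal_ext fun q => by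
      rw [ord_supI, ord_one]
      by_cases hq : ofPrime q ∣ n
      · rw [h q hq]; simp
      · rw [ofPrime_dvd_iff] at hq; omega
    rw [← coe_supI, h1]
    exact Ideal.one_eq_top

lemma toFrac_mem_primeTo {I n : IntIdeal K} :
    toFrac I ∈ primeTo n ↔ IsCoprime (I : Ideal (𝓞 K)) (n : Ideal (𝓞 K)) := by
  rw [isCoprime_iff_ord]
  constructor
  · intro h q hq
    have := h q (asIdeal_dvd_iff.2 (ofPrime_dvd_iff.1 hq))
    rw [count_toFrac] at this
    exact_mod_cast this
  · intro h q hq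
    rw [count_toFrac, h q (ofPrime_dvd_iff.2 (asIdeal_dvd_iff.1 hq))]; rfl

/-! ### Principal ideals and the ray -/

/-- The principal ideal generated by a nonzero integer of `K`. -/
def prin : (𝓞 K)⁰ →* IntIdeal K where
  toFun x := ⟨Ideal.span {(x : 𝓞 K)}, mem_nonZeroDivisors_of_ne_zero (by
    simp)⟩
  map_one' := Subtype.ext (by simp)
  map_mul' x y := Subtype.ext (by simp [Ideal.span_singleton_mul_span_singleton])

lemma coe_prin (x : (𝓞 K)⁰) : (prin x : Ideal (𝓞 K)) = Ideal.span {(x : 𝓞 K)} := rfl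

/-- A nonzero integer of `K` as an element of `Kˣ`. -/
def toUnit : (𝓞 K)⁰ →* Kˣ where
  toFun x := Units.mk0 (algebraMap (𝓞 K) K x) (by simp)
  map_one' := by ext; simp
  map_mul' x y := by ext; simp

lemma coe_toUnit (x : (𝓞 K)⁰) : ((toUnit x : Kˣ) : K) = ((x : 𝓞 K) : K) := rfl

lemma toPrincipalIdeal_toUnit (x : (𝓞 K)⁰) :
    toPrincipalIdeal (𝓞 K) K (toUnit x) = toFrac (prin x) := by
  rw [toPrincipalIdeal_eq_iff]
  change _ = ((Ideal.span {(x : 𝓞 K)} : Ideal (𝓞 K)) : FractionalIdeal (𝓞 K)⁰ K)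
  rw [FractionalIdeal.coeIdeal_span_singleton]
  rfl

/-- The condition that `±1` are the only units of `𝓞 K` and that `K` has no real embedding, so that
the positivity condition in the definition of the ray is empty. -/
class HasTrivialUnits (K : Type*) [Field K] [NumberField K] : Prop where
  units : ∀ u : (𝓞 K)ˣ, u = 1 ∨ u = -1
  noReal : IsEmpty (K →+* ℝ)

variable [HasTrivialUnits K]

lemma mem_ray_iff {n : IntIdeal K} {I : FracIdeal K} : I ∈ ray n ↔
    ∃ a b : (𝓞 K)⁰, IsCoprime (prin b : Ideal (𝓞 K)) (n : Ideal (𝓞 K)) ∧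
      (a : 𝓞 K) - b ∈ (n : Ideal (𝓞 K)) ∧ I * toFrac (prin b) = toFrac (prin a) := by
  constructor
  · rintro ⟨x, ⟨⟨a, b, hb, hc, hab, hx⟩, -⟩, rfl⟩
    have ha : a ≠ 0 := by
      rintro rfl
      exact x.ne_zero (by rw [hx]; simp)
    refine ⟨⟨a, mem_nonZeroDivisors_of_ne_zero ha⟩, ⟨b, mem_nonZeroDivisors_of_ne_zero hb⟩,
      hc, hab, ?_⟩
    rw [← toPrincipalIdeal_toUnit, ← toPrincipalIdeal_toUnit, ← map_mul]
    congr 1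
    ext
    rw [Units.val_mul, hx, coe_toUnit, coe_toUnit]
    exact div_mul_cancel₀ _ (by simpa using hb)
  · rintro ⟨a, b, hc, hab, h⟩
    refine ⟨toUnit a / toUnit b, ⟨⟨a, b, nonZeroDivisors.coe_ne_zero b, hc, hab, ?_⟩,
      fun σ => (HasTrivialUnits.noReal.false σ).elim⟩, ?_⟩
    · rw [Units.val_div_eq_div_val]; rfl
    · rw [map_div, toPrincipalIdeal_toUnit, toPrincipalIdeal_toUnit, ← h, mul_div_cancel_right]

lemma neg_mem_nzd (y : (𝓞 K)⁰) : -(y : 𝓞 K) ∈ (𝓞 K)⁰ :=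
  mem_nonZeroDivisors_of_ne_zero (neg_ne_zero.2 (nonZeroDivisors.coe_ne_zero y))

lemma prin_eq_prin_iff {x y : (𝓞 K)⁰} : prin x = prin y ↔ (x : 𝓞 K) = y ∨ (x : 𝓞 K) = -y := by
  constructor
  · intro h
    have h1 : Ideal.span {(x : 𝓞 K)} = Ideal.span {(y : 𝓞 K)} := congrArg Subtype.val h
    rw [Ideal.span_singleton_eq_span_singleton] at h1
    obtain ⟨u, hu⟩ := h1
    rcases HasTrivialUnits.units u with rfl | rfl
    · left; rw [← hu]; simp
    · right; rw [← hu]; simp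
  · intro h
    apply Subtype.ext
    rw [coe_prin, coe_prin]
    rcases h with h | h
    · rw [h]
    · rw [h, Ideal.span_singleton_neg]

/-- Cancellation of an integer prime to `n` modulo `n`. -/
lemma mem_of_mul_mem_of_isCoprime {n : Ideal (𝓞 K)} {b x : 𝓞 K}
    (hb : IsCoprime (Ideal.span {b}) n) (h : b * x ∈ n) : x ∈ n := by
  rw [Ideal.isCoprime_iff_exists] at hb
  obtain ⟨i, hi, j, hj, hij⟩ := hb
  obtain ⟨c, rfl⟩ := Ideal.mem_span_singleton'.1 hi
  have : x = c * (b * x) + x * j := by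
    calc x = x * (c * b + j) := by rw [hij, mul_one]
      _ = _ := by ring
  rw [this]
  exact n.add_mem (n.mul_mem_left _ h) (n.mul_mem_left _ hj)

/-- Since `±1` are the only units, two integers prime to `n` generate ideals in the same ray class
if and only if they are congruent modulo `n` up to sign. -/
lemma prin_div_prin_mem_ray {n : IntIdeal K} {x y : (𝓞 K)⁰}
    (hy : IsCoprime (prin y : Ideal (𝓞 K)) (n : Ideal (𝓞 K))) :
    toFrac (prin x) * (toFrac (prin y))⁻¹ ∈ ray n ↔
      (x : 𝓞 K) - y ∈ (n : Ideal (𝓞 K)) ∨ (x : 𝓞 K) + y ∈ (n : Ideal (𝓞 K)) := by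
  rw [mem_ray_iff]
  constructor
  · rintro ⟨a, b, hb, hab, h⟩
    have h1 : toFrac (prin (x * b)) = toFrac (prin (a * y)) := by
      rw [map_mul, map_mul, map_mul, map_mul, ← h, mul_right_comm, inv_mul_cancel_right]
    rcases prin_eq_prin_iff.1 (toFrac_injective h1) with h2 | h2
    · left
      refine mem_of_mul_mem_of_isCoprime hb ?_
      have : (b : 𝓞 K) * (x - y) = (y : 𝓞 K) * (a - b) := by
        have : (x : 𝓞 K) * b = a * y := h2
        linear_combination this
      rw [this]
      exact Ideal.mul_mem_left _ _ hab
    · right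
      refine mem_of_mul_mem_of_isCoprime hb ?_
      have : (b : 𝓞 K) * (x + y) = (-y : 𝓞 K) * (a - b) := by
        have : (x : 𝓞 K) * b = -(a * y) := h2
        linear_combination this
      rw [this]
      exact Ideal.mul_mem_left _ _ hab
  · rintro (h | h)
    · exact ⟨x, y, hy, h, by rw [inv_mul_cancel_right]⟩
    · refine ⟨x, ⟨-(y : 𝓞 K), neg_mem_nzd y⟩, ?_, by simpa using h, ?_⟩
      · rw [coe_prin, Ideal.span_singleton_neg]; exact hy
      · have : prin (⟨-(y : 𝓞 K), neg_mem_nzd y⟩ : (𝓞 K)⁰) = prin y :=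
          prin_eq_prin_iff.2 (Or.inr rfl)
        rw [this, inv_mul_cancel_right]

lemma prin_mem_ray {n : IntIdeal K} {x : (𝓞 K)⁰} :
    toFrac (prin x) ∈ ray n ↔
      (x : 𝓞 K) - 1 ∈ (n : Ideal (𝓞 K)) ∨ (x : 𝓞 K) + 1 ∈ (n : Ideal (𝓞 K)) := by
  have h := prin_div_prin_mem_ray (n := n) (x := x) (y := 1) (by
    rw [map_one]; exact isCoprime_one_left)
  simpa using h

end

section

variable {K : Type*} [Field K] [NumberField K]

/-! ### Ideals in a given ray class -/

/-- Every fractional ideal is a quotient of coprime integral ideals. -/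
lemma exists_coprime_div (I : FracIdeal K) : ∃ A B : IntIdeal K,
    I * toFrac B = toFrac A ∧ ∀ q, ord q A = 0 ∨ ord q B = 0 := by
  obtain ⟨a, J, ha, hJ⟩ := FractionalIdeal.exists_eq_spanSingleton_mul
    (I : FractionalIdeal (𝓞 K)⁰ K)
  have hJ0 : J ≠ 0 := by
    rintro rfl
    exact I.ne_zero (by rw [hJ]; simp)
  let a' : (𝓞 K)⁰ := ⟨a, mem_nonZeroDivisors_of_ne_zero ha⟩
  let J' : IntIdeal K := ⟨J, mem_nonZeroDivisors_of_ne_zero hJ0⟩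
  have h1 : I = (toPrincipalIdeal (𝓞 K) K (toUnit a'))⁻¹ * toFrac J' := by
    apply Units.ext
    rw [← map_inv, Units.val_mul, coe_toPrincipalIdeal, hJ, Units.val_inv_eq_inv_val, coe_toUnit]
    rfl
  rw [toPrincipalIdeal_toUnit] at h1
  obtain ⟨A, hA⟩ : supI J' (prin a') ∣ J' := dvd_iff_ord.2 fun q => by
    rw [ord_supI]; exact min_le_left _ _
  obtain ⟨B, hB⟩ : supI J' (prin a') ∣ prin a' := dvd_iff_ord.2 fun q => by
    rw [ord_supI]; exact min_le_right _ _
  refine ⟨A, B, ?_, fun q => ?_⟩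
  · generalize supI J' (prin a') = G at *
    rw [h1, hA, hB, map_mul, map_mul, mul_assoc, inv_mul_eq_iff_eq_mul, mul_right_comm]
  · have h2 := congrArg (ord q) hA
    have h3 := congrArg (ord q) hB
    rw [ord_mul, ord_supI] at h2 h3
    omega

lemma IsCoprime.intIdeal_mul {I J n : IntIdeal K}
    (hI : IsCoprime (I : Ideal (𝓞 K)) (n : Ideal (𝓞 K)))
    (hJ : IsCoprime (J : Ideal (𝓞 K)) (n : Ideal (𝓞 K))) :
    IsCoprime ((I * J : IntIdeal K) : Ideal (𝓞 K)) (n : Ideal (𝓞 K)) := by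
  rw [Submonoid.coe_mul]; exact hI.mul_left hJ

lemma isCoprime_of_dvd_left {I J n : IntIdeal K} (h : I ∣ J)
    (hJ : IsCoprime (J : Ideal (𝓞 K)) (n : Ideal (𝓞 K))) :
    IsCoprime (I : Ideal (𝓞 K)) (n : Ideal (𝓞 K)) :=
  hJ.of_isCoprime_of_dvd_left (coe_dvd_coe.2 h)

lemma isCoprime_of_dvd_right {I n n' : IntIdeal K} (h : n ∣ n')
    (hJ : IsCoprime (I : Ideal (𝓞 K)) (n' : Ideal (𝓞 K))) :
    IsCoprime (I : Ideal (𝓞 K)) (n : Ideal (𝓞 K)) :=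
  hJ.of_isCoprime_of_dvd_right (coe_dvd_coe.2 h)

lemma isCoprime_prin_of_sub_one_mem {n : IntIdeal K} {x : (𝓞 K)⁰} {y : 𝓞 K}
    (h : (x : 𝓞 K) * y - 1 ∈ (n : Ideal (𝓞 K))) :
    IsCoprime (prin x : Ideal (𝓞 K)) (n : Ideal (𝓞 K)) := by
  rw [Ideal.isCoprime_iff_exists]
  refine ⟨x * y, ?_, _, neg_mem h, by ring⟩
  rw [coe_prin, mul_comm]
  exact Ideal.mul_mem_left _ _ (Ideal.mem_span_singleton_self _)

lemma exists_mem_nonZeroDivisors (J : IntIdeal K) : ∃ x : (𝓞 K)⁰, J ∣ prin x := by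
  obtain ⟨x, hx, hx0⟩ := Submodule.exists_mem_ne_zero_of_ne_bot J.ne_bot
  exact ⟨⟨x, mem_nonZeroDivisors_of_ne_zero hx0⟩,
    dvd_iff_le.2 ((Ideal.span_singleton_le_iff_mem _).2 hx)⟩

lemma eq_one_of_one_mem {n : IntIdeal K} (h : (1 : 𝓞 K) ∈ (n : Ideal (𝓞 K))) : n = 1 :=
  Subtype.ext (((Ideal.eq_top_iff_one _).2 h).trans Ideal.one_eq_top.symm)

lemma mem_coe_one (x : 𝓞 K) : x ∈ ((1 : IntIdeal K) : Ideal (𝓞 K)) := by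
  rw [OneMemClass.coe_one, Ideal.one_eq_top]; exact Submodule.mem_top

lemma exists_dvd_prin_sub_one_mem {B n : IntIdeal K}
    (h : IsCoprime (B : Ideal (𝓞 K)) (n : Ideal (𝓞 K))) :
    ∃ β : (𝓞 K)⁰, B ∣ prin β ∧ (β : 𝓞 K) - 1 ∈ (n : Ideal (𝓞 K)) := by
  rw [Ideal.isCoprime_iff_exists] at h
  obtain ⟨i, hi, j, hj, hij⟩ := h
  by_cases h0 : i = 0
  · rw [h0, zero_add] at hij
    rw [hij] at hj
    obtain ⟨β, hβ⟩ := exists_mem_nonZeroDivisors B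
    refine ⟨β, hβ, ?_⟩
    rw [eq_one_of_one_mem hj]
    exact mem_coe_one _
  · refine ⟨⟨i, mem_nonZeroDivisors_of_ne_zero h0⟩,
      dvd_iff_le.2 ((Ideal.span_singleton_le_iff_mem _).2 hi), ?_⟩
    have : i - 1 = -j := by rw [← hij]; ring
    change i - 1 ∈ _
    rw [this]
    exact neg_mem hj

/-- Every ideal class contains integral ideals prime to a given ideal `M`. -/
lemma exists_mul_eq_prin_isCoprime (J M : IntIdeal K) : ∃ (C : IntIdeal K) (α : (𝓞 K)⁰),
    J * C = prin α ∧ IsCoprime (C : Ideal (𝓞 K)) (M : Ideal (𝓞 K)) := by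
  obtain ⟨a, ha⟩ := IsDedekindDomain.exists_sup_span_eq
    (dvd_iff_le.1 (Dvd.intro M rfl : J ∣ J * M)) (J * M).ne_bot
  by_cases h0 : a = 0
  · have h1 : J * M = J := Subtype.ext (by rw [← ha, h0]; simp)
    have h2 : M = 1 := intIdeal_ext fun q => by
      have := congrArg (ord q) h1
      rw [ord_mul] at this
      rw [ord_one]; omega
    obtain ⟨x, C, hC⟩ := exists_mem_nonZeroDivisors J
    exact ⟨C, x, hC.symm, by rw [h2]; exact isCoprime_one_right⟩
  · let α : (𝓞 K)⁰ := ⟨a, mem_nonZeroDivisors_of_ne_zero h0⟩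
    have h1 : supI (J * M) (prin α) = J := Subtype.ext ha
    obtain ⟨C, hC⟩ : J ∣ prin α := dvd_iff_ord.2 fun q => by
      have := congrArg (ord q) h1
      rw [ord_supI] at this
      omega
    refine ⟨C, α, hC.symm, isCoprime_iff_ord.2 fun q hq => ?_⟩
    rw [ofPrime_dvd_iff] at hq
    have := congrArg (ord q) h1
    rw [hC, ord_supI, ord_mul, ord_mul] at this
    omega

/-- The class in `G_n` of a nonzero integral ideal prime to `n`. -/
def idealClass {n : IntIdeal K} (J : IntIdeal K)
    (h : IsCoprime (J : Ideal (𝓞 K)) (n : Ideal (𝓞 K))) : RayClassGroup n :=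
  QuotientGroup.mk ⟨toFrac J, toFrac_mem_primeTo.2 h⟩

lemma idealClass_eq_iff {n I J : IntIdeal K} {hI : IsCoprime (I : Ideal (𝓞 K)) (n : Ideal (𝓞 K))}
    {hJ : IsCoprime (J : Ideal (𝓞 K)) (n : Ideal (𝓞 K))} :
    idealClass I hI = idealClass J hJ ↔ toFrac J * (toFrac I)⁻¹ ∈ ray n := by
  rw [idealClass, idealClass, QuotientGroup.eq, Subgroup.mem_subgroupOf, mul_comm]
  rfl

lemma idealClass_mul {n I J : IntIdeal K} (hI : IsCoprime (I : Ideal (𝓞 K)) (n : Ideal (𝓞 K)))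
    (hJ : IsCoprime (J : Ideal (𝓞 K)) (n : Ideal (𝓞 K))) :
    idealClass (I * J) (IsCoprime.intIdeal_mul hI hJ) = idealClass I hI * idealClass J hJ := by
  rw [idealClass, idealClass, idealClass, ← QuotientGroup.mk_mul]
  congr 1
  exact Subtype.ext (map_mul _ _ _)

lemma idealClass_eq_one_iff {n I : IntIdeal K}
    {hI : IsCoprime (I : Ideal (𝓞 K)) (n : Ideal (𝓞 K))} :
    idealClass I hI = 1 ↔ toFrac I ∈ ray n := by
  rw [idealClass, QuotientGroup.eq_one_iff, Subgroup.mem_subgroupOf]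

lemma res_idealClass {n n' I : IntIdeal K} (h : n ∣ n')
    (hI : IsCoprime (I : Ideal (𝓞 K)) (n' : Ideal (𝓞 K))) :
    res h (idealClass I hI) = idealClass I (isCoprime_of_dvd_right h hI) := rfl

lemma res_res {n n' n'' : IntIdeal K} (h : n ∣ n') (h' : n' ∣ n'') (g : RayClassGroup n'') :
    res h (res h' g) = res (h.trans h') g := by
  obtain ⟨I, rfl⟩ := QuotientGroup.mk_surjective g
  rfl

lemma frob_eq {n : IntIdeal K} {p : HeightOneSpectrum (𝓞 K)} (h : ¬ ofPrime p ∣ n)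
    (h' : IsCoprime (ofPrime p : Ideal (𝓞 K)) (n : Ideal (𝓞 K))) :
    frob h = idealClass (ofPrime p) h' := rfl

lemma isCoprime_ofPrime {n : IntIdeal K} {p : HeightOneSpectrum (𝓞 K)} (h : ¬ ofPrime p ∣ n) :
    IsCoprime (ofPrime p : Ideal (𝓞 K)) (n : Ideal (𝓞 K)) :=
  toFrac_mem_primeTo.1 (ofPrime_mem_primeTo h)

/-- The map from the ray class group to the ideal class group. -/
def toClassGroup (n : IntIdeal K) : RayClassGroup n →* ClassGroup (𝓞 K) :=
  QuotientGroup.lift _ ((ClassGroup.mk K).comp (primeTo n).subtype) (by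
    rintro ⟨I, hI⟩ h
    obtain ⟨x, -, hx⟩ := Subgroup.mem_subgroupOf.1 h
    change ClassGroup.mk K I = 1
    change _ = I at hx
    rw [← hx, ClassGroup.mk_eq_one_iff, coe_toPrincipalIdeal]
    exact ⟨⟨x, FractionalIdeal.coe_spanSingleton _ _⟩⟩)

lemma toClassGroup_idealClass {n J : IntIdeal K}
    (h : IsCoprime (J : Ideal (𝓞 K)) (n : Ideal (𝓞 K))) :
    toClassGroup n (idealClass J h) = ClassGroup.mk0 J :=
  ClassGroup.mk_mk0 (K := K) J

lemma toClassGroup_res {n n' : IntIdeal K} (h : n ∣ n') (g : RayClassGroup n') :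
    toClassGroup n (res h g) = toClassGroup n' g := by
  obtain ⟨I, rfl⟩ := QuotientGroup.mk_surjective g
  rfl

lemma toClassGroup_surjective (n : IntIdeal K) : Function.Surjective (toClassGroup n) := by
  intro c
  obtain ⟨J, hJ⟩ := ClassGroup.mk0_surjective c⁻¹
  obtain ⟨C, α, h, hC⟩ := exists_mul_eq_prin_isCoprime J n
  refine ⟨idealClass C hC, ?_⟩
  rw [toClassGroup_idealClass, ← inv_inv c, ← hJ, eq_inv_iff_mul_eq_one, ← map_mul, mul_comm, h,
    ClassGroup.mk0_eq_one_iff]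
  exact ⟨⟨_, rfl⟩⟩

variable [HasTrivialUnits K]

/-- Every class modulo `n` is represented by an integral ideal: the denominator of a fractional
ideal prime to `n` divides a principal ideal in the ray. -/
lemma exists_idealClass_eq {n : IntIdeal K} (σ : RayClassGroup n) : ∃ (J : IntIdeal K)
    (h : IsCoprime (J : Ideal (𝓞 K)) (n : Ideal (𝓞 K))), idealClass J h = σ := by
  obtain ⟨⟨I, hI⟩, rfl⟩ := QuotientGroup.mk_surjective σ
  obtain ⟨A, B, hAB, h0⟩ := exists_coprime_div I
  have hcnt : ∀ q, ofPrime q ∣ n → ord q A = ord q B := fun q hq => by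
    have h1 := hI q (asIdeal_dvd_iff.2 (ofPrime_dvd_iff.1 hq))
    have h2 := congrArg (fun x : FracIdeal K =>
      FractionalIdeal.count K q (x : FractionalIdeal (𝓞 K)⁰ K)) hAB
    simp only [Units.val_mul] at h2
    rw [FractionalIdeal.count_mul K q I.ne_zero (toFrac B).ne_zero, h1, count_toFrac, count_toFrac,
      zero_add] at h2
    exact_mod_cast h2.symm
  have hA : IsCoprime (A : Ideal (𝓞 K)) (n : Ideal (𝓞 K)) := isCoprime_iff_ord.2 fun q hq => by
    have := hcnt q hq
    have := h0 q
    omega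
  have hB : IsCoprime (B : Ideal (𝓞 K)) (n : Ideal (𝓞 K)) := isCoprime_iff_ord.2 fun q hq => by
    have := hcnt q hq
    have := h0 q
    omega
  obtain ⟨β, ⟨C, hC⟩, hβ⟩ := exists_dvd_prin_sub_one_mem hB
  have hβn : IsCoprime (prin β : Ideal (𝓞 K)) (n : Ideal (𝓞 K)) :=
    isCoprime_prin_of_sub_one_mem (y := 1) (by rwa [mul_one])
  refine ⟨A * C, IsCoprime.intIdeal_mul hA (isCoprime_of_dvd_left (Dvd.intro_left B hC.symm) hβn),
    ?_⟩
  rw [idealClass, QuotientGroup.eq, Subgroup.mem_subgroupOf, ← inv_mem_iff]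
  have : ((⟨toFrac (A * C), toFrac_mem_primeTo.2 (IsCoprime.intIdeal_mul hA
      (isCoprime_of_dvd_left (Dvd.intro_left B hC.symm) hβn))⟩ : primeTo n)⁻¹ * ⟨I, hI⟩ :
        primeTo n)⁻¹ = toFrac (prin β) := by
    change ((toFrac (A * C))⁻¹ * I)⁻¹ = toFrac (prin β)
    rw [mul_inv, inv_inv, map_mul, ← hAB, hC, map_mul, mul_right_comm, mul_right_comm I,
      mul_inv_cancel, one_mul]
  refine (congrArg (· ∈ ray n) this).mpr ?_
  exact prin_mem_ray.2 (Or.inl hβ)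

/-- A class modulo `n` is represented by an integral ideal prime to `n n''` if `n` and `n''` are
coprime. -/
lemma exists_isCoprime_mul_idealClass_eq {n n'' : IntIdeal K}
    (hn : IsCoprime (n : Ideal (𝓞 K)) (n'' : Ideal (𝓞 K))) (σ : RayClassGroup n) :
    ∃ (J : IntIdeal K) (_ : IsCoprime (J : Ideal (𝓞 K)) ((n * n'' : IntIdeal K) : Ideal (𝓞 K)))
      (h : IsCoprime (J : Ideal (𝓞 K)) (n : Ideal (𝓞 K))), idealClass J h = σ := by
  obtain ⟨J, hJ, hJσ⟩ := exists_idealClass_eq σ⁻¹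
  obtain ⟨C, α, hα, hC⟩ := exists_mul_eq_prin_isCoprime J (n * n'')
  have hCn : IsCoprime (C : Ideal (𝓞 K)) (n : Ideal (𝓞 K)) :=
    isCoprime_of_dvd_right (Dvd.intro _ rfl) hC
  have hCn'' : IsCoprime (C : Ideal (𝓞 K)) (n'' : Ideal (𝓞 K)) :=
    isCoprime_of_dvd_right (Dvd.intro_left _ rfl) hC
  have hαn : IsCoprime (prin α : Ideal (𝓞 K)) (n : Ideal (𝓞 K)) := by
    rw [← hα]; exact IsCoprime.intIdeal_mul hJ hCn
  obtain ⟨γ, hγ, hγ'⟩ : ∃ γ : (𝓞 K)⁰, (γ : 𝓞 K) * α - 1 ∈ (n : Ideal (𝓞 K)) ∧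
      (γ : 𝓞 K) - 1 ∈ (n'' : Ideal (𝓞 K)) := by
    rw [Ideal.isCoprime_iff_exists] at hαn hn
    obtain ⟨x, hx, y, hy, hxy⟩ := hαn
    obtain ⟨c, rfl⟩ := Ideal.mem_span_singleton'.1 hx
    obtain ⟨i, hi, j, hj, hij⟩ := hn
    -- The element `c j + i` has the required residues, but it might be zero; then `n` and `n''`
    -- are the unit ideal.
    by_cases h0 : c * j + i = 0
    · have h1 : (1 : 𝓞 K) ∈ (n : Ideal (𝓞 K)) := by
        have : (1 : 𝓞 K) = y + i * α * (c - 1) := by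
          linear_combination (α : 𝓞 K) * h0 - hxy - (c * α : 𝓞 K) * hij
        rw [this]
        exact Ideal.add_mem _ hy (Ideal.mul_mem_right _ _ (Ideal.mul_mem_right _ _ hi))
      have h2 : (1 : 𝓞 K) ∈ (n'' : Ideal (𝓞 K)) := by
        have : (1 : 𝓞 K) = j * (1 - c) := by linear_combination -hij + h0
        rw [this]
        exact Ideal.mul_mem_right _ _ hj
      exact ⟨1, by rw [eq_one_of_one_mem h1]; exact mem_coe_one _,
        by simp⟩
    · refine ⟨⟨c * j + i, mem_nonZeroDivisors_of_ne_zero h0⟩, ?_, ?_⟩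
      · have : (c * j + i) * α - 1 = -y + i * (α * (1 - c)) := by
          linear_combination (c * α : 𝓞 K) * hij + hxy
        change (c * j + i) * α - 1 ∈ _
        rw [this]
        exact Ideal.add_mem _ (neg_mem hy) (Ideal.mul_mem_right _ _ hi)
      · have : c * j + i - 1 = j * (c - 1) := by linear_combination hij
        change c * j + i - 1 ∈ _
        rw [this]
        exact Ideal.mul_mem_right _ _ hj
  have h1 : IsCoprime (prin γ : Ideal (𝓞 K)) (n : Ideal (𝓞 K)) := isCoprime_prin_of_sub_one_mem hγ
  have h2 : IsCoprime (prin γ : Ideal (𝓞 K)) (n'' : Ideal (𝓞 K)) :=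
    isCoprime_prin_of_sub_one_mem (y := 1) (by rwa [mul_one])
  refine ⟨C * prin γ, ?_, IsCoprime.intIdeal_mul hCn h1, ?_⟩
  · have : ((n * n'' : IntIdeal K) : Ideal (𝓞 K)) = (n : Ideal (𝓞 K)) * n'' := rfl
    rw [this]
    exact (IsCoprime.intIdeal_mul hCn h1).mul_right (IsCoprime.intIdeal_mul hCn'' h2)
  · rw [← inv_inv σ, ← hJσ, eq_inv_iff_mul_eq_one, ← idealClass_mul, idealClass_eq_one_iff]
    have : C * prin γ * J = prin (γ * α) := by rw [map_mul, ← hα, mul_comm J C, mul_right_comm,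
      mul_comm]
    rw [this]
    exact prin_mem_ray.2 (Or.inl hγ)

lemma res_surjective {n n' n'' : IntIdeal K} (h : n' = n * n'')
    (hn : IsCoprime (n : Ideal (𝓞 K)) (n'' : Ideal (𝓞 K))) (hd : n ∣ n') :
    Function.Surjective (res hd) := by
  subst h
  intro σ
  obtain ⟨J, hJ, hJn, rfl⟩ := exists_isCoprime_mul_idealClass_eq hn σ
  exact ⟨idealClass J hJ, rfl⟩

lemma toClassGroup_eq_one_iff {n : IntIdeal K} {σ : RayClassGroup n} : toClassGroup n σ = 1 ↔
    ∃ (x : (𝓞 K)⁰) (h : IsCoprime (prin x : Ideal (𝓞 K)) (n : Ideal (𝓞 K))),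
      σ = idealClass (prin x) h := by
  constructor
  · intro h
    obtain ⟨J, hJ, rfl⟩ := exists_idealClass_eq σ
    rw [toClassGroup_idealClass, ClassGroup.mk0_eq_one_iff] at h
    obtain ⟨⟨x, hx⟩⟩ := h
    have hx0 : x ≠ 0 := by
      rintro rfl
      exact J.ne_bot (by rw [hx]; simp)
    have : J = prin ⟨x, mem_nonZeroDivisors_of_ne_zero hx0⟩ := Subtype.ext hx
    subst this
    exact ⟨_, hJ, rfl⟩
  · rintro ⟨x, h, rfl⟩
    rw [toClassGroup_idealClass, ClassGroup.mk0_eq_one_iff]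
    exact ⟨⟨_, rfl⟩⟩

end

section

variable {K : Type*} [Field K] [NumberField K]

/-! ### The equivalence relation defining the distribution relations -/

lemma supI_dvd_right (a n : IntIdeal K) : supI a n ∣ n :=
  dvd_iff_ord.2 fun q => by rw [ord_supI]; exact min_le_right _ _

/-- The denominator of the fractional ideal `a n⁻¹`. -/
def den (n a : IntIdeal K) : IntIdeal K := (supI_dvd_right a n).choose

lemma supI_mul_den (n a : IntIdeal K) : supI a n * den n a = n :=
  (supI_dvd_right a n).choose_spec.symm

lemma ord_den (q : HeightOneSpectrum (𝓞 K)) (n a : IntIdeal K) :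
    ord q (den n a) = ord q n - ord q a := by
  have := congrArg (ord q) (supI_mul_den n a)
  rw [ord_mul, ord_supI] at this
  omega

lemma rayEquiv_iff {n a b : IntIdeal K} : RayEquiv n a b ↔
    (∀ q, min (ord q a) (ord q n) = min (ord q b) (ord q n)) ∧
      toFrac b * (toFrac a)⁻¹ ∈ ray (den n a) := by
  rw [RayEquiv, sup_eq_sup_iff]
  refine and_congr_right fun _ => ⟨?_, fun h => ⟨_, ?_, h⟩⟩
  · rintro ⟨n', hn', h⟩
    have h1 : n' * supI a n = n := Subtype.ext hn'
    have h2 : n' = den n a := intIdeal_ext fun q => by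
      have := congrArg (ord q) h1
      rw [ord_mul, ord_supI] at this
      rw [ord_den]
      omega
    rwa [← h2]
  · rw [mul_comm]
    exact congrArg Subtype.val (supI_mul_den n a)

lemma den_eq_den {n a b : IntIdeal K}
    (h : ∀ q, min (ord q a) (ord q n) = min (ord q b) (ord q n)) : den n a = den n b :=
  intIdeal_ext fun q => by
    have := h q
    rw [ord_den, ord_den]; omega

lemma RayEquiv.refl (n a : IntIdeal K) : RayEquiv n a a :=
  rayEquiv_iff.2 ⟨fun _ => rfl, by rw [mul_inv_cancel]; exact one_mem _⟩

lemma RayEquiv.symm {n a b : IntIdeal K} (h : RayEquiv n a b) : RayEquiv n b a := by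
  rw [rayEquiv_iff] at h ⊢
  refine ⟨fun q => (h.1 q).symm, ?_⟩
  rw [← den_eq_den h.1, ← inv_mem_iff, mul_inv, inv_inv, mul_comm]
  exact h.2

lemma RayEquiv.trans {n a b c : IntIdeal K} (h : RayEquiv n a b) (h' : RayEquiv n b c) :
    RayEquiv n a c := by
  rw [rayEquiv_iff] at *
  refine ⟨fun q => (h.1 q).trans (h'.1 q), ?_⟩
  have h2 := h'.2
  rw [← den_eq_den h.1] at h2
  have := mul_mem h2 h.2
  rwa [mul_assoc, inv_mul_cancel_left] at this

lemma RayEquiv.mono {n n' a b : IntIdeal K} (hn : n ∣ n') (h : RayEquiv n' a b) :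
    RayEquiv n a b := by
  rw [rayEquiv_iff] at *
  rw [dvd_iff_ord] at hn
  refine ⟨fun q => ?_, ray_anti (dvd_iff_ord.2 fun q => ?_) h.2⟩
  · have := h.1 q
    have := hn q
    omega
  · rw [ord_den, ord_den]
    have := hn q
    omega

/-- Induction on the factorization of a nonzero integral ideal into maximal ideals. -/
lemma ofPrime_mul_induction {P : IntIdeal K → Prop} (one : P 1)
    (mul : ∀ q I, P I → P (ofPrime q * I)) (I : IntIdeal K) : P I := by
  have key : ∀ I : Ideal (𝓞 K), ∀ h : I ≠ 0, P ⟨I, mem_nonZeroDivisors_of_ne_zero h⟩ := by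
    intro I
    induction I using UniqueFactorizationMonoid.induction_on_prime with
    | h₁ => exact fun h => (h rfl).elim
    | h₂ x hx =>
      intro h
      have : (⟨x, mem_nonZeroDivisors_of_ne_zero h⟩ : IntIdeal K) = 1 :=
        Subtype.ext (isUnit_iff_eq_one.1 hx)
      rw [this]; exact one
    | h₃ a p ha hp ih =>
      intro h
      have e : (⟨p * a, mem_nonZeroDivisors_of_ne_zero h⟩ : IntIdeal K) =
          ofPrime ⟨p, Ideal.isPrime_of_prime hp, hp.ne_zero⟩ *
            ⟨a, mem_nonZeroDivisors_of_ne_zero ha⟩ := Subtype.ext rfl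
      rw [e]
      exact mul _ _ (ih ha)
  exact key I I.ne_bot

/-- A function of fractional ideals satisfies all the distribution relations once it respects the
equivalence of numerators and satisfies the relations in which one prime is added to the
denominator. -/
lemma distRel_of_prime_step {M : Type*} [AddCommMonoid M] (f : FracIdeal K → M)
    (hinv : ∀ v b b', RayEquiv v b b' →
      f (toFrac b * (toFrac v)⁻¹) = f (toFrac b' * (toFrac v)⁻¹))
    (hstep : ∀ u q a w, IsRepSystem u (u * ofPrime q) a w → f (toFrac a * (toFrac u)⁻¹) =
      ∑ b ∈ w, f (toFrac b * (toFrac (u * ofPrime q))⁻¹))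
    {u v a : IntIdeal K} {w : Finset (IntIdeal K)} (huv : u ∣ v) (h : IsRepSystem u v a w) :
    f (toFrac a * (toFrac u)⁻¹) = ∑ b ∈ w, f (toFrac b * (toFrac v)⁻¹) := by
  classical
  obtain ⟨t, ht⟩ := huv
  induction t using ofPrime_mul_induction generalizing u a w with
  | one =>
    rw [mul_one] at ht
    subst ht
    obtain ⟨b, ⟨hb, hab⟩, huniq⟩ := h.2 a (RayEquiv.refl _ _)
    have : w = {b} := Finset.eq_singleton_iff_unique_mem.2
      ⟨hb, fun c hc => huniq c ⟨hc, h.1 c hc⟩⟩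
    rw [this, Finset.sum_singleton]
    exact hinv _ _ _ hab
  | mul q t ih =>
    -- The system `w` is partitioned according to the equivalence modulo `u q`.
    let s : Setoid (IntIdeal K) :=
      ⟨RayEquiv (u * ofPrime q), RayEquiv.refl _, RayEquiv.symm, RayEquiv.trans⟩
    let r : IntIdeal K → IntIdeal K := fun b => (Quotient.mk s b).out
    have hr : ∀ b, RayEquiv (u * ofPrime q) (r b) b := fun b => Quotient.mk_out (s := s) b
    have hr' : ∀ b c, RayEquiv (u * ofPrime q) b c → r b = r c := fun b c hbc => by
      change (Quotient.mk s b).out = (Quotient.mk s c).out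
      rw [Quotient.sound (s := s) hbc]
    have hu : u ∣ u * ofPrime q := Dvd.intro _ rfl
    have hv : u * ofPrime q ∣ v := ⟨t, by rw [ht, mul_assoc]⟩
    have h1 : IsRepSystem u (u * ofPrime q) a (w.image r) := by
      constructor
      · intro c hc
        obtain ⟨b, hb, rfl⟩ := Finset.mem_image.1 hc
        exact (h.1 b hb).trans ((hr b).mono hu).symm
      · intro c hc
        obtain ⟨b, ⟨hb, hcb⟩, -⟩ := h.2 c hc
        refine ⟨r b, ⟨Finset.mem_image_of_mem _ hb, (hcb.mono hv).trans (hr b).symm⟩, ?_⟩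
        rintro _ ⟨hd, hcd⟩
        obtain ⟨d, hd, rfl⟩ := Finset.mem_image.1 hd
        exact hr' _ _ ((hr d).symm.trans (hcd.symm.trans (hcb.mono hv)))
    rw [hstep _ _ _ _ h1]
    refine Eq.trans ?_ (Finset.sum_fiberwise_of_maps_to
      (fun b hb => Finset.mem_image_of_mem r hb) _)
    refine Finset.sum_congr rfl fun c hc => ?_
    obtain ⟨b0, hb0, rfl⟩ := Finset.mem_image.1 hc
    refine ih ⟨?_, ?_⟩ (by rw [ht, mul_assoc])
    · intro b hb
      obtain ⟨hb, hbc⟩ := Finset.mem_filter.1 hb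
      rw [← hbc]
      exact hr b
    · intro c hc
      have hac : RayEquiv u a c := ((h.1 b0 hb0).trans ((hr b0).mono hu).symm).trans (hc.mono hu)
      obtain ⟨b, ⟨hb, hcb⟩, huniq⟩ := h.2 c hac
      refine ⟨b, ⟨Finset.mem_filter.2 ⟨hb, ?_⟩, hcb⟩, fun d hd => huniq d
        ⟨(Finset.mem_filter.1 hd.1).1, hd.2⟩⟩
      exact hr' _ _ (((hcb.mono hv).symm.trans hc.symm).trans (hr b0))

/-! ### The parity of the fibres -/

/-- The kernel of `G_{n'} → G_n`, realized by fractional ideals. -/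
abbrev RayKernel (n n' : IntIdeal K) : Type _ :=
  ↥(ray n ⊓ primeTo n') ⧸ (ray n').subgroupOf (ray n ⊓ primeTo n')

variable [HasTrivialUnits K]

/-- In a system of representatives for the step from `u` to `u q`, the elements whose denominator
gains the prime `q` are a torsor under the kernel of a map of ray class groups. -/
lemma card_filter_eq_card_rayKernel {u a : IntIdeal K} {q : HeightOneSpectrum (𝓞 K)}
    {w : Finset (IntIdeal K)} (h : IsRepSystem u (u * ofPrime q) a w) {b0 : IntIdeal K}
    (hb0 : b0 ∈ w) (hb0q : ord q b0 ≤ ord q u) :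
    (w.filter fun b => ord q b ≤ ord q u).card =
      Nat.card (RayKernel (den u a) (den u a * ofPrime q)) := by
  classical
  have hden : ∀ b, RayEquiv u a b → ord q b ≤ ord q u →
      den (u * ofPrime q) b = den u a * ofPrime q := by
    intro b hb hbq
    refine intIdeal_ext fun r => ?_
    have h1 := (rayEquiv_iff.1 hb).1 r
    rw [ord_den, ord_mul, ord_mul, ord_den]
    rcases eq_or_ne r q with rfl | hr
    · rw [ord_ofPrime_self]
      omega
    · rw [ord_ofPrime_of_ne hr]
      omega
  have hd0 := hden b0 (h.1 b0 hb0) hb0q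
  generalize hD' : den u a * ofPrime q = D' at *
  have hqD' : ofPrime q ∣ D' := Dvd.intro_left _ hD'
  have hmem : ∀ b, RayEquiv u a b → ord q b ≤ ord q u →
      toFrac b * (toFrac b0)⁻¹ ∈ ray (den u a) ⊓ primeTo D' := by
    intro b hb hbq
    refine ⟨?_, ?_⟩
    · have := mul_mem (rayEquiv_iff.1 hb).2 (inv_mem (rayEquiv_iff.1 (h.1 b0 hb0)).2)
      rwa [mul_inv, inv_inv, mul_comm (toFrac b0)⁻¹, mul_assoc, inv_mul_cancel_left] at this
    · intro r hr
      rw [asIdeal_dvd_iff] at hr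
      have h1 := congrArg (ord r) (hden b hb hbq)
      have h2 := congrArg (ord r) hd0
      rw [ord_den] at h1 h2
      rw [Units.val_mul, FractionalIdeal.count_mul K r (toFrac b).ne_zero (Units.ne_zero _),
        Units.val_inv_eq_inv_val, FractionalIdeal.count_inv, count_toFrac, count_toFrac]
      omega
  have hmin : ∀ b, RayEquiv u a b → ord q b ≤ ord q u → ∀ r,
      min (ord r b) (ord r (u * ofPrime q)) = ord r (u * ofPrime q) - ord r D' := by
    intro b hb hbq r
    have h1 := congrArg (ord r) (hden b hb hbq)
    rw [ord_den] at h1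
    omega
  have hfil : ∀ b : {b // b ∈ w.filter fun b => ord q b ≤ ord q u},
      RayEquiv u a b ∧ ord q b.1 ≤ ord q u := fun b =>
    ⟨h.1 b (Finset.mem_filter.1 b.2).1, (Finset.mem_filter.1 b.2).2⟩
  let φ : {b // b ∈ w.filter fun b => ord q b ≤ ord q u} → RayKernel (den u a) D' := fun b =>
    QuotientGroup.mk ⟨toFrac b.1 * (toFrac b0)⁻¹, hmem b (hfil b).1 (hfil b).2⟩
  have hφ : Function.Bijective φ := by
    constructor
    · intro b c hbc
      have h1 := QuotientGroup.eq.1 hbc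
      rw [Subgroup.mem_subgroupOf] at h1
      change (toFrac b.1 * (toFrac b0)⁻¹)⁻¹ * (toFrac c.1 * (toFrac b0)⁻¹) ∈ ray D' at h1
      have h2 : toFrac c.1 * (toFrac b.1)⁻¹ ∈ ray D' := by
        rwa [mul_inv, inv_inv, mul_comm (toFrac c.1), mul_assoc, mul_inv_cancel_left,
          mul_comm] at h1
      have h3 : RayEquiv (u * ofPrime q) b.1 c.1 := rayEquiv_iff.2 ⟨fun r => by
        rw [hmin b (hfil b).1 (hfil b).2, hmin c (hfil c).1 (hfil c).2], by
        rwa [hden b (hfil b).1 (hfil b).2]⟩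
      obtain ⟨d, -, hd⟩ := h.2 b.1 (hfil b).1
      exact Subtype.ext ((hd b.1 ⟨(Finset.mem_filter.1 b.2).1, RayEquiv.refl _ _⟩).trans
        (hd c.1 ⟨(Finset.mem_filter.1 c.2).1, h3⟩).symm)
    · intro x
      obtain ⟨⟨I, hI, hI'⟩, rfl⟩ := QuotientGroup.mk_surjective x
      obtain ⟨J, hJ, hJI⟩ := exists_idealClass_eq (QuotientGroup.mk ⟨I, hI'⟩ : RayClassGroup D')
      have h1 : (toFrac J)⁻¹ * I ∈ ray D' := by
        rw [idealClass, QuotientGroup.eq, Subgroup.mem_subgroupOf] at hJI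
        exact hJI
      have hDD' : den u a ∣ D' := Dvd.intro _ hD'
      have h2 : toFrac J ∈ ray (den u a) := by
        have := mul_mem (inv_mem (ray_anti hDD' h1)) hI
        rwa [mul_inv, inv_inv, mul_assoc, inv_mul_cancel, mul_one] at this
      have hordJ := isCoprime_iff_ord.1 hJ
      have hac : RayEquiv u a (b0 * J) := by
        rw [rayEquiv_iff]
        refine ⟨fun r => ?_, ?_⟩
        · rw [(rayEquiv_iff.1 (h.1 b0 hb0)).1 r, ord_mul]
          by_cases hr : ofPrime r ∣ D'
          · rw [hordJ r hr]; rfl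
          · have h3 := congrArg (ord r) hd0
            rw [ofPrime_dvd_iff] at hr
            rw [ord_den, ord_mul] at h3
            omega
        · rw [map_mul, mul_right_comm]
          exact mul_mem (rayEquiv_iff.1 (h.1 b0 hb0)).2 h2
      have hcq : ord q (b0 * J) ≤ ord q u := by
        rw [ord_mul, hordJ q hqD']; exact hb0q
      obtain ⟨b, ⟨hb, hcb⟩, -⟩ := h.2 _ hac
      have hbq : ord q b ≤ ord q u := by
        have := (rayEquiv_iff.1 hcb).1 q
        rw [ord_mul q u, ord_ofPrime_self] at this
        omega
      refine ⟨⟨b, Finset.mem_filter.2 ⟨hb, hbq⟩⟩, ?_⟩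
      refine QuotientGroup.eq.2 (Subgroup.mem_subgroupOf.2 ?_)
      change (toFrac b * (toFrac b0)⁻¹)⁻¹ * I ∈ ray D'
      have h4 := (rayEquiv_iff.1 hcb).2
      rw [hden _ hac hcq] at h4
      have key : ∀ x y z t : FracIdeal K,
          (x * (y * z)⁻¹)⁻¹ * (z⁻¹ * t) = (x * y⁻¹)⁻¹ * t := fun x y z t => by
        rw [mul_inv, inv_inv, mul_inv, inv_inv, mul_assoc, mul_assoc, mul_assoc,
          mul_inv_cancel_left]
      rw [← key _ _ (toFrac J), ← map_mul]
      exact mul_mem (inv_mem h4) h1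
  rw [← Nat.card_eq_of_bijective φ hφ, Nat.card_eq_fintype_card, Fintype.card_coe]

/-- If `q` divides `n` and has odd residue characteristic, then the kernel of `G_{n q} → G_n` has no
element of order two. -/
lemma odd_card_rayKernel {n : IntIdeal K} {q : HeightOneSpectrum (𝓞 K)} (hq : ofPrime q ∣ n)
    (h2 : (2 : 𝓞 K) ∉ q.asIdeal) (h0 : Nat.card (RayKernel n (n * ofPrime q)) ≠ 0) :
    Odd (Nat.card (RayKernel n (n * ofPrime q))) := by
  have : Finite (RayKernel n (n * ofPrime q)) := Nat.finite_of_card_ne_zero h0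
  rw [← Nat.not_even_iff_odd, even_iff_two_dvd]
  intro heven
  obtain ⟨x, hx⟩ := exists_prime_orderOf_dvd_card' 2 heven
  obtain ⟨⟨I, hI, hI'⟩, rfl⟩ := QuotientGroup.mk_surjective x
  have hsq := pow_orderOf_eq_one (QuotientGroup.mk ⟨I, hI, hI'⟩ : RayKernel n (n * ofPrime q))
  rw [hx, ← QuotientGroup.mk_pow, QuotientGroup.eq_one_iff, Subgroup.mem_subgroupOf] at hsq
  change I ^ 2 ∈ ray _ at hsq
  have hne : I ∉ ray (n * ofPrime q) := fun hmem => by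
    have : (QuotientGroup.mk ⟨I, hI, hI'⟩ : RayKernel n (n * ofPrime q)) = 1 :=
      (QuotientGroup.eq_one_iff _).2 (Subgroup.mem_subgroupOf.2 hmem)
    rw [this, orderOf_one] at hx
    omega
  obtain ⟨a, b, hb, hab, hI1⟩ := mem_ray_iff.1 hI
  have hbq : IsCoprime (prin b : Ideal (𝓞 K)) (ofPrime q : Ideal (𝓞 K)) :=
    isCoprime_of_dvd_right hq hb
  have hb' : IsCoprime (prin b : Ideal (𝓞 K)) ((n * ofPrime q : IntIdeal K) : Ideal (𝓞 K)) := by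
    have : ((n * ofPrime q : IntIdeal K) : Ideal (𝓞 K)) = (n : Ideal (𝓞 K)) * ofPrime q := rfl
    rw [this]
    exact hb.mul_right hbq
  have hI2 : I = toFrac (prin a) * (toFrac (prin b))⁻¹ := by rw [← hI1, mul_inv_cancel_right]
  have hnq : (n : Ideal (𝓞 K)) ≤ q.asIdeal := dvd_iff_le.1 hq
  have hbmem : (b : 𝓞 K) ∉ q.asIdeal := fun hmem => by
    have hbq' : IsCoprime (Ideal.span {(b : 𝓞 K)}) q.asIdeal := hbq
    have : (1 : 𝓞 K) ∈ q.asIdeal := mem_of_mul_mem_of_isCoprime hbq' (by rwa [mul_one])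
    exact q.isPrime.ne_top ((Ideal.eq_top_iff_one _).2 this)
  have hb2 : IsCoprime (prin (b ^ 2) : Ideal (𝓞 K))
      ((n * ofPrime q : IntIdeal K) : Ideal (𝓞 K)) := by
    rw [pow_two, map_mul]
    exact IsCoprime.intIdeal_mul hb' hb'
  rw [hI2, mul_pow, inv_pow, ← map_pow, ← map_pow, ← map_pow, ← map_pow,
    prin_div_prin_mem_ray hb2] at hsq
  have hmul : ∀ y : 𝓞 K, y ∈ ((n * ofPrime q : IntIdeal K) : Ideal (𝓞 K)) → y ∈ q.asIdeal :=
    fun y hy => dvd_iff_le.1 (Dvd.intro_left n rfl : ofPrime q ∣ n * ofPrime q) hy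
  have hne2 : (a : 𝓞 K) + b ∉ q.asIdeal := fun hmem => by
    have : (2 : 𝓞 K) * b ∈ q.asIdeal := by
      have := sub_mem hmem (hnq hab)
      convert this using 1; ring
    exact (q.isPrime.mem_or_mem this).elim h2 hbmem
  -- `a² ≡ b²` modulo `n q`, and `q` does not divide `a + b`, so `n q` divides `a - b`.
  rcases hsq with hsq | hsq
  · apply hne
    rw [hI2, prin_div_prin_mem_ray hb']
    left
    by_cases h0 : (a : 𝓞 K) - b = 0
    · rw [h0]; exact zero_mem _
    let c : (𝓞 K)⁰ := ⟨(a : 𝓞 K) - b, mem_nonZeroDivisors_of_ne_zero h0⟩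
    have hab0 : (a : 𝓞 K) + b ≠ 0 := fun h => hne2 (by rw [h]; exact zero_mem _)
    let d : (𝓞 K)⁰ := ⟨(a : 𝓞 K) + b, mem_nonZeroDivisors_of_ne_zero hab0⟩
    have hc : n ∣ prin c := dvd_iff_le.2 ((Ideal.span_singleton_le_iff_mem _).2 hab)
    have hd : ¬ ofPrime q ∣ prin d := fun h =>
      hne2 ((Ideal.span_singleton_le_iff_mem _).1 (dvd_iff_le.1 h))
    have hcd : n * ofPrime q ∣ prin c * prin d := by
      rw [← map_mul]
      refine dvd_iff_le.2 ((Ideal.span_singleton_le_iff_mem _).2 ?_)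
      change ((a : 𝓞 K) - b) * (a + b) ∈ _
      convert hsq using 1
      change ((a : 𝓞 K) - b) * (a + b) = (a : 𝓞 K) ^ 2 - (b : 𝓞 K) ^ 2
      ring
    have : n * ofPrime q ∣ prin c := by
      rw [dvd_iff_ord] at hcd hc ⊢
      intro r
      have h1 := hcd r
      rw [ord_mul, ord_mul] at h1
      rw [ord_mul]
      rcases eq_or_ne r q with rfl | hr
      · rw [ofPrime_dvd_iff] at hd
        omega
      · rw [ord_ofPrime_of_ne hr]
        exact hc r
    exact (Ideal.span_singleton_le_iff_mem _).1 (dvd_iff_le.1 this)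
  -- `a² ≡ -b²` is impossible modulo `q`, where `a ≡ b` and `2` is invertible.
  · exfalso
    have h3 : (a : 𝓞 K) ^ 2 + (b : 𝓞 K) ^ 2 ∈ q.asIdeal := hmul _ hsq
    have h4 : (2 : 𝓞 K) * (b * b) ∈ q.asIdeal := by
      have := sub_mem h3 (Ideal.mul_mem_right ((a : 𝓞 K) + b) _ (hnq hab))
      convert this using 1; ring
    exact (q.isPrime.mem_or_mem h4).elim h2 fun h => (q.isPrime.mem_or_mem h).elim hbmem hbmem

/-- If `q` does not divide `n`, and `n` has a prime factor of odd residue characteristic, then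
the kernel of `G_{n q} → G_n` contains the element of order two given by an integer congruent to `1`
modulo `n` and to `-1` modulo `q`. -/
lemma even_card_rayKernel {n : IntIdeal K} {q r : HeightOneSpectrum (𝓞 K)} (hq : ¬ ofPrime q ∣ n)
    (h2 : (2 : 𝓞 K) ∉ q.asIdeal) (hr : ofPrime r ∣ n) (hr2 : (2 : 𝓞 K) ∉ r.asIdeal) :
    Even (Nat.card (RayKernel n (n * ofPrime q))) := by
  have hcop := isCoprime_ofPrime hq
  obtain ⟨i, hi, j, hj, hij⟩ := Ideal.isCoprime_iff_exists.1 hcop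
  -- `i ∈ q`, `j ∈ n`, `i + j = 1`, so `x = i - j` is `1` modulo `n` and `-1` modulo `q`.
  have hx0 : i - j ≠ 0 := fun h => by
    apply h2
    have : (2 : 𝓞 K) = 4 * i := by linear_combination -2 * h - 2 * hij
    rw [this]; exact Ideal.mul_mem_left _ _ hi
  let x : (𝓞 K)⁰ := ⟨i - j, mem_nonZeroDivisors_of_ne_zero hx0⟩
  have hx1 : (x : 𝓞 K) - 1 = -(2 * j) := by
    change i - j - 1 = _
    linear_combination hij
  have hx2 : (x : 𝓞 K) + 1 = 2 * i := by
    change i - j + 1 = _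
    linear_combination -hij
  have hprod : ((n * ofPrime q : IntIdeal K) : Ideal (𝓞 K)) = (n : Ideal (𝓞 K)) * ofPrime q := rfl
  have hxx : (x : 𝓞 K) * x - 1 ∈ ((n * ofPrime q : IntIdeal K) : Ideal (𝓞 K)) := by
    have : (x : 𝓞 K) * x - 1 = (-4) * (j * i) := by
      calc (x : 𝓞 K) * x - 1 = (x - 1) * (x + 1) := by ring
        _ = _ := by rw [hx1, hx2]; ring
    rw [this, hprod]
    exact Ideal.mul_mem_left _ _ (Ideal.mul_mem_mul hj hi)
  have hmulq : ((n * ofPrime q : IntIdeal K) : Ideal (𝓞 K)) ≤ q.asIdeal :=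
    dvd_iff_le.1 (Dvd.intro_left n rfl : ofPrime q ∣ n * ofPrime q)
  have hmuln : ((n * ofPrime q : IntIdeal K) : Ideal (𝓞 K)) ≤ n :=
    dvd_iff_le.1 (Dvd.intro _ rfl : n ∣ n * ofPrime q)
  have hxcop := isCoprime_prin_of_sub_one_mem hxx
  have hxray : toFrac (prin x) ∈ ray n := prin_mem_ray.2 (Or.inl (by
    rw [hx1]; exact neg_mem (Ideal.mul_mem_left _ _ hj)))
  have hnray : toFrac (prin x) ∉ ray (n * ofPrime q) := by
    rw [prin_mem_ray]
    rintro (h | h)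
    · have h3 : (x : 𝓞 K) - 1 ∈ q.asIdeal := hmulq h
      have h4 : (2 : 𝓞 K) = 2 * i - (x - 1) := by rw [hx1]; linear_combination -2 * hij
      exact h2 (h4 ▸ sub_mem (Ideal.mul_mem_left _ _ hi) h3)
    · have h3 : (x : 𝓞 K) + 1 ∈ (n : Ideal (𝓞 K)) := hmuln h
      have h4 : (2 : 𝓞 K) = (x + 1) + 2 * j := by rw [hx2]; linear_combination -2 * hij
      exact hr2 (dvd_iff_le.1 hr (h4 ▸ add_mem h3 (Ideal.mul_mem_left _ _ hj)))
  let κ : RayKernel n (n * ofPrime q) :=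
    QuotientGroup.mk ⟨toFrac (prin x), hxray, toFrac_mem_primeTo.2 hxcop⟩
  have hκ : orderOf κ = 2 := by
    refine orderOf_eq_prime ?_ ?_
    · rw [← QuotientGroup.mk_pow, QuotientGroup.eq_one_iff, Subgroup.mem_subgroupOf]
      change toFrac (prin x) ^ 2 ∈ _
      rw [← map_pow, ← map_pow, prin_mem_ray]
      left
      rw [pow_two]
      exact hxx
    · intro h
      exact hnray (Subgroup.mem_subgroupOf.1 ((QuotientGroup.eq_one_iff _).1 h))
  rw [even_iff_two_dvd, ← hκ]
  exact orderOf_dvd_natCard κ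

end

section

variable {K : Type*} [Field K] [NumberField K]

/-! ### A distribution modulo two -/

open Classical in
/-- The function on fractional ideals which is `1` if the primes in the denominator are exactly
those in `T`, and `0` otherwise. -/
def denIndicator (T : Set (HeightOneSpectrum (𝓞 K))) (c : FracIdeal K) : ZMod 2 :=
  if {q | FractionalIdeal.count K q (c : FractionalIdeal (𝓞 K)⁰ K) < 0} = T then 1 else 0

open Classical in
lemma denIndicator_div (T : Set (HeightOneSpectrum (𝓞 K))) (b u : IntIdeal K) :
    denIndicator T (toFrac b * (toFrac u)⁻¹) = if {q | ord q b < ord q u} = T then 1 else 0 := by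
  rw [denIndicator]
  congr 2
  ext q
  rw [Set.mem_ofPred_eq, Set.mem_ofPred_eq, Units.val_mul,
    FractionalIdeal.count_mul K q (toFrac b).ne_zero (Units.ne_zero _),
    Units.val_inv_eq_inv_val, FractionalIdeal.count_inv, count_toFrac, count_toFrac]
  omega

variable [HasTrivialUnits K]

open Classical in
/-- The fibre over a class with denominator prime to `q` contains exactly one class whose
denominator is prime to `q`. -/
lemma card_filter_eq_one {u a : IntIdeal K} {q : HeightOneSpectrum (𝓞 K)}
    {w : Finset (IntIdeal K)} (h : IsRepSystem u (u * ofPrime q) a w)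
    (hqa : ord q u ≤ ord q a) : (w.filter fun b => ord q u < ord q b).card = 1 := by
  have hq : ¬ ofPrime q ∣ den u a := by
    rw [ofPrime_dvd_iff, ord_den]; omega
  obtain ⟨x, hqx, hx⟩ := exists_dvd_prin_sub_one_mem (isCoprime_ofPrime hq)
  have hxcop : IsCoprime (prin x : Ideal (𝓞 K)) (den u a : Ideal (𝓞 K)) :=
    isCoprime_prin_of_sub_one_mem (y := 1) (by rwa [mul_one])
  have hac : RayEquiv u a (a * prin x) := by
    rw [rayEquiv_iff]
    refine ⟨fun r => ?_, ?_⟩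
    · rw [ord_mul]
      by_cases hr : ofPrime r ∣ den u a
      · rw [isCoprime_iff_ord.1 hxcop r hr, add_zero]
      · rw [ofPrime_dvd_iff, ord_den] at hr
        omega
    · rw [map_mul, mul_right_comm, mul_inv_cancel, one_mul]
      exact prin_mem_ray.2 (Or.inl hx)
  rw [ofPrime_dvd_iff] at hqx
  obtain ⟨b, ⟨hb, hcb⟩, -⟩ := h.2 _ hac
  have hbq : ord q u < ord q b := by
    have := (rayEquiv_iff.1 hcb).1 q
    rw [ord_mul, ord_mul, ord_ofPrime_self] at this
    omega
  have hden : ∀ c, RayEquiv u a c → ord q u < ord q c → ∀ r,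
      min (ord r c) (ord r (u * ofPrime q)) = ord r (u * ofPrime q) - ord r (den u a) := by
    intro c hc hcq r
    have h1 := (rayEquiv_iff.1 hc).1 r
    rw [ord_den, ord_mul]
    rcases eq_or_ne r q with rfl | hr
    · rw [ord_ofPrime_self]; omega
    · rw [ord_ofPrime_of_ne hr]; omega
  rw [Finset.card_eq_one]
  refine ⟨b, Finset.eq_singleton_iff_unique_mem.2 ⟨Finset.mem_filter.2 ⟨hb, hbq⟩, fun c hc => ?_⟩⟩
  obtain ⟨hc, hcq⟩ := Finset.mem_filter.1 hc
  have hbc : RayEquiv (u * ofPrime q) b c := by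
    rw [rayEquiv_iff]
    refine ⟨fun r => by rw [hden b (h.1 b hb) hbq, hden c (h.1 c hc) hcq], ?_⟩
    have hd : den (u * ofPrime q) b = den u a := intIdeal_ext fun r => by
      have h1 := hden b (h.1 b hb) hbq r
      have h2 := (rayEquiv_iff.1 (h.1 b hb)).1 r
      rw [ord_den, ord_den]
      rw [ord_den] at h1
      rw [ord_mul] at h1 ⊢
      rcases eq_or_ne r q with rfl | hr
      · rw [ord_ofPrime_self] at h1 ⊢; omega
      · rw [ord_ofPrime_of_ne hr] at h1 ⊢; omega
    rw [hd]
    have := mul_mem (rayEquiv_iff.1 (h.1 c hc)).2 (inv_mem (rayEquiv_iff.1 (h.1 b hb)).2)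
    rwa [mul_inv, inv_inv, mul_comm (toFrac b)⁻¹, mul_assoc, inv_mul_cancel_left] at this
  obtain ⟨d, -, hd⟩ := h.2 b (h.1 b hb)
  exact (hd c ⟨hc, hbc⟩).trans (hd b ⟨hb, RayEquiv.refl _ _⟩).symm

/-- If `T` consists of at least two primes of odd residue characteristic, then its indicator
function satisfies the distribution relations modulo two that add a prime to the denominator. -/
lemma denIndicator_prime_step {T : Set (HeightOneSpectrum (𝓞 K))} (hT : T.Nontrivial)
    (hT2 : ∀ q ∈ T, (2 : 𝓞 K) ∉ q.asIdeal) {u a : IntIdeal K} {q : HeightOneSpectrum (𝓞 K)}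
    {w : Finset (IntIdeal K)} (h : IsRepSystem u (u * ofPrime q) a w) :
    denIndicator T (toFrac a * (toFrac u)⁻¹) =
      ∑ b ∈ w, denIndicator T (toFrac b * (toFrac (u * ofPrime q))⁻¹) := by
  classical
  simp_rw [denIndicator_div]
  have hne : ∀ b ∈ w, ∀ r, r ≠ q →
      (ord r b < ord r (u * ofPrime q) ↔ ord r a < ord r u) := by
    intro b hb r hr
    have h1 := (rayEquiv_iff.1 (h.1 b hb)).1 r
    rw [ord_mul, ord_ofPrime_of_ne hr]
    omega
  have hord : ord q (u * ofPrime q) = ord q u + 1 := by rw [ord_mul, ord_ofPrime_self]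
  -- If `q` is in the denominator already, all terms on the right are equal to the left side, and
  -- their number is odd.
  by_cases hqa : ord q a < ord q u
  · have hle : ∀ b ∈ w, ord q b ≤ ord q u := fun b hb => by
      have h1 := (rayEquiv_iff.1 (h.1 b hb)).1 q
      omega
    have hset : ∀ b ∈ w, {r | ord r b < ord r (u * ofPrime q)} = {r | ord r a < ord r u} := by
      intro b hb
      ext r
      rcases eq_or_ne r q with rfl | hr
      · have := hle b hb
        simp only [Set.mem_ofPred_eq]
        omega
      · exact hne b hb r hr
    rw [Finset.sum_congr rfl fun b hb => by rw [hset b hb]]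
    split_ifs with hTa
    · obtain ⟨b, ⟨hb, -⟩, -⟩ := h.2 a (RayEquiv.refl _ _)
      have hcard := card_filter_eq_card_rayKernel h hb (hle b hb)
      rw [Finset.filter_true_of_mem hle] at hcard
      have hodd := odd_card_rayKernel (n := den u a) (q := q)
        (by rw [ofPrime_dvd_iff, ord_den]; omega) (hT2 q (hTa ▸ hqa))
        (hcard ▸ (Finset.card_pos.2 ⟨b, hb⟩).ne')
      rw [← hcard] at hodd
      rw [Finset.sum_const, nsmul_eq_mul, mul_one]
      exact ((ZMod.natCast_eq_one_iff_odd).2 hodd).symm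
    · simp
  · by_cases hqT : q ∈ T
    -- If `q` is in `T`, the left side vanishes and the terms equal to `1` on the right are even in
    -- number.
    · have hTa : {r | ord r a < ord r u} ≠ T := fun hTa => hqa (by
        have : q ∈ {r | ord r a < ord r u} := by rw [hTa]; exact hqT
        exact this)
      rw [if_neg hTa]
      have hset : ∀ b ∈ w, ({r | ord r b < ord r (u * ofPrime q)} = T ↔
          ord q b ≤ ord q u ∧ insert q {r | ord r a < ord r u} = T) := by
        intro b hb
        constructor
        · intro hb'
          have : q ∈ {r | ord r b < ord r (u * ofPrime q)} := hb' ▸ hqT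
          rw [Set.mem_ofPred_eq, hord] at this
          refine ⟨by omega, ?_⟩
          rw [← hb']
          ext r
          rcases eq_or_ne r q with rfl | hr
          · simp only [Set.mem_insert_iff, true_or, Set.mem_ofPred_eq, hord, true_iff]
            omega
          · simp only [Set.mem_insert_iff, hr, false_or]
            exact (hne b hb r hr).symm
        · rintro ⟨hbq, hb'⟩
          rw [← hb']
          ext r
          rcases eq_or_ne r q with rfl | hr
          · simp only [Set.mem_insert_iff, true_or, Set.mem_ofPred_eq, hord, iff_true]
            omega
          · simp only [Set.mem_insert_iff, hr, false_or]
            exact hne b hb r hr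
      rw [Finset.sum_congr rfl fun b hb => by rw [if_congr (hset b hb) rfl rfl]]
      by_cases hTa : insert q {r | ord r a < ord r u} = T
      · simp only [hTa, and_true]
        rw [← Finset.sum_filter, Finset.sum_const, nsmul_eq_mul, mul_one]
        symm
        rw [ZMod.natCast_eq_zero_iff_even]
        rcases Finset.eq_empty_or_nonempty (w.filter fun b => ord q b ≤ ord q u) with he | ⟨b, hb⟩
        · rw [he]; simp
        · obtain ⟨hb, hbq⟩ := Finset.mem_filter.1 hb
          rw [card_filter_eq_card_rayKernel h hb hbq]
          obtain ⟨r, hr, hrq⟩ := hT.exists_ne q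
          have hr' : ord r a < ord r u := by
            rw [← hTa] at hr
            exact hr.resolve_left hrq
          exact even_card_rayKernel (r := r) (by rw [ofPrime_dvd_iff, ord_den]; omega)
            (hT2 q hqT) (by rw [ofPrime_dvd_iff, ord_den]; omega) (hT2 r hr)
      · simp [hTa]
    -- If `q` is not in `T`, only the single term whose denominator does not gain `q` counts.
    · have hset : ∀ b ∈ w, ({r | ord r b < ord r (u * ofPrime q)} = T ↔
          ord q u < ord q b ∧ {r | ord r a < ord r u} = T) := by
        intro b hb
        have key : ord q u < ord q b →
            {r | ord r b < ord r (u * ofPrime q)} = {r | ord r a < ord r u} := by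
          intro hbq
          ext r
          rcases eq_or_ne r q with rfl | hr
          · simp only [Set.mem_ofPred_eq, hord]
            omega
          · exact hne b hb r hr
        constructor
        · intro hb'
          have : q ∉ {r | ord r b < ord r (u * ofPrime q)} := hb' ▸ hqT
          rw [Set.mem_ofPred_eq, hord] at this
          have hbq : ord q u < ord q b := by omega
          exact ⟨hbq, (key hbq) ▸ hb'⟩
        · rintro ⟨hbq, hb'⟩
          rw [key hbq, hb']
      rw [Finset.sum_congr rfl fun b hb => by rw [if_congr (hset b hb) rfl rfl]]
      by_cases hTa : {r | ord r a < ord r u} = T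
      · simp only [hTa, and_true, if_true]
        rw [← Finset.sum_filter, Finset.sum_const, card_filter_eq_one h (by omega), one_smul]
      · simp [hTa]

/-- The homomorphism from the universal distribution to `ℤ/2` induced by the indicator function of
the fractional ideals whose denominator has the set of prime factors `T`. -/
def univOrdDistToZMod {T : Set (HeightOneSpectrum (𝓞 K))} (hT : T.Nontrivial)
    (hT2 : ∀ q ∈ T, (2 : 𝓞 K) ∉ q.asIdeal) : UnivOrdDist K →+ ZMod 2 :=
  QuotientAddGroup.lift (distRel K)
    (Finsupp.liftAddHom fun c => (zmultiplesHom (ZMod 2)) (denIndicator T c)) (by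
      rw [distRel, AddSubgroup.closure_le]
      rintro _ ⟨a, u, v, w, huv, hw, rfl⟩
      simp only [SetLike.mem_coe, AddMonoidHom.mem_ker, map_sub, map_sum,
        Finsupp.liftAddHom_apply_single, zmultiplesHom_apply, one_smul]
      rw [sub_eq_zero]
      refine distRel_of_prime_step (denIndicator T) ?_
        (fun u q a w h => denIndicator_prime_step hT hT2 h) huv hw
      intro v b b' h
      rw [denIndicator_div, denIndicator_div]
      congr 2
      ext r
      have := (rayEquiv_iff.1 h).1 r
      simp only [Set.mem_ofPred_eq]
      omega)

lemma univOrdDistToZMod_single {T : Set (HeightOneSpectrum (𝓞 K))} (hT : T.Nontrivial)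
    (hT2 : ∀ q ∈ T, (2 : 𝓞 K) ∉ q.asIdeal) (c : FracIdeal K) :
    univOrdDistToZMod hT hT2 (QuotientAddGroup.mk (Finsupp.single c 1)) = denIndicator T c := by
  rw [univOrdDistToZMod, QuotientAddGroup.lift_mk, Finsupp.liftAddHom_apply_single,
    zmultiplesHom_apply, one_smul]

/-! ### From `Δ` to the universal distribution -/

/-- An integral ideal prime to `n` in a given class modulo `n`. -/
def classRep {n : IntIdeal K} (σ : RayClassGroup n) : IntIdeal K := (exists_idealClass_eq σ).choose

lemma isCoprime_classRep {n : IntIdeal K} (σ : RayClassGroup n) :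
    IsCoprime (classRep σ : Ideal (𝓞 K)) (n : Ideal (𝓞 K)) :=
  (exists_idealClass_eq σ).choose_spec.choose

lemma idealClass_classRep {n : IntIdeal K} (σ : RayClassGroup n) :
    idealClass (classRep σ) (isCoprime_classRep σ) = σ :=
  (exists_idealClass_eq σ).choose_spec.choose_spec

variable (K) in
/-- The homomorphism from `Δ` to the universal distribution sending `σ ∈ G_n` to `[a n⁻¹]`, where
`a` is an integral ideal in the class `σ`. -/
def deltaToDist : Delta K →+ UnivOrdDist K :=
  Finsupp.liftAddHom fun x => (zmultiplesHom (UnivOrdDist K))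
    (QuotientAddGroup.mk (Finsupp.single (toFrac (classRep x.2) * (toFrac x.1)⁻¹) 1))

lemma deltaToDist_symb {n : IntIdeal K} (σ : RayClassGroup n) : deltaToDist K (symb σ) =
    QuotientAddGroup.mk (Finsupp.single (toFrac (classRep σ) * (toFrac n)⁻¹) 1) := by
  rw [deltaToDist, symb, Finsupp.liftAddHom_apply_single, zmultiplesHom_apply, one_smul]

lemma rayEquiv_of_isCoprime {n a b : IntIdeal K}
    (ha : IsCoprime (a : Ideal (𝓞 K)) (n : Ideal (𝓞 K))) : RayEquiv n a b ↔
      ∃ hb : IsCoprime (b : Ideal (𝓞 K)) (n : Ideal (𝓞 K)), idealClass a ha = idealClass b hb := by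
  have hden : den n a = n := intIdeal_ext fun q => by
    rw [ord_den]
    by_cases hq : ofPrime q ∣ n
    · rw [isCoprime_iff_ord.1 ha q hq]; rfl
    · rw [ofPrime_dvd_iff] at hq; omega
  rw [rayEquiv_iff, hden]
  simp_rw [idealClass_eq_iff, exists_prop]
  refine and_congr_left fun _ => ?_
  rw [isCoprime_iff_ord] at *
  constructor
  · intro h q hq
    have h1 := h q
    rw [ha q hq] at h1
    rw [ofPrime_dvd_iff] at hq
    omega
  · intro h q
    by_cases hq : ofPrime q ∣ n
    · rw [ha q hq, h q hq]
    · rw [ofPrime_dvd_iff] at hq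
      omega

lemma map_normSum {M : Type*} [AddCommGroup M] (f : Delta K →+ M) {n n' : IntIdeal K} (h : n ∣ n')
    [Finite (res h).ker] (τ : RayClassGroup n') :
    f (normSum h τ) = ∑ᶠ g : (res h).ker, f (symb ((g : RayClassGroup n') * τ)) := by
  rw [normSum]
  exact f.map_finsum (Set.toFinite _)

/-- The homomorphism to the universal distribution respects the relation with Frobenius: the
integral ideals in the class `σ` modulo `n`, up to equivalence modulo `n q`, are those prime to `q`,
which form the classes of the lifts of `σ`, and one class of multiples `q b`, where `b` is in the
class `frob⁻¹ * σ` and `q b / (n q) = b / n`. -/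
lemma deltaToDist_normSum {n n' : IntIdeal K} {q : HeightOneSpectrum (𝓞 K)} (hq : ¬ ofPrime q ∣ n)
    (hn' : n' = n * ofPrime q) (h : n ∣ n') [Finite (res h).ker] {σ : RayClassGroup n}
    {τ : RayClassGroup n'} (hτ : res h τ = σ) :
    deltaToDist K (symb σ - symb ((frob hq)⁻¹ * σ) - normSum h τ) = 0 := by
  classical
  have := Fintype.ofFinite (res h).ker
  have hqn' : ofPrime q ∣ n' := Dvd.intro_left n hn'.symm
  have hcopn' : ∀ {b : IntIdeal K}, ¬ ofPrime q ∣ b →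
      IsCoprime (b : Ideal (𝓞 K)) (n : Ideal (𝓞 K)) →
      IsCoprime (b : Ideal (𝓞 K)) (n' : Ideal (𝓞 K)) := by
    intro b hb hbn
    rw [isCoprime_iff_ord] at *
    intro r hr
    rw [ofPrime_dvd_iff] at hr hb
    rw [hn', ord_mul] at hr
    rcases eq_or_ne r q with rfl | hrq
    · omega
    · rw [ord_ofPrime_of_ne hrq] at hr
      exact hbn r (ofPrime_dvd_iff.2 (by omega))
  have hnq : ∀ {b : IntIdeal K}, IsCoprime (b : Ideal (𝓞 K)) (n' : Ideal (𝓞 K)) →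
      ¬ ofPrime q ∣ b := fun hb hqb => by
    have := isCoprime_iff_ord.1 hb q hqn'
    rw [ofPrime_dvd_iff] at hqb
    omega
  rw [map_sub, map_sub, map_normSum, finsum_eq_sum_of_fintype, deltaToDist_symb, deltaToDist_symb]
  simp_rw [deltaToDist_symb]
  set a' := classRep ((frob hq)⁻¹ * σ) with ha'
  let R : (res h).ker → IntIdeal K := fun g => classRep ((g : RayClassGroup n') * τ)
  have hRcop : ∀ g, IsCoprime (R g : Ideal (𝓞 K)) (n' : Ideal (𝓞 K)) := fun g =>
    isCoprime_classRep _
  have hRinj : Function.Injective R := by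
    intro g g' hgg'
    have h1 : (g : RayClassGroup n') * τ = g' * τ := by
      rw [← idealClass_classRep ((g : RayClassGroup n') * τ),
        ← idealClass_classRep ((g' : RayClassGroup n') * τ)]
      congr 1
    have h2 := congrArg (· * τ⁻¹) h1
    simp only [mul_inv_cancel_right] at h2
    exact Subtype.ext h2
  have hb0cop : IsCoprime ((ofPrime q * a' : IntIdeal K) : Ideal (𝓞 K)) (n : Ideal (𝓞 K)) :=
    IsCoprime.intIdeal_mul (isCoprime_ofPrime hq) (isCoprime_classRep _)
  have hb0 : idealClass (ofPrime q * a') hb0cop = σ := by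
    rw [idealClass_mul (isCoprime_ofPrime hq) (isCoprime_classRep _), idealClass_classRep,
      ← frob_eq hq, mul_inv_cancel_left]
  have hb0R : ofPrime q * a' ∉ Finset.univ.image R := by
    intro hmem
    obtain ⟨g, -, hg⟩ := Finset.mem_image.1 hmem
    exact hnq (hRcop g) (hg ▸ Dvd.intro _ rfl)
  have hsys : IsRepSystem n n' (classRep σ) (insert (ofPrime q * a') (Finset.univ.image R)) := by
    have heq : ∀ c, RayEquiv n (classRep σ) c ↔
        ∃ hc : IsCoprime (c : Ideal (𝓞 K)) (n : Ideal (𝓞 K)), σ = idealClass c hc := fun c => by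
      rw [rayEquiv_of_isCoprime (isCoprime_classRep σ), idealClass_classRep]
    constructor
    · intro b hb
      rw [heq]
      rcases Finset.mem_insert.1 hb with rfl | hb
      · exact ⟨hb0cop, hb0.symm⟩
      · obtain ⟨g, -, rfl⟩ := Finset.mem_image.1 hb
        refine ⟨isCoprime_of_dvd_right h (hRcop g), ?_⟩
        rw [← res_idealClass h (hRcop g), idealClass_classRep, map_mul, hτ, MonoidHom.mem_ker.1 g.2,
          one_mul]
    · intro c hc
      obtain ⟨hcn, hcσ⟩ := (heq c).1 hc
      by_cases hqc : ofPrime q ∣ c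
      · refine ⟨ofPrime q * a', ⟨Finset.mem_insert_self _ _, ?_⟩, ?_⟩
        · have hqc' := ofPrime_dvd_iff.1 hqc
          have hqn := ofPrime_dvd_iff.not.1 hq
          have hden : den n' c = n := intIdeal_ext fun r => by
            rw [ord_den, hn', ord_mul]
            rcases eq_or_ne r q with rfl | hrq
            · rw [ord_ofPrime_self]; omega
            · rw [ord_ofPrime_of_ne hrq]
              by_cases hr : ofPrime r ∣ n
              · rw [isCoprime_iff_ord.1 hcn r hr]; rfl
              · rw [ofPrime_dvd_iff] at hr; omega
          rw [rayEquiv_iff, hden]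
          refine ⟨fun r => ?_, idealClass_eq_iff.1 (hcσ.symm.trans hb0.symm)⟩
          by_cases hr : ofPrime r ∣ n
          · rw [isCoprime_iff_ord.1 hcn r hr, isCoprime_iff_ord.1 hb0cop r hr]
          · rw [ofPrime_dvd_iff] at hr
            rw [hn', ord_mul, ord_mul]
            rcases eq_or_ne r q with rfl | hrq
            · rw [ord_ofPrime_self]; omega
            · rw [ord_ofPrime_of_ne hrq]; omega
        · rintro y ⟨hy, hcy⟩
          rcases Finset.mem_insert.1 hy with rfl | hy
          · rfl
          · obtain ⟨g, -, rfl⟩ := Finset.mem_image.1 hy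
            have h1 := (rayEquiv_iff.1 hcy).1 q
            have h2 := isCoprime_iff_ord.1 (hRcop g) q hqn'
            rw [ofPrime_dvd_iff] at hqc hqn'
            omega
      · have hcn' := hcopn' hqc hcn
        have hker : idealClass c hcn' * τ⁻¹ ∈ (res h).ker := by
          rw [MonoidHom.mem_ker, map_mul, map_inv, hτ, res_idealClass, ← hcσ, mul_inv_cancel]
        refine ⟨R ⟨_, hker⟩, ⟨Finset.mem_insert_of_mem (Finset.mem_image_of_mem _
          (Finset.mem_univ _)), ?_⟩, ?_⟩
        · rw [rayEquiv_of_isCoprime hcn']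
          refine ⟨hRcop _, ?_⟩
          rw [idealClass_classRep, inv_mul_cancel_right]
        · rintro y ⟨hy, hcy⟩
          obtain ⟨hycop, hcy⟩ := (rayEquiv_of_isCoprime hcn').1 hcy
          rcases Finset.mem_insert.1 hy with rfl | hy
          · exact (hnq hycop (Dvd.intro _ rfl)).elim
          · obtain ⟨g, -, rfl⟩ := Finset.mem_image.1 hy
            congr 1
            apply Subtype.ext
            change _ = idealClass c hcn' * τ⁻¹
            rw [hcy, idealClass_classRep, mul_inv_cancel_right]
  have hmem : Finsupp.single (toFrac (classRep σ) * (toFrac n)⁻¹) 1 -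
      ∑ b ∈ insert (ofPrime q * a') (Finset.univ.image R),
        Finsupp.single (toFrac b * (toFrac n')⁻¹) 1 ∈ distRel K :=
    AddSubgroup.subset_closure ⟨_, n, n', _, h, hsys, rfl⟩
  rw [Finset.sum_insert hb0R, Finset.sum_image hRinj.injOn, ← QuotientAddGroup.eq_zero_iff,
    QuotientAddGroup.mk_sub, QuotientAddGroup.mk_add, QuotientAddGroup.mk_sum] at hmem
  have hfrac : toFrac (ofPrime q * a') * (toFrac n')⁻¹ = toFrac a' * (toFrac n)⁻¹ := by
    rw [hn', map_mul, map_mul, mul_inv, mul_comm (toFrac n)⁻¹, mul_comm (toFrac (ofPrime q)),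
      mul_assoc, mul_inv_cancel_left]
  rw [hfrac, ← sub_sub] at hmem
  exact hmem

end

section

/-! ### Systems of elements indexed by three groups with signs -/

/-- Three finite commutative groups `A i`, each the product of a subgroup `B i` and the group
generated by an element `ε i` of order two, together with elements `z S a` of a group `Q`, for
`S ⊆ {0, 1, 2}` and `a ∈ A 0 × A 1 × A 2`, which depend only on the coordinates of `a` in `S`,
are invariant under the simultaneous sign change `ε`, and satisfy norm relations: the `z S a` are
the elements of `Δ / U(m)` at level `∏_{i ∈ S} p_i` which lie over a fixed ideal class, and
`f i` is the Frobenius at `p_i`. -/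
structure LevelSystem {A : Fin 3 → Type*} [∀ i, CommGroup (A i)] [∀ i, Fintype (A i)]
    (B : ∀ i, Subgroup (A i)) [∀ i, Fintype (B i)] (ε : ∀ i, A i) (Q : Type*)
    [AddCommGroup Q] where
  eps_mul_eps : ∀ i, ε i * ε i = 1
  eps_mul_mem : ∀ i a, ε i * a ∈ B i ↔ a ∉ B i
  f : Fin 3 → ∀ i, A i
  z : Finset (Fin 3) → (∀ i, A i) → Q
  z_congr : ∀ S a b, (∀ i ∈ S, a i = b i) → z S a = z S b
  z_eps : ∀ S a, z S (ε * a) = z S a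
  z_sum : ∀ S i a, S.Nonempty → i ∉ S →
    ∑ t : A i, z (insert i S) (Pi.mulSingle i t * a) = z S a - z S ((f i)⁻¹ * a)
  z_sum_empty : ∀ i a, ∑ t : B i, z {i} (Pi.mulSingle i (t : A i) * a) = 0

variable {A : Fin 3 → Type*} [∀ i, CommGroup (A i)] [∀ i, Fintype (A i)]
  {B : ∀ i, Subgroup (A i)} [∀ i, Fintype (B i)] {ε : ∀ i, A i} {Q : Type*} [AddCommGroup Q]

/-- The sum of the translates of a function by the elements of `B i`. -/
def sumB (B : ∀ i, Subgroup (A i)) [∀ i, Fintype (B i)] (i : Fin 3) (g : (∀ i, A i) → Q) :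
    (∀ i, A i) → Q :=
  fun a => ∑ t : B i, g (Pi.mulSingle i (t : A i) * a)

lemma sumB_comm (i j : Fin 3) (g : (∀ i, A i) → Q) :
    sumB B i (sumB B j g) = sumB B j (sumB B i g) := by
  funext a
  simp only [sumB]
  rw [Finset.sum_comm]
  simp_rw [mul_left_comm]

lemma sumB_mul_single {i : Fin 3} (g : (∀ i, A i) → Q) {t : A i} (ht : t ∈ B i) (a : ∀ i, A i) :
    sumB B i g (Pi.mulSingle i t * a) = sumB B i g a := by
  simp only [sumB]
  refine Fintype.sum_equiv (Equiv.mulRight (⟨t, ht⟩ : B i)) _ _ fun s => ?_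
  simp only [Equiv.coe_mulRight, Subgroup.coe_mul, Pi.mulSingle_mul, mul_assoc]

lemma sumB_mem {W : AddSubgroup Q} {i : Fin 3} {g : (∀ i, A i) → Q} {a : ∀ i, A i}
    (h : ∀ t ∈ B i, g (Pi.mulSingle i t * a) ∈ W) : sumB B i g a ∈ W :=
  sum_mem fun t _ => h t t.2

lemma mem_of_sumB_mem {W : AddSubgroup Q} {i : Fin 3} {g : (∀ i, A i) → Q} {a : ∀ i, A i}
    (hs : sumB B i g a ∈ W) (h : ∀ t ∈ B i, t ≠ 1 → g (Pi.mulSingle i t * a) ∈ W) : g a ∈ W := by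
  classical
  rw [sumB, ← Finset.add_sum_erase _ _ (Finset.mem_univ (1 : B i))] at hs
  have h1 : ∑ t ∈ Finset.univ.erase (1 : B i), g (Pi.mulSingle i (t : A i) * a) ∈ W :=
    sum_mem fun t ht => h t t.2 fun h1 => (Finset.mem_erase.1 ht).1 (Subtype.ext h1)
  have := (W.add_mem_cancel_right h1).1 hs
  simpa using this

/-- If the sum of `g` over each `B i`-coset lies in `W`, then the values of `g` at elements with
trivial `i`-th coordinate can be expressed through those with nontrivial coordinate. -/
lemma mem_of_sumB_mem_of_ne_one {W : AddSubgroup Q} {i : Fin 3} {g : (∀ i, A i) → Q}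
    (C : (∀ i, A i) → Prop) (hC : ∀ t b, C b → C (Pi.mulSingle i t * b))
    (hs : ∀ b, (∀ i, b i ∈ B i) → C b → sumB B i g b ∈ W)
    (h : ∀ b, (∀ i, b i ∈ B i) → C b → b i ≠ 1 → g b ∈ W) {b : ∀ i, A i} (hb : ∀ i, b i ∈ B i)
    (hCb : C b) : g b ∈ W := by
  by_cases h1 : b i = 1
  · refine mem_of_sumB_mem (hs b hb hCb) fun t ht ht1 => h _ (fun j => ?_) (hC _ _ hCb) ?_
    · rcases eq_or_ne j i with rfl | hj
      · rw [Pi.mul_apply, Pi.mulSingle_eq_same]; exact mul_mem ht (hb j)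
      · rw [Pi.mul_apply, Pi.mulSingle_eq_of_ne hj, one_mul]; exact hb j
    · rwa [Pi.mul_apply, Pi.mulSingle_eq_same, h1, mul_one]
  · exact h b hb hCb h1

/-- A sum over `A i` is a sum over `B i` and its other coset `ε i * B i`. -/
lemma sum_eq_sum_subgroup (h1 : ∀ i, ε i * ε i = 1)
    (h2 : ∀ i a, ε i * a ∈ B i ↔ a ∉ B i) (i : Fin 3) (g : A i → Q) :
    ∑ t : A i, g t = ∑ t : B i, (g t + g (ε i * t)) := by
  classical
  rw [← Finset.sum_filter_add_sum_filter_not Finset.univ (fun t => t ∈ B i), Finset.sum_add_distrib]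
  congr 1
  · rw [Finset.sum_subtype]
    simp
  · symm
    refine Finset.sum_bij (fun t _ => ε i * t) ?_ ?_ ?_ ?_
    · intro t _
      rw [Finset.mem_filter, ← h2, ← mul_assoc, h1, one_mul]
      exact ⟨Finset.mem_univ _, t.2⟩
    · intro t _ s _ h
      exact Subtype.ext (mul_left_cancel h)
    · intro t ht
      rw [Finset.mem_filter, ← h2] at ht
      exact ⟨⟨_, ht.2⟩, Finset.mem_univ _, by rw [← mul_assoc, h1, one_mul]⟩
    · intro t _; rfl

lemma fin_three_ne (i : Fin 3) : i ≠ i + 1 ∧ i + 1 ≠ i + 2 ∧ i ≠ i + 2 := by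
  revert i; decide

lemma fin_three_insert (i : Fin 3) : insert i {i + 1, i + 2} = (Finset.univ : Finset (Fin 3)) := by
  revert i; decide

lemma fin_three_pair_ne (i : Fin 3) : ({i + 1, i + 2} : Finset (Fin 3)) ≠ Finset.univ := by
  revert i; decide

namespace LevelSystem

variable (D : LevelSystem B ε Q)
include D

/-- The sign change in the coordinate `i`. -/
def e (_ : LevelSystem B ε Q) (i : Fin 3) : ∀ i, A i := Pi.mulSingle i (ε i)

lemma e_mul_e (i : Fin 3) : D.e i * D.e i = 1 := by
  rw [e, ← Pi.mulSingle_mul, D.eps_mul_eps, Pi.mulSingle_one]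

lemma sumB_add_sumB {S T : Finset (Fin 3)} {i : Fin 3} (hT : insert i S = T) (hS : S.Nonempty)
    (hi : i ∉ S) (a : ∀ i, A i) :
    sumB B i (D.z T) a + sumB B i (D.z T) (D.e i * a) = D.z S a - D.z S ((D.f i)⁻¹ * a) := by
  subst hT
  rw [← D.z_sum S i a hS hi, sum_eq_sum_subgroup D.eps_mul_eps D.eps_mul_mem,
    Finset.sum_add_distrib]
  congr 1
  refine Finset.sum_congr rfl fun t _ => ?_
  rw [e, ← mul_assoc, ← Pi.mulSingle_mul, mul_comm (t : A i)]

lemma sumB_singleton (i : Fin 3) : sumB B i (D.z {i}) = 0 := funext fun a => D.z_sum_empty i a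

lemma e_mul_of_mem_e {i : Fin 3} {a : ∀ i, A i} : (D.e i * a) i ∈ B i ↔ a i ∉ B i := by
  rw [e, Pi.mul_apply, Pi.mulSingle_eq_same, D.eps_mul_mem]

lemma e_mul_apply_of_ne {i j : Fin 3} (h : j ≠ i) (a : ∀ i, A i) : (D.e i * a) j = a j := by
  rw [e, Pi.mul_apply, Pi.mulSingle_eq_of_ne h, one_mul]

lemma e_mul_e_mul_e {i j k : Fin 3} (hij : i ≠ j) (hjk : j ≠ k) (hik : i ≠ k) :
    D.e i * D.e j * D.e k = ε := by
  funext l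
  have : l = i ∨ l = j ∨ l = k := by revert i j k l; decide
  rcases this with rfl | rfl | rfl
  · simp [e, Pi.mulSingle_eq_of_ne hij, Pi.mulSingle_eq_of_ne hik]
  · simp [e, Pi.mulSingle_eq_of_ne hij.symm, Pi.mulSingle_eq_of_ne hjk]
  · simp [e, Pi.mulSingle_eq_of_ne hik.symm, Pi.mulSingle_eq_of_ne hjk.symm]

lemma z_e_mul_e {S : Finset (Fin 3)} {i j k : Fin 3} (hij : i ≠ j) (hjk : j ≠ k) (hik : i ≠ k)
    (a : ∀ i, A i) : D.z S (D.e i * (D.e j * a)) = D.z S (D.e k * a) := by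
  have h : D.e i * (D.e j * a) = ε * (D.e k * a) := by
    calc D.e i * (D.e j * a) = D.e i * D.e j * (D.e k * D.e k) * a := by
          rw [D.e_mul_e, mul_one, mul_assoc]
      _ = D.e i * D.e j * D.e k * (D.e k * a) := by simp only [mul_assoc]
      _ = _ := by rw [D.e_mul_e_mul_e hij hjk hik]
  rw [h, D.z_eps]

lemma z_e_of_notMem {S : Finset (Fin 3)} {i : Fin 3} (hi : i ∉ S) (a : ∀ i, A i) :
    D.z S (D.e i * a) = D.z S a :=
  D.z_congr _ _ _ fun j hj => D.e_mul_apply_of_ne (fun h : j = i => hi (h ▸ hj)) a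

/-! #### The torsion element -/

/-- The sum of the elements of level `{j, k}` over `B j × B k`. -/
def pairSum (j k : Fin 3) : (∀ i, A i) → Q := sumB B j (sumB B k (D.z {j, k}))

lemma sumB_sumB_add {i j : Fin 3} (g : (∀ i, A i) → Q) (c a : ∀ i, A i) :
    sumB B i (sumB B j g) a + sumB B i (sumB B j g) (c * a) =
      ∑ t : B i, (sumB B j g (Pi.mulSingle i (t : A i) * a) +
        sumB B j g (c * (Pi.mulSingle i (t : A i) * a))) := by
  rw [Finset.sum_add_distrib]
  congr 1
  refine Finset.sum_congr rfl fun t _ => ?_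
  rw [mul_left_comm]

/-- The sum over `A j` of the elements of level `{j, k}` is a difference of elements of level `{k}`,
which the sum over `B k` kills. -/
lemma pairSum_e_mul {j k : Fin 3} (hjk : j ≠ k) (a : ∀ i, A i) :
    D.pairSum j k (D.e j * a) = - D.pairSum j k a := by
  rw [eq_neg_iff_add_eq_zero, add_comm, pairSum, sumB_comm, D.sumB_sumB_add]
  have h := fun a => D.sumB_add_sumB (S := {k}) (T := {j, k}) (i := j) rfl
    (Finset.singleton_nonempty k) (by simpa using hjk) a
  simp_rw [h]
  have h0 : ∀ a, ∑ t : B k, D.z {k} (Pi.mulSingle k (t : A k) * a) = 0 := D.z_sum_empty k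
  rw [Finset.sum_sub_distrib, h0]
  simp_rw [mul_left_comm]
  rw [h0, sub_zero]

lemma pairSum_e_mul' {i j k : Fin 3} (hij : i ≠ j) (hjk : j ≠ k) (hik : i ≠ k) (a : ∀ i, A i) :
    D.pairSum j k (D.e k * a) = - D.pairSum j k a := by
  rw [← D.pairSum_e_mul hjk, pairSum]
  simp only [sumB]
  refine Finset.sum_congr rfl fun t _ => Finset.sum_congr rfl fun s _ => ?_
  rw [mul_left_comm _ (D.e k), mul_left_comm _ (D.e k), ← D.z_e_mul_e hij hjk hik, D.z_e_of_notMem,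
    mul_left_comm _ (D.e j), mul_left_comm _ (D.e j)]
  simp [hij, hik]

lemma pairSum_mul_of_mem {j k : Fin 3} (hjk : j ≠ k) {c : ∀ i, A i} (hj : c j ∈ B j)
    (hk : c k ∈ B k) (a : ∀ i, A i) : D.pairSum j k (c * a) = D.pairSum j k a := by
  have h1 : D.pairSum j k (c * a) =
      D.pairSum j k (Pi.mulSingle j (c j) * (Pi.mulSingle k (c k) * a)) := by
    simp only [pairSum, sumB]
    refine Finset.sum_congr rfl fun t _ => Finset.sum_congr rfl fun s _ => ?_
    refine D.z_congr _ _ _ fun l hl => ?_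
    rcases Finset.mem_insert.1 hl with rfl | hl
    · simp [Pi.mulSingle_eq_of_ne hjk]
    · rw [Finset.mem_singleton.1 hl]
      simp [Pi.mulSingle_eq_of_ne hjk.symm]
  rw [h1, pairSum, sumB_mul_single _ hj, sumB_comm, sumB_mul_single _ hk]

/-- All translates of the sum over `B j × B k` are equal to it up to sign. -/
lemma pairSum_mul {i j k : Fin 3} (hij : i ≠ j) (hjk : j ≠ k) (hik : i ≠ k) (c a : ∀ i, A i) :
    D.pairSum j k (c * a) = D.pairSum j k a ∨ D.pairSum j k (c * a) = - D.pairSum j k a := by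
  by_cases hj : c j ∈ B j <;> by_cases hk : c k ∈ B k
  · exact Or.inl (D.pairSum_mul_of_mem hjk hj hk a)
  · right
    rw [← D.pairSum_mul_of_mem hjk (c := D.e k * c) (a := a)
      (by rwa [D.e_mul_apply_of_ne hjk]) (D.e_mul_of_mem_e.2 hk), mul_assoc,
      D.pairSum_e_mul' hij hjk hik, neg_neg]
  · right
    rw [← D.pairSum_mul_of_mem hjk (c := D.e j * c) (a := a)
      (D.e_mul_of_mem_e.2 hj) (by rwa [D.e_mul_apply_of_ne hjk.symm]), mul_assoc,
      D.pairSum_e_mul hjk, neg_neg]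
  · left
    rw [← D.pairSum_mul_of_mem hjk (c := D.e j * (D.e k * c)) (a := a), mul_assoc, mul_assoc,
      D.pairSum_e_mul hjk, D.pairSum_e_mul' hij hjk hik, neg_neg]
    · rwa [D.e_mul_of_mem_e, D.e_mul_apply_of_ne hjk]
    · rwa [D.e_mul_apply_of_ne hjk.symm, D.e_mul_of_mem_e]

/-- The sum of the elements of full level over `B 0 × B 1 × B 2`. -/
def fullSum : (∀ i, A i) → Q := sumB B 0 (sumB B 1 (sumB B 2 (D.z Finset.univ)))

lemma fullSum_eq : ∀ i : Fin 3,
    D.fullSum = sumB B (i + 1) (sumB B (i + 2) (sumB B i (D.z Finset.univ)))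
  | 0 => by
    change _ = sumB B 1 (sumB B 2 (sumB B 0 _))
    rw [fullSum, sumB_comm 2 0, sumB_comm 1 0]
  | 1 => by
    change _ = sumB B 2 (sumB B 0 (sumB B 1 _))
    rw [fullSum, sumB_comm 1 2, sumB_comm 0 2]
  | 2 => rfl

/-- The subgroup generated by the elements of level other than the full one. -/
def lower : AddSubgroup Q :=
  AddSubgroup.closure {x | ∃ S a, S ≠ Finset.univ ∧ x = D.z S a}

lemma z_mem_lower {S : Finset (Fin 3)} (hS : S ≠ Finset.univ) (a : ∀ i, A i) :
    D.z S a ∈ D.lower := AddSubgroup.subset_closure ⟨S, a, hS, rfl⟩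

/-- The norm relation gives `x - F_i⁻¹ x` with `x` the sum over `B j × B k` at the level without
`i`, and `F_i⁻¹ x` is `x` or `-x`; so the result is `0` or twice `x`. -/
lemma exists_fullSum_add_eq (i : Fin 3) (a : ∀ i, A i) :
    ∃ w ∈ D.lower, D.fullSum a + D.fullSum (D.e i * a) = w + w := by
  obtain ⟨hij, hjk, hik⟩ := fin_three_ne i
  have h1 : D.fullSum a + D.fullSum (D.e i * a) =
      D.pairSum (i + 1) (i + 2) a - D.pairSum (i + 1) (i + 2) ((D.f i)⁻¹ * a) := by
    rw [D.fullSum_eq i, D.sumB_sumB_add]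
    simp_rw [D.sumB_sumB_add, D.sumB_add_sumB (fin_three_insert i)
      (Finset.insert_nonempty _ _) (by simp [hij, hik])]
    simp only [pairSum, sumB, Finset.sum_sub_distrib]
    congr 1
    refine Finset.sum_congr rfl fun t _ => Finset.sum_congr rfl fun s _ => ?_
    rw [mul_left_comm _ (D.f i)⁻¹, mul_left_comm _ (D.f i)⁻¹]
  rcases D.pairSum_mul hij hjk hik (D.f i)⁻¹ a with h | h
  · exact ⟨0, zero_mem _, by rw [h1, h, sub_self, add_zero]⟩
  · refine ⟨D.pairSum (i + 1) (i + 2) a, ?_, by rw [h1, h, sub_neg_eq_add]⟩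
    exact sumB_mem fun t _ => sumB_mem fun s _ => D.z_mem_lower (fin_three_pair_ne i) _

/-- Modulo elements of lower level, the sum of the elements of full level over the product of the
`B i` is a torsion element, because `2 = (1 + e₂) + (1 + e₀) - e₀ (1 + e₁)` when `e₀ e₁ e₂ = 1`. -/
lemma exists_torsion : ∃ w ∈ D.lower, 2 • (D.fullSum 1 - w) = 0 := by
  obtain ⟨w0, hw0, h0⟩ := D.exists_fullSum_add_eq 0 1
  obtain ⟨w1, hw1, h1⟩ := D.exists_fullSum_add_eq 1 (D.e 0 * 1)
  obtain ⟨w2, hw2, h2⟩ := D.exists_fullSum_add_eq 2 1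
  refine ⟨w2 + w0 - w1, sub_mem (add_mem hw2 hw0) hw1, ?_⟩
  have h3 : D.fullSum (D.e 1 * (D.e 0 * 1)) = D.fullSum (D.e 2 * 1) := by
    simp only [fullSum, sumB]
    refine Finset.sum_congr rfl fun t _ => Finset.sum_congr rfl fun s _ =>
      Finset.sum_congr rfl fun r _ => ?_
    rw [mul_left_comm _ (D.e 1), mul_left_comm _ (D.e 1), mul_left_comm _ (D.e 1),
      mul_left_comm _ (D.e 0), mul_left_comm _ (D.e 0), mul_left_comm _ (D.e 0),
      D.z_e_mul_e (k := 2) (by decide) (by decide) (by decide), mul_left_comm _ (D.e 2),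
      mul_left_comm _ (D.e 2), mul_left_comm _ (D.e 2)]
  rw [h3] at h1
  have : 2 • (D.fullSum 1 - (w2 + w0 - w1)) =
      2 • D.fullSum 1 - (w2 + w2) - (w0 + w0) + (w1 + w1) := by abel
  rw [this, ← h0, ← h1, ← h2]
  abel

lemma map_fullSum_sub {V : Type*} [AddCommGroup V]
    (f : Q →+ V) {v : V} (h1 : ∀ a, f (D.z Finset.univ a) = v)
    (h2 : ∀ S a, S ≠ Finset.univ → f (D.z S a) = 0) {w : Q} (hw : w ∈ D.lower) :
    f (D.fullSum 1 - w) = (∏ i, Fintype.card (B i)) • v := by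
  have hw0 : f w = 0 := by
    have : D.lower ≤ f.ker := by
      rw [lower, AddSubgroup.closure_le]
      rintro _ ⟨S, a, hS, rfl⟩
      exact h2 S a hS
    exact this hw
  rw [map_sub, hw0, sub_zero]
  simp only [fullSum, sumB, map_sum, h1, Finset.sum_const, Finset.card_univ, smul_smul,
    Fin.prod_univ_three, mul_assoc]

end LevelSystem

end

section

variable {A : Fin 3 → Type*} [∀ i, CommGroup (A i)] [∀ i, Fintype (A i)]
  {B : ∀ i, Subgroup (A i)} [∀ i, Fintype (B i)] {ε : ∀ i, A i} {Q : Type*} [AddCommGroup Q]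

/-! ### A generating set modulo the torsion element -/

open Classical in
/-- The elements of `B i`. -/
def finB (B : ∀ i, Subgroup (A i)) (i : Fin 3) : Finset (A i) := Finset.univ.filter (· ∈ B i)

open Classical in
/-- The nontrivial elements of `B i`. -/
def finB' (B : ∀ i, Subgroup (A i)) (i : Fin 3) : Finset (A i) := (finB B i).erase 1

lemma mem_finB {i : Fin 3} {t : A i} : t ∈ finB B i ↔ t ∈ B i := by
  classical simp [finB]

lemma mem_finB' {i : Fin 3} {t : A i} : t ∈ finB' B i ↔ t ≠ 1 ∧ t ∈ B i := by
  classical rw [finB', Finset.mem_erase, mem_finB]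

lemma card_finB (i : Fin 3) : (finB B i).card = Fintype.card (B i) := by
  classical
  rw [finB, ← Fintype.card_subtype]

lemma card_finB' (i : Fin 3) : (finB' B i).card = Fintype.card (B i) - 1 := by
  classical
  rw [finB', Finset.card_erase_of_mem (mem_finB.2 (one_mem _)), card_finB]

open Classical in
/-- Levels and indices of elements that generate everything modulo the torsion element. With
`e i` the sign change in the coordinate `i`, and `b` running through elements of
`B 0 × B 1 × B 2`, these are: `1` at level `∅`; the `b` with `b i ≠ 1` at level `{i}`; all `b`, and
the `e j b` with `b j ≠ 1` and `b k ≠ 1`, at level `{j, k}`; the `b ≠ 1`, and the `e i b` with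
`b i ≠ 1` and `b (i + 1) ≠ 1`, at level `{0, 1, 2}`. -/
def genIndex (B : ∀ i, Subgroup (A i)) (ε : ∀ i, A i) : Finset (Finset (Fin 3) × ∀ i, A i) :=
  {(∅, 1)} ∪
  (Finset.univ.biUnion fun i : Fin 3 => (Fintype.piFinset fun l =>
    if l = i then finB' B l else {1}).image (Prod.mk {i})) ∪
  (Finset.univ.biUnion fun i : Fin 3 => (Fintype.piFinset fun l =>
    if l = i then {1} else finB B l).image (Prod.mk {i + 1, i + 2})) ∪
  (Finset.univ.biUnion fun i : Fin 3 => (Fintype.piFinset fun l =>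
    if l = i then {1} else finB' B l).image
      fun b => ({i + 1, i + 2}, Pi.mulSingle (i + 1) (ε (i + 1)) * b)) ∪
  ((Fintype.piFinset (finB B)).erase 1).image (Prod.mk Finset.univ) ∪
  (Finset.univ.biUnion fun i : Fin 3 => (Fintype.piFinset fun l =>
    if l = i + 2 then finB B l else finB' B l).image
      fun b => (Finset.univ, Pi.mulSingle i (ε i) * b))

/-- Writing `|B i| = n i + 1`, the bound is the identity
`1 + ∑ n i + ∑ (n j + 1) (n k + 1) + ∑ n j n k + (∏ (n i + 1) - 1) + ∑ n i n j (n k + 1) =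
4 ∏ (n i + 1)`. -/
lemma card_genIndex_le :
    (genIndex B ε).card ≤ 4 * ∏ i, Fintype.card (B i) := by
  classical
  have hpos : ∀ i, ∃ n, Fintype.card (B i) = n + 1 := fun i =>
    ⟨Fintype.card (B i) - 1, by have := Fintype.card_pos (α := B i); omega⟩
  choose n hn using hpos
  have h1 : ∀ i, (finB B i).card = n i + 1 := fun i => by rw [card_finB, hn]
  have h2 : ∀ i, (finB' B i).card = n i := fun i => by rw [card_finB', hn]; rfl
  have h3 : ((Fintype.piFinset (finB B)).erase 1).card + 1 = ∏ i, (n i + 1) := by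
    rw [Finset.card_erase_add_one, Fintype.card_piFinset]
    · simp_rw [h1]
    · exact Fintype.mem_piFinset.2 fun i => mem_finB.2 (one_mem _)
  have hle : (genIndex B ε).card ≤ 1 + (∑ i : Fin 3, ∏ l, (if l = i then n l else 1)) +
      (∑ i : Fin 3, ∏ l, (if l = i then 1 else n l + 1)) +
      (∑ i : Fin 3, ∏ l, (if l = i then 1 else n l)) +
      ((Fintype.piFinset (finB B)).erase 1).card +
      (∑ i : Fin 3, ∏ l, (if l = i + 2 then n l + 1 else n l)) := by
    rw [genIndex]
    refine (Finset.card_union_le _ _).trans (add_le_add ?_ ?_)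
    · refine (Finset.card_union_le _ _).trans (add_le_add ?_ Finset.card_image_le)
      refine (Finset.card_union_le _ _).trans (add_le_add ?_ ?_)
      · refine (Finset.card_union_le _ _).trans (add_le_add ?_ ?_)
        · refine (Finset.card_union_le _ _).trans (add_le_add ?_ ?_)
          · simp
          · refine Finset.card_biUnion_le.trans (Finset.sum_le_sum fun i _ => ?_)
            refine Finset.card_image_le.trans (le_of_eq ?_)
            rw [Fintype.card_piFinset]
            refine Finset.prod_congr rfl fun l _ => ?_
            split_ifs <;> simp [h2]
        · refine Finset.card_biUnion_le.trans (Finset.sum_le_sum fun i _ => ?_)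
          refine Finset.card_image_le.trans (le_of_eq ?_)
          rw [Fintype.card_piFinset]
          refine Finset.prod_congr rfl fun l _ => ?_
          split_ifs <;> simp [h1]
      · refine Finset.card_biUnion_le.trans (Finset.sum_le_sum fun i _ => ?_)
        refine Finset.card_image_le.trans (le_of_eq ?_)
        rw [Fintype.card_piFinset]
        refine Finset.prod_congr rfl fun l _ => ?_
        split_ifs <;> simp [h2]
    · refine Finset.card_biUnion_le.trans (Finset.sum_le_sum fun i _ => ?_)
      refine Finset.card_image_le.trans (le_of_eq ?_)
      rw [Fintype.card_piFinset]
      refine Finset.prod_congr rfl fun l _ => ?_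
      split_ifs <;> simp [h1, h2]
  refine hle.trans (le_of_eq ?_)
  apply Nat.add_right_cancel (m := 1)
  rw [add_right_comm, add_assoc _ _ 1, h3]
  simp_rw [hn]
  simp [Fin.sum_univ_three, Fin.prod_univ_three]
  ring

lemma fin_three_cases (i l : Fin 3) : l = i ∨ l = i + 1 ∨ l = i + 2 := by
  revert i l; decide

lemma fin_three_add (i : Fin 3) : i + 2 + 1 = i := by
  revert i; decide

namespace LevelSystem

variable (D : LevelSystem B ε Q)
include D

variable {W : AddSubgroup Q}

lemma z_empty_mem (hW : ∀ x ∈ genIndex B ε, D.z x.1 x.2 ∈ W) (a : ∀ i, A i) : D.z ∅ a ∈ W := by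
  rw [D.z_congr ∅ a 1 (by simp)]
  exact hW (∅, 1) (by simp [genIndex])

lemma z_singleton_mem (hW : ∀ x ∈ genIndex B ε, D.z x.1 x.2 ∈ W) (i : Fin 3) (a : ∀ i, A i) :
    D.z {i} a ∈ W := by
  classical
  have h1 : ∀ b, (∀ i, b i ∈ B i) → D.z {i} b ∈ W := by
    intro b hb
    refine mem_of_sumB_mem_of_ne_one (i := i) (fun _ => True) (fun _ _ _ => trivial) ?_ ?_ hb
      trivial
    · intro b _ _
      rw [D.sumB_singleton]
      exact zero_mem _
    · intro b hb _ hbi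
      rw [D.z_congr {i} b (Pi.mulSingle i (b i)) (by simp)]
      refine hW ({i}, Pi.mulSingle i (b i)) ?_
      simp only [genIndex, Finset.mem_union, Finset.mem_biUnion, Finset.mem_image]
      refine Or.inl (Or.inl (Or.inl (Or.inl (Or.inr ⟨i, Finset.mem_univ _, _, ?_, rfl⟩))))
      refine Fintype.mem_piFinset.2 fun l => ?_
      by_cases hl : l = i
      · subst hl
        rw [if_pos rfl, Pi.mulSingle_eq_same]
        exact mem_finB'.2 ⟨hbi, hb _⟩
      · rw [if_neg hl, Pi.mulSingle_eq_of_ne hl]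
        exact Finset.mem_singleton_self _
  have h2 : ∀ a : ∀ i, A i, a i ∈ B i → D.z {i} a ∈ W := by
    intro a ha
    rw [D.z_congr {i} a (Pi.mulSingle i (a i)) (by simp)]
    refine h1 _ fun l => ?_
    by_cases hl : l = i
    · subst hl; rwa [Pi.mulSingle_eq_same]
    · rw [Pi.mulSingle_eq_of_ne hl]; exact one_mem _
  by_cases ha : a i ∈ B i
  · exact h2 a ha
  · rw [← D.z_eps]
    exact h2 _ ((D.eps_mul_mem _ _).2 ha)

lemma z_pair_mem (hW : ∀ x ∈ genIndex B ε, D.z x.1 x.2 ∈ W) (i : Fin 3) (a : ∀ i, A i) :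
    D.z {i + 1, i + 2} a ∈ W := by
  classical
  obtain ⟨hij, hjk, hik⟩ := fin_three_ne i
  -- At level `{j, k}` only the coordinates `j` and `k` matter.
  have hcut : ∀ c b : ∀ i, A i, D.z {i + 1, i + 2} (c * b) =
      D.z {i + 1, i + 2} (c * Function.update b i 1) := fun c b =>
    D.z_congr _ _ _ fun l hl => by
      have : l ≠ i := by
        rintro rfl
        simp [hij, hik] at hl
      rw [Pi.mul_apply, Pi.mul_apply, Function.update_of_ne this]
  have h1 : ∀ b, (∀ i, b i ∈ B i) → D.z {i + 1, i + 2} b ∈ W := by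
    intro b hb
    rw [← one_mul b, hcut, one_mul]
    refine hW (_, Function.update b i 1) ?_
    simp only [genIndex, Finset.mem_union, Finset.mem_biUnion, Finset.mem_image]
    refine Or.inl (Or.inl (Or.inl (Or.inr ⟨i, Finset.mem_univ _, _, ?_, rfl⟩)))
    refine Fintype.mem_piFinset.2 fun l => ?_
    by_cases hl : l = i
    · subst hl
      rw [if_pos rfl, Function.update_self]
      exact Finset.mem_singleton_self _
    · rw [if_neg hl, Function.update_of_ne hl]
      exact mem_finB.2 (hb _)
  have h2 : ∀ b, (∀ i, b i ∈ B i) → b (i + 1) ≠ 1 → b (i + 2) ≠ 1 →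
      D.z {i + 1, i + 2} (D.e (i + 1) * b) ∈ W := by
    intro b hb hbj hbk
    rw [hcut]
    refine hW (_, D.e (i + 1) * Function.update b i 1) ?_
    simp only [genIndex, Finset.mem_union, Finset.mem_biUnion, Finset.mem_image]
    refine Or.inl (Or.inl (Or.inr ⟨i, Finset.mem_univ _, _, ?_, rfl⟩))
    refine Fintype.mem_piFinset.2 fun l => ?_
    have hl3 := fin_three_cases i l
    rcases hl3 with rfl | rfl | rfl
    · rw [if_pos rfl, Function.update_self]
      exact Finset.mem_singleton_self _
    · rw [if_neg hij.symm, Function.update_of_ne hij.symm]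
      exact mem_finB'.2 ⟨hbj, hb _⟩
    · rw [if_neg hik.symm, Function.update_of_ne hik.symm]
      exact mem_finB'.2 ⟨hbk, hb _⟩
  -- The norm relations from level `{j, k}` to the levels `{k}` and `{j}` remove the conditions
  -- `b j ≠ 1` and `b k ≠ 1`.
  have hs : ∀ b, (∀ i, b i ∈ B i) →
      sumB B (i + 1) (fun b => D.z {i + 1, i + 2} (D.e (i + 1) * b)) b ∈ W := by
    intro b hb
    have h := D.sumB_add_sumB (S := {i + 2}) (T := {i + 1, i + 2}) (i := i + 1) rfl
      (Finset.singleton_nonempty _) (by simp) b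
    have h3 : sumB B (i + 1) (D.z {i + 1, i + 2}) b ∈ W := sumB_mem fun t ht => h1 _ fun l => by
      by_cases hl : l = i + 1
      · subst hl; rw [Pi.mul_apply, Pi.mulSingle_eq_same]; exact mul_mem ht (hb _)
      · rw [Pi.mul_apply, Pi.mulSingle_eq_of_ne hl, one_mul]; exact hb _
    have h4 : sumB B (i + 1) (fun b => D.z {i + 1, i + 2} (D.e (i + 1) * b)) b =
        sumB B (i + 1) (D.z {i + 1, i + 2}) (D.e (i + 1) * b) := by
      simp only [sumB]
      simp_rw [mul_left_comm]
    rw [h4, ← W.add_mem_cancel_left h3, h]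
    exact sub_mem (D.z_singleton_mem hW _ _) (D.z_singleton_mem hW _ _)
  have hs' : ∀ b, (∀ i, b i ∈ B i) →
      sumB B (i + 2) (fun b => D.z {i + 1, i + 2} (D.e (i + 1) * b)) b ∈ W := by
    intro b hb
    have h := D.sumB_add_sumB (S := {i + 1}) (T := {i + 1, i + 2}) (i := i + 2)
      (Finset.pair_comm _ _) (Finset.singleton_nonempty _) (by simp) b
    have h3 : sumB B (i + 2) (D.z {i + 1, i + 2}) b ∈ W := sumB_mem fun t ht => h1 _ fun l => by
      by_cases hl : l = i + 2
      · subst hl; rw [Pi.mul_apply, Pi.mulSingle_eq_same]; exact mul_mem ht (hb _)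
      · rw [Pi.mul_apply, Pi.mulSingle_eq_of_ne hl, one_mul]; exact hb _
    have h4 : sumB B (i + 2) (fun b => D.z {i + 1, i + 2} (D.e (i + 1) * b)) b =
        sumB B (i + 2) (D.z {i + 1, i + 2}) (D.e (i + 2) * b) := by
      simp only [sumB]
      refine Finset.sum_congr rfl fun t _ => ?_
      rw [← D.z_e_of_notMem (i := i) (by simp [hij, hik]), D.z_e_mul_e hij hjk hik, mul_left_comm]
    rw [h4, ← W.add_mem_cancel_left h3, h]
    exact sub_mem (D.z_singleton_mem hW _ _) (D.z_singleton_mem hW _ _)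
  have h3 : ∀ b, (∀ i, b i ∈ B i) → b (i + 2) ≠ 1 →
      D.z {i + 1, i + 2} (D.e (i + 1) * b) ∈ W := by
    intro b hb hbk
    refine mem_of_sumB_mem_of_ne_one (i := i + 1) (fun b => b (i + 2) ≠ 1) ?_
      (fun b hb _ => hs b hb) (fun b hb hbk hbj => h2 b hb hbj hbk) hb hbk
    intro t b hb
    rwa [Pi.mul_apply, Pi.mulSingle_eq_of_ne hjk.symm, one_mul]
  have h4 : ∀ b, (∀ i, b i ∈ B i) → D.z {i + 1, i + 2} (D.e (i + 1) * b) ∈ W := fun b hb =>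
    mem_of_sumB_mem_of_ne_one (i := i + 2) (fun _ => True) (fun _ _ _ => trivial)
      (fun b hb _ => hs' b hb) (fun b hb _ hbk => h3 b hb hbk) hb trivial
  have h5 : ∀ a : ∀ i, A i, a (i + 2) ∈ B (i + 2) → D.z {i + 1, i + 2} a ∈ W := by
    intro a hak
    by_cases haj : a (i + 1) ∈ B (i + 1)
    · rw [← one_mul a, hcut, one_mul]
      refine h1 _ fun l => ?_
      have hl3 := fin_three_cases i l
      rcases hl3 with rfl | rfl | rfl
      · rw [Function.update_self]; exact one_mem _
      · rwa [Function.update_of_ne hij.symm]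
      · rwa [Function.update_of_ne hik.symm]
    · rw [← one_mul a, ← D.e_mul_e (i + 1), mul_assoc, hcut]
      refine h4 _ fun l => ?_
      have hl3 := fin_three_cases i l
      rcases hl3 with rfl | rfl | rfl
      · rw [Function.update_self]; exact one_mem _
      · rw [Function.update_of_ne hij.symm]
        exact D.e_mul_of_mem_e.2 haj
      · rw [Function.update_of_ne hik.symm, D.e_mul_apply_of_ne hjk.symm]
        exact hak
  by_cases hak : a (i + 2) ∈ B (i + 2)
  · exact h5 a hak
  · rw [← D.z_eps]
    exact h5 _ ((D.eps_mul_mem _ _).2 hak)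

lemma lower_le (hW : ∀ x ∈ genIndex B ε, D.z x.1 x.2 ∈ W) : D.lower ≤ W := by
  rw [lower, AddSubgroup.closure_le]
  rintro _ ⟨S, a, hS, rfl⟩
  have h : S = ∅ ∨ (∃ i, S = {i}) ∨ (∃ i, S = {i + 1, i + 2}) := by revert S; decide
  rcases h with rfl | ⟨i, rfl⟩ | ⟨i, rfl⟩
  · exact D.z_empty_mem hW a
  · exact D.z_singleton_mem hW i a
  · exact D.z_pair_mem hW i a

/-- At full level, the torsion element gives the missing index `1`, and the norm relations then
remove the conditions on the indices `e i * b`. -/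
lemma z_univ_mem (hW : ∀ x ∈ genIndex B ε, D.z x.1 x.2 ∈ W) {w : Q} (hw : w ∈ D.lower)
    (hx : D.fullSum 1 - w ∈ W) (a : ∀ i, A i) : D.z Finset.univ a ∈ W := by
  classical
  have hlow := D.lower_le hW
  have hfull : D.fullSum 1 ∈ W := by
    have := add_mem hx (hlow hw)
    rwa [sub_add_cancel] at this
  have hmul : ∀ {i : Fin 3} {t : A i} {b : ∀ i, A i}, t ∈ B i → (∀ i, b i ∈ B i) →
      ∀ l, (Pi.mulSingle i t * b : ∀ i, A i) l ∈ B l := by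
    intro i t b ht hb l
    by_cases hl : l = i
    · subst hl; rw [Pi.mul_apply, Pi.mulSingle_eq_same]; exact mul_mem ht (hb _)
    · rw [Pi.mul_apply, Pi.mulSingle_eq_of_ne hl, one_mul]; exact hb _
  have h1 : ∀ b : ∀ i, A i, (∀ i, b i ∈ B i) → b ≠ 1 → D.z Finset.univ b ∈ W := by
    intro b hb hb1
    refine hW (_, b) ?_
    simp only [genIndex, Finset.mem_union, Finset.mem_biUnion, Finset.mem_image]
    refine Or.inl (Or.inr ⟨b, Finset.mem_erase.2 ⟨hb1, ?_⟩, rfl⟩)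
    exact Fintype.mem_piFinset.2 fun l => mem_finB.2 (hb l)
  have hne : ∀ {i : Fin 3} {t : A i} {b : ∀ i, A i}, t ≠ 1 → b i = 1 →
      (Pi.mulSingle i t * b : ∀ i, A i) ≠ 1 := by
    intro i t b ht hb h
    have := congrFun h i
    rw [Pi.mul_apply, Pi.mulSingle_eq_same, hb, mul_one] at this
    exact ht this
  -- The full sum expresses the element of index `1` through the other `b`.
  have hone : D.z Finset.univ 1 ∈ W := by
    refine mem_of_sumB_mem (i := 2) (mem_of_sumB_mem (i := 1) (mem_of_sumB_mem (i := 0) hfull ?_)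
      ?_) ?_
    · exact fun t ht ht1 => sumB_mem fun s hs => sumB_mem fun r hr =>
        h1 _ (hmul hr (hmul hs (hmul ht fun _ => one_mem _))) fun h => by
          have := congrFun h 0
          simp at this
          exact ht1 this
    · exact fun s hs hs1 => sumB_mem fun r hr =>
        h1 _ (hmul hr (hmul hs fun _ => one_mem _)) fun h => by
          have := congrFun h 1
          simp at this
          exact hs1 this
    · exact fun r hr hr1 => h1 _ (hmul hr fun _ => one_mem _) (hne hr1 rfl)
  have h2 : ∀ b : ∀ i, A i, (∀ i, b i ∈ B i) → D.z Finset.univ b ∈ W := by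
    intro b hb
    by_cases hb1 : b = 1
    · rw [hb1]; exact hone
    · exact h1 b hb hb1
  have h3 : ∀ i, ∀ b : ∀ i, A i, (∀ i, b i ∈ B i) → b i ≠ 1 → b (i + 1) ≠ 1 →
      D.z Finset.univ (D.e i * b) ∈ W := by
    intro i b hb hbi hbj
    obtain ⟨hij, hjk, hik⟩ := fin_three_ne i
    refine hW (_, D.e i * b) ?_
    simp only [genIndex, Finset.mem_union, Finset.mem_biUnion, Finset.mem_image]
    refine Or.inr ⟨i, Finset.mem_univ _, _, ?_, rfl⟩
    refine Fintype.mem_piFinset.2 fun l => ?_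
    have hl3 := fin_three_cases i l
    rcases hl3 with rfl | rfl | rfl
    · rw [if_neg hik]
      exact mem_finB'.2 ⟨hbi, hb _⟩
    · rw [if_neg hjk]
      exact mem_finB'.2 ⟨hbj, hb _⟩
    · rw [if_pos rfl]
      exact mem_finB.2 (hb _)
  have hsum : ∀ i (a : ∀ i, A i), sumB B i (D.z Finset.univ) a +
      sumB B i (D.z Finset.univ) (D.e i * a) ∈ W := by
    intro i a
    obtain ⟨hij, hjk, hik⟩ := fin_three_ne i
    rw [D.sumB_add_sumB (fin_three_insert i) (Finset.insert_nonempty _ _) (by simp [hij, hik])]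
    exact sub_mem (hlow (D.z_mem_lower (fin_three_pair_ne i) _))
      (hlow (D.z_mem_lower (fin_three_pair_ne i) _))
  have hs : ∀ i (b : ∀ i, A i), (∀ i, b i ∈ B i) →
      sumB B i (fun b => D.z Finset.univ (D.e i * b)) b ∈ W := by
    intro i b hb
    have h4 : sumB B i (fun b => D.z Finset.univ (D.e i * b)) b =
        sumB B i (D.z Finset.univ) (D.e i * b) := by
      simp only [sumB]
      simp_rw [mul_left_comm]
    have h5 : sumB B i (D.z Finset.univ) b ∈ W := sumB_mem fun t ht => h2 _ (hmul ht hb)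
    rw [h4, ← W.add_mem_cancel_left h5]
    exact hsum i b
  have hadjacent : ∀ i, ∀ b : ∀ i, A i, (∀ i, b i ∈ B i) → b (i + 1) ≠ 1 →
      D.z Finset.univ (D.e i * b) ∈ W := by
    intro i b hb hbj
    refine mem_of_sumB_mem_of_ne_one (i := i) (fun b => b (i + 1) ≠ 1) ?_
      (fun b hb _ => hs i b hb) (fun b hb hbj hbi => h3 i b hb hbi hbj) hb hbj
    intro t b hb
    rwa [Pi.mul_apply, Pi.mulSingle_eq_of_ne (fin_three_ne i).1.symm, one_mul]
  -- The condition on the coordinate `i + 1` is removed next.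
  have hcoord : ∀ i, ∀ b : ∀ i, A i, (∀ i, b i ∈ B i) → b i ≠ 1 →
      D.z Finset.univ (D.e i * b) ∈ W := by
    intro i b hb hbi
    obtain ⟨hij, hjk, hik⟩ := fin_three_ne i
    refine mem_of_sumB_mem_of_ne_one (i := i + 1) (fun b => b i ≠ 1) ?_ ?_
      (fun b hb _ hbj => hadjacent i b hb hbj) hb hbi
    · intro t b hb
      rwa [Pi.mul_apply, Pi.mulSingle_eq_of_ne hij, one_mul]
    · -- The sum over `B j` of `e j * e i` is that of `e k`, to which `hadjacent` applies.
      intro b hb hbi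
      have hi3 : i + 2 + 1 = i := fin_three_add i
      have h4 : sumB B (i + 1) (D.z Finset.univ) (D.e (i + 1) * (D.e i * b)) ∈ W :=
        sumB_mem fun t ht => by
          rw [mul_left_comm, mul_left_comm _ (D.e i), D.z_e_mul_e hij.symm hik hjk]
          refine hadjacent (i + 2) _ (hmul ht hb) ?_
          rw [hi3, Pi.mul_apply, Pi.mulSingle_eq_of_ne hij, one_mul]
          exact hbi
      have h5 := hsum (i + 1) (D.e i * b)
      rw [W.add_mem_cancel_right h4] at h5
      have h6 : sumB B (i + 1) (fun b => D.z Finset.univ (D.e i * b)) b =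
          sumB B (i + 1) (D.z Finset.univ) (D.e i * b) := by
        simp only [sumB]
        simp_rw [mul_left_comm]
      rwa [h6]
  have htwist : ∀ i, ∀ b : ∀ i, A i, (∀ i, b i ∈ B i) →
      D.z Finset.univ (D.e i * b) ∈ W := fun i b hb =>
    mem_of_sumB_mem_of_ne_one (i := i) (fun _ => True) (fun _ _ _ => trivial)
      (fun b hb _ => hs i b hb) (fun b hb _ hbi => hcoord i b hb hbi) hb trivial
  -- An element of `A 0 × A 1 × A 2` with first coordinate in `B 0` is one of `b`, `e 1 * b`,
  -- `e 2 * b` and `e 1 * e 2 * b`, and `e 1 * e 2` has the same effect as `e 0`.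
  have hfin : ∀ a : ∀ i, A i, a 0 ∈ B 0 → D.z Finset.univ a ∈ W := by
    intro a h0
    by_cases ha1 : a 1 ∈ B 1 <;> by_cases ha2 : a 2 ∈ B 2
    · refine h2 a fun l => ?_
      fin_cases l
      exacts [h0, ha1, ha2]
    · rw [← one_mul a, ← D.e_mul_e 2, mul_assoc]
      refine htwist 2 _ fun l => ?_
      fin_cases l
      · rwa [Fin.zero_eta, D.e_mul_apply_of_ne (by decide)]
      · rwa [Fin.mk_one, D.e_mul_apply_of_ne (by decide)]
      · exact D.e_mul_of_mem_e.2 ha2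
    · rw [← one_mul a, ← D.e_mul_e 1, mul_assoc]
      refine htwist 1 _ fun l => ?_
      fin_cases l
      · rwa [Fin.zero_eta, D.e_mul_apply_of_ne (by decide)]
      · exact D.e_mul_of_mem_e.2 ha1
      · change (D.e 1 * a) 2 ∈ B 2
        rwa [D.e_mul_apply_of_ne (by decide)]
    · have h4 : a = D.e 1 * (D.e 2 * (D.e 1 * (D.e 2 * a))) := by
        rw [mul_left_comm (D.e 2), ← mul_assoc, D.e_mul_e, one_mul, ← mul_assoc, D.e_mul_e, one_mul]
      rw [h4, D.z_e_mul_e (k := 0) (by decide) (by decide) (by decide)]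
      refine htwist 0 _ fun l => ?_
      fin_cases l
      · change (D.e 1 * (D.e 2 * a)) 0 ∈ B 0
        rwa [D.e_mul_apply_of_ne (by decide), D.e_mul_apply_of_ne (by decide)]
      · refine D.e_mul_of_mem_e.2 ?_
        rwa [D.e_mul_apply_of_ne (by decide)]
      · change (D.e 1 * (D.e 2 * a)) 2 ∈ B 2
        rw [D.e_mul_apply_of_ne (by decide)]
        exact D.e_mul_of_mem_e.2 ha2
  by_cases h0 : a 0 ∈ B 0
  · exact hfin a h0
  · rw [← D.z_eps]
    exact hfin _ ((D.eps_mul_mem _ _).2 h0)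

/-- The elements with index in `genIndex`, together with the torsion element, generate. -/
lemma z_mem (hW : ∀ x ∈ genIndex B ε, D.z x.1 x.2 ∈ W) {w : Q} (hw : w ∈ D.lower)
    (hx : D.fullSum 1 - w ∈ W) (S : Finset (Fin 3)) (a : ∀ i, A i) : D.z S a ∈ W := by
  by_cases hS : S = Finset.univ
  · rw [hS]; exact D.z_univ_mem hW hw hx a
  · exact D.lower_le hW (D.z_mem_lower hS a)

end LevelSystem

end

section

/-! ### Three principal primes -/

/-- Three distinct principal maximal ideals of norm congruent to `3` modulo `4`, with a choice of
generators. -/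
structure PrimeTriple (K : Type*) [Field K] [NumberField K] where
  p : Fin 3 → HeightOneSpectrum (𝓞 K)
  inj : Function.Injective p
  gen : Fin 3 → (𝓞 K)⁰
  prin_gen : ∀ i, prin (gen i) = ofPrime (p i)
  card_mod_four : ∀ i, Nat.card (𝓞 K ⧸ (p i).asIdeal) % 4 = 3

namespace PrimeTriple

variable {K : Type*} [Field K] [NumberField K] (T : PrimeTriple K)

/-- The product of the primes with index in `S`. -/
def lev (S : Finset (Fin 3)) : IntIdeal K := ∏ i ∈ S, ofPrime (T.p i)

lemma lev_insert {S : Finset (Fin 3)} {i : Fin 3} (hi : i ∉ S) :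
    T.lev (insert i S) = T.lev S * ofPrime (T.p i) := by
  rw [lev, Finset.prod_insert hi, mul_comm]; rfl

lemma ord_lev_of_ne {q : HeightOneSpectrum (𝓞 K)} (hq : ∀ i, T.p i ≠ q) (S : Finset (Fin 3)) :
    ord q (T.lev S) = 0 := by
  induction S using Finset.induction_on with
  | empty => exact ord_one q
  | insert i S hi ih => rw [lev_insert _ hi, ord_mul, ih, ord_ofPrime_of_ne (hq i).symm]

lemma ord_p_lev (S : Finset (Fin 3)) (i : Fin 3) :
    ord (T.p i) (T.lev S) = if i ∈ S then 1 else 0 := by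
  induction S using Finset.induction_on with
  | empty => exact ord_one _
  | insert j S hj ih =>
    rw [lev_insert _ hj, ord_mul, ih]
    rcases eq_or_ne i j with rfl | hij
    · rw [ord_ofPrime_self, if_neg hj, if_pos (Finset.mem_insert_self _ _)]
    · rw [ord_ofPrime_of_ne (T.inj.ne hij)]
      simp [hij]

lemma ofPrime_dvd_lev {S : Finset (Fin 3)} {q : HeightOneSpectrum (𝓞 K)} :
    ofPrime q ∣ T.lev S ↔ ∃ i ∈ S, T.p i = q := by
  rw [ofPrime_dvd_iff]
  by_cases hq : ∃ i, T.p i = q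
  · obtain ⟨i, rfl⟩ := hq
    rw [ord_p_lev]
    constructor
    · intro h
      by_cases hi : i ∈ S
      · exact ⟨i, hi, rfl⟩
      · rw [if_neg hi] at h; omega
    · rintro ⟨j, hj, hji⟩
      rw [← T.inj hji, if_pos hj]
  · rw [not_exists] at hq
    rw [T.ord_lev_of_ne hq]
    constructor
    · omega
    · rintro ⟨i, -, hi⟩; exact (hq i hi).elim

lemma lev_dvd_lev {S S' : Finset (Fin 3)} (h : S ⊆ S') : T.lev S ∣ T.lev S' :=
  Finset.prod_dvd_prod_of_subset _ _ _ h

lemma lev_dvd (S : Finset (Fin 3)) : T.lev S ∣ T.lev Finset.univ :=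
  T.lev_dvd_lev (Finset.subset_univ S)

lemma lev_injective : Function.Injective T.lev := by
  intro S S' h
  ext i
  have := congrArg (ord (T.p i)) h
  rw [ord_p_lev, ord_p_lev] at this
  by_cases h1 : i ∈ S <;> by_cases h2 : i ∈ S' <;> simp_all

lemma exists_eq_lev {n : IntIdeal K} (h : n ∣ T.lev Finset.univ) : ∃ S, n = T.lev S := by
  classical
  rw [dvd_iff_ord] at h
  refine ⟨Finset.univ.filter fun i => 1 ≤ ord (T.p i) n, intIdeal_ext fun q => ?_⟩
  have hq := h q
  by_cases hp : ∃ i, T.p i = q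
  · obtain ⟨i, rfl⟩ := hp
    rw [ord_p_lev] at hq ⊢
    rw [if_pos (Finset.mem_univ _)] at hq
    split_ifs with h1
    · rw [Finset.mem_filter] at h1
      omega
    · simp only [Finset.mem_filter, Finset.mem_univ, true_and] at h1
      omega
  · rw [not_exists] at hp
    rw [T.ord_lev_of_ne hp] at hq ⊢
    omega

lemma of_mul_pow_dvd {S : Finset (Fin 3)} {q : HeightOneSpectrum (𝓞 K)} {e : ℕ} (he : 1 ≤ e)
    (h : T.lev S * ofPrime q ^ e ∣ T.lev Finset.univ) : e = 1 ∧ ∃ i, i ∉ S ∧ q = T.p i := by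
  obtain ⟨i, -, rfl⟩ := T.ofPrime_dvd_lev.1
    ((dvd_pow_self (ofPrime q) (by omega)).trans ((Dvd.intro_left _ rfl).trans h))
  have hpow : ∀ e, ord (T.p i) (ofPrime (T.p i) ^ e) = e := fun e => by
    induction e with
    | zero => rw [pow_zero, ord_one]
    | succ e ih => rw [pow_succ, ord_mul, ih, ord_ofPrime_self]
  have h1 := dvd_iff_ord.1 h (T.p i)
  rw [ord_mul, hpow, ord_p_lev, ord_p_lev, if_pos (Finset.mem_univ _)] at h1
  refine ⟨by omega, i, fun hi => ?_, rfl⟩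
  rw [if_pos hi] at h1
  omega

lemma mem_lev {S : Finset (Fin 3)} {x : 𝓞 K} :
    x ∈ (T.lev S : Ideal (𝓞 K)) ↔ ∀ i ∈ S, x ∈ (T.p i).asIdeal := by
  constructor
  · intro h i hi
    exact dvd_iff_le.1 (T.ofPrime_dvd_lev.2 ⟨i, hi, rfl⟩) h
  · intro h
    by_cases hx : x = 0
    · rw [hx]; exact zero_mem _
    let x' : (𝓞 K)⁰ := ⟨x, mem_nonZeroDivisors_of_ne_zero hx⟩
    have : T.lev S ∣ prin x' := dvd_iff_ord.2 fun q => by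
      by_cases hq : ∃ i, T.p i = q
      · obtain ⟨i, rfl⟩ := hq
        rw [ord_p_lev]
        split_ifs with hi
        · exact ofPrime_dvd_iff.1 (dvd_iff_le.2 ((Ideal.span_singleton_le_iff_mem _).2 (h i hi)))
        · exact Nat.zero_le _
      · rw [not_exists] at hq
        rw [T.ord_lev_of_ne hq]
        exact Nat.zero_le _
    exact (Ideal.span_singleton_le_iff_mem _).1 (dvd_iff_le.1 this)

lemma isCoprime_prin_lev {S : Finset (Fin 3)} {x : (𝓞 K)⁰} :
    IsCoprime (prin x : Ideal (𝓞 K)) (T.lev S : Ideal (𝓞 K)) ↔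
      ∀ i ∈ S, (x : 𝓞 K) ∉ (T.p i).asIdeal := by
  have key : ∀ i, (x : 𝓞 K) ∈ (T.p i).asIdeal ↔ 1 ≤ ord (T.p i) (prin x) := fun i => by
    rw [← ofPrime_dvd_iff, dvd_iff_le]
    exact (Ideal.span_singleton_le_iff_mem _).symm
  rw [isCoprime_iff_ord]
  constructor
  · intro h i hi hx
    have := h (T.p i) (T.ofPrime_dvd_lev.2 ⟨i, hi, rfl⟩)
    rw [key] at hx
    omega
  · intro h q hq
    obtain ⟨i, hi, rfl⟩ := T.ofPrime_dvd_lev.1 hq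
    have := (key i).not.1 (h i hi)
    omega

/-! ### The groups `(𝓞 K / p i)ˣ` -/

/-- The multiplicative group of the residue field of `p i`. -/
abbrev A (i : Fin 3) : Type _ := (𝓞 K ⧸ (T.p i).asIdeal)ˣ

instance (i : Fin 3) : Finite (𝓞 K ⧸ (T.p i).asIdeal) :=
  Ideal.finiteQuotientOfFreeOfNeBot _ (T.p i).ne_bot

instance (i : Fin 3) : Fintype (T.A i) := Fintype.ofFinite _

lemma card_A (i : Fin 3) : Fintype.card (T.A i) % 4 = 2 := by
  let _ : Field (𝓞 K ⧸ (T.p i).asIdeal) := Ideal.Quotient.field _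
  have h : Nat.card (T.A i) = Nat.card (𝓞 K ⧸ (T.p i).asIdeal) - 1 := Nat.card_units _
  have := T.card_mod_four i
  rw [← Nat.card_eq_fintype_card, h]
  omega

/-- The subgroup of the elements of odd order, of index two in `(𝓞 K / p i)ˣ`, a group of order `2`
modulo `4`. -/
def B (i : Fin 3) : Subgroup (T.A i) := (powMonoidHom (Fintype.card (T.A i) / 2)).ker

instance (i : Fin 3) : Fintype (T.B i) := Fintype.ofFinite _

lemma mem_B {i : Fin 3} {a : T.A i} : a ∈ T.B i ↔ a ^ (Fintype.card (T.A i) / 2) = 1 := by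
  rw [B, MonoidHom.mem_ker, powMonoidHom_apply]

lemma two_notMem (i : Fin 3) : (2 : 𝓞 K) ∉ (T.p i).asIdeal := by
  intro h
  have h1 : (2 : 𝓞 K ⧸ (T.p i).asIdeal) = 0 := Ideal.Quotient.eq_zero_iff_mem.2 h
  have h2 : ((Nat.card (𝓞 K ⧸ (T.p i).asIdeal) : ℕ) : 𝓞 K ⧸ (T.p i).asIdeal) = 0 := by
    let _ := Fintype.ofFinite (𝓞 K ⧸ (T.p i).asIdeal)
    rw [Nat.card_eq_fintype_card]
    exact Nat.cast_card_eq_zero _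
  have h3 := T.card_mod_four i
  have h4 : Nat.card (𝓞 K ⧸ (T.p i).asIdeal) =
      2 * (Nat.card (𝓞 K ⧸ (T.p i).asIdeal) / 2) + 1 := by omega
  rw [h4] at h2
  push_cast at h2
  rw [h1, zero_mul, zero_add] at h2
  exact one_ne_zero h2

lemma neg_ne (i : Fin 3) (a : T.A i) : -a ≠ a := by
  intro h
  apply T.two_notMem i
  have h1 : -(a : 𝓞 K ⧸ (T.p i).asIdeal) = a := by rw [← Units.val_neg, h]
  have h2 : (2 : 𝓞 K ⧸ (T.p i).asIdeal) * a = 0 := by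
    rw [two_mul]; nth_rewrite 1 [← h1]; exact neg_add_cancel _
  rw [Units.mul_left_eq_zero] at h2
  exact Ideal.Quotient.eq_zero_iff_mem.1 h2

/-- The elements of `B i` represent the classes modulo sign: `a` to the odd power `|A i| / 2` is a
square root of `1`, hence `1` or `-1`. -/
lemma neg_one_mul_mem_B (i : Fin 3) (a : T.A i) : -1 * a ∈ T.B i ↔ a ∉ T.B i := by
  let _ : Field (𝓞 K ⧸ (T.p i).asIdeal) := Ideal.Quotient.field _
  have hodd : Odd (Fintype.card (T.A i) / 2) := by
    have := T.card_A i
    rw [Nat.odd_iff]; omega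
  have h2 : a ^ (Fintype.card (T.A i) / 2) = 1 ∨ a ^ (Fintype.card (T.A i) / 2) = -1 := by
    have hsq : (a ^ (Fintype.card (T.A i) / 2)) ^ 2 = 1 := by
      rw [← pow_mul, Nat.div_mul_cancel (by have := T.card_A i; omega), pow_card_eq_one]
    have h3 : ((a ^ (Fintype.card (T.A i) / 2) : T.A i) : 𝓞 K ⧸ (T.p i).asIdeal) ^ 2 = 1 := by
      rw [← Units.val_pow_eq_pow_val, hsq, Units.val_one]
    rw [pow_two] at h3
    rcases mul_self_eq_one_iff.1 h3 with h | h
    · exact Or.inl (Units.ext h)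
    · exact Or.inr (Units.ext h)
  rw [mem_B, mem_B, neg_one_mul, hodd.neg_pow]
  rcases h2 with h | h
  · rw [h]
    simp only [not_true_eq_false, iff_false]
    exact T.neg_ne i 1
  · rw [h, neg_neg]
    simp only [true_iff]
    exact T.neg_ne i 1

lemma neg_one_mul_neg_one (i : Fin 3) : (-1 : T.A i) * -1 = 1 := by rw [neg_mul_neg, one_mul]

lemma card_A_eq (i : Fin 3) : Fintype.card (T.A i) = 2 * Fintype.card (T.B i) := by
  have h := sum_eq_sum_subgroup (B := T.B) (ε := fun i => (-1 : T.A i)) T.neg_one_mul_neg_one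
    T.neg_one_mul_mem_B i (fun _ => (1 : ℤ))
  simp only [Finset.sum_const, Finset.card_univ, nsmul_eq_mul, mul_one] at h
  have h2 : (Fintype.card (T.A i) : ℤ) = ((2 * Fintype.card (T.B i) : ℕ) : ℤ) := by
    rw [h]; push_cast; ring
  exact_mod_cast h2

lemma odd_card_B (i : Fin 3) : Odd (Fintype.card (T.B i)) := by
  have h1 := T.card_A i
  have h2 := T.card_A_eq i
  rw [Nat.odd_iff]; omega

/-! ### Classes of principal ideals -/

lemma exists_lift (a : ∀ i, T.A i) : ∃ x : (𝓞 K)⁰,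
    ∀ i, Ideal.Quotient.mk (T.p i).asIdeal x = a i := by
  choose y hy using fun i => Ideal.Quotient.mk_surjective (a i : 𝓞 K ⧸ (T.p i).asIdeal)
  obtain ⟨x, hx⟩ := IsDedekindDomain.exists_forall_sub_mem_ideal (s := Finset.univ)
    (fun i => (T.p i).asIdeal) (fun _ => 1) (fun i _ => (T.p i).prime)
    (fun i _ j _ hij h => hij (T.inj (HeightOneSpectrum.ext h))) (fun i => y i)
  have hx' : ∀ i, Ideal.Quotient.mk (T.p i).asIdeal x = a i := fun i => by
    rw [← hy i, Ideal.Quotient.eq]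
    simpa using hx i (Finset.mem_univ _)
  refine ⟨⟨x, mem_nonZeroDivisors_of_ne_zero ?_⟩, hx'⟩
  rintro rfl
  have := hx' 0
  rw [map_zero] at this
  exact (a 0).ne_zero this.symm

lemma isCoprime_of_lift {a : ∀ i, T.A i} {x : (𝓞 K)⁰} {S : Finset (Fin 3)}
    (hx : ∀ i ∈ S, Ideal.Quotient.mk (T.p i).asIdeal x = a i) :
    IsCoprime (prin x : Ideal (𝓞 K)) (T.lev S : Ideal (𝓞 K)) := by
  rw [isCoprime_prin_lev]
  intro i hi h
  rw [← Ideal.Quotient.eq_zero_iff_mem, hx i hi] at h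
  exact (a i).ne_zero h

/-- The residue classes of an integer prime to the `p i`, `i ∈ S`. -/
lemma exists_residues {S : Finset (Fin 3)} {x : (𝓞 K)⁰}
    (hx : IsCoprime (prin x : Ideal (𝓞 K)) (T.lev S : Ideal (𝓞 K))) :
    ∃ a : ∀ i, T.A i, ∀ i ∈ S, Ideal.Quotient.mk (T.p i).asIdeal x = a i := by
  rw [isCoprime_prin_lev] at hx
  have : ∀ i, ∃ a : T.A i, i ∈ S → Ideal.Quotient.mk (T.p i).asIdeal x = a := by
    intro i
    by_cases hi : i ∈ S
    · let _ : Field (𝓞 K ⧸ (T.p i).asIdeal) := Ideal.Quotient.field _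
      refine ⟨Units.mk0 _ fun h => hx i hi (Ideal.Quotient.eq_zero_iff_mem.1 h), fun _ => rfl⟩
    · exact ⟨1, fun h => (hi h).elim⟩
  choose a ha using this
  exact ⟨a, ha⟩

variable [HasTrivialUnits K]

/-- Because the units are `±1`, the residues of an integer modulo the `p i`, `i ∈ S`, are determined
by the class of its ideal up to a common sign. -/
lemma idealClass_prin_eq_iff {S : Finset (Fin 3)} {x y : (𝓞 K)⁰} {a b : ∀ i, T.A i}
    (hx : ∀ i ∈ S, Ideal.Quotient.mk (T.p i).asIdeal x = a i)
    (hy : ∀ i ∈ S, Ideal.Quotient.mk (T.p i).asIdeal y = b i) :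
    idealClass (prin x) (T.isCoprime_of_lift hx) = idealClass (prin y) (T.isCoprime_of_lift hy) ↔
      (∀ i ∈ S, a i = b i) ∨ (∀ i ∈ S, a i = -b i) := by
  rw [eq_comm, idealClass_eq_iff, prin_div_prin_mem_ray (T.isCoprime_of_lift hy), T.mem_lev,
    T.mem_lev]
  refine or_congr (forall₂_congr fun i hi => ?_) (forall₂_congr fun i hi => ?_)
  · rw [← Ideal.Quotient.eq_zero_iff_mem, map_sub, hx i hi, hy i hi, sub_eq_zero, Units.val_inj]
  · rw [← Ideal.Quotient.eq_zero_iff_mem, map_add, hx i hi, hy i hi, ← eq_neg_iff_add_eq_zero,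
      ← Units.val_neg, Units.val_inj]

/-- The homomorphism sending a system of residue classes modulo the `p i` to the class of the
principal ideal generated by a common lift. -/
def theta : (∀ i, T.A i) →* RayClassGroup (T.lev Finset.univ) :=
  MonoidHom.mk' (fun a => idealClass (prin (T.exists_lift a).choose)
    (T.isCoprime_of_lift fun i _ => (T.exists_lift a).choose_spec i)) (by
    intro a b
    have h := T.isCoprime_of_lift (S := Finset.univ)
      (x := (T.exists_lift a).choose * (T.exists_lift b).choose) (a := a * b)
      (fun i _ => by
        rw [Submonoid.coe_mul, map_mul, (T.exists_lift a).choose_spec i,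
          (T.exists_lift b).choose_spec i]; rfl)
    rw [← idealClass_mul]
    have h2 := (T.idealClass_prin_eq_iff (S := Finset.univ) (a := a * b) (b := a * b)
      (x := (T.exists_lift (a * b)).choose)
      (y := (T.exists_lift a).choose * (T.exists_lift b).choose)
      (fun i _ => (T.exists_lift (a * b)).choose_spec i)
      (fun i _ => by
        rw [Submonoid.coe_mul, map_mul, (T.exists_lift a).choose_spec i,
          (T.exists_lift b).choose_spec i]; rfl)).2 (Or.inl fun _ _ => rfl)
    rw [h2]
    congr 1
    exact map_mul _ _ _)

/-- The image of `theta a` in the ray class group of level `S`. -/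
lemma res_theta {S : Finset (Fin 3)} {a : ∀ i, T.A i} {x : (𝓞 K)⁰}
    (hx : ∀ i ∈ S, Ideal.Quotient.mk (T.p i).asIdeal x = a i) :
    res (T.lev_dvd S) (T.theta a) = idealClass (prin x) (T.isCoprime_of_lift hx) :=
  (T.idealClass_prin_eq_iff (fun i _ => (T.exists_lift a).choose_spec i) hx).2
    (Or.inl fun _ _ => rfl)

lemma res_theta_eq_iff {S : Finset (Fin 3)} {a b : ∀ i, T.A i} :
    res (T.lev_dvd S) (T.theta a) = res (T.lev_dvd S) (T.theta b) ↔
      (∀ i ∈ S, a i = b i) ∨ (∀ i ∈ S, a i = -b i) := by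
  rw [T.res_theta (fun i _ => (T.exists_lift a).choose_spec i),
    T.res_theta (fun i _ => (T.exists_lift b).choose_spec i)]
  exact T.idealClass_prin_eq_iff (fun i _ => (T.exists_lift a).choose_spec i)
    (fun i _ => (T.exists_lift b).choose_spec i)

lemma res_self (g : RayClassGroup (T.lev Finset.univ)) : res (T.lev_dvd Finset.univ) g = g := by
  obtain ⟨I, rfl⟩ := QuotientGroup.mk_surjective g
  rfl

lemma theta_eq_one_iff {a : ∀ i, T.A i} : T.theta a = 1 ↔ a = 1 ∨ a = -1 := by
  have h := T.res_theta_eq_iff (S := Finset.univ) (a := a) (b := 1)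
  rw [map_one, map_one, res_self] at h
  rw [h, funext_iff, funext_iff]
  simp

lemma toClassGroup_lev_eq_one_iff {S : Finset (Fin 3)} {σ : RayClassGroup (T.lev S)} :
    toClassGroup _ σ = 1 ↔ ∃ a, σ = res (T.lev_dvd S) (T.theta a) := by
  rw [toClassGroup_eq_one_iff]
  constructor
  · rintro ⟨x, hx, rfl⟩
    obtain ⟨a, ha⟩ := T.exists_residues hx
    exact ⟨a, (T.res_theta ha).symm⟩
  · rintro ⟨a, rfl⟩
    exact ⟨_, _, T.res_theta (fun i _ => (T.exists_lift a).choose_spec i)⟩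

lemma lev_isCoprime_compl (S : Finset (Fin 3)) :
    IsCoprime (T.lev S : Ideal (𝓞 K)) (T.lev Sᶜ : Ideal (𝓞 K)) := by
  rw [isCoprime_iff_ord]
  intro q hq
  obtain ⟨i, hi, rfl⟩ := T.ofPrime_dvd_lev.1 hq
  rw [ord_p_lev, if_neg (Finset.mem_compl.1 hi)]

lemma res_lev_surjective (S : Finset (Fin 3)) : Function.Surjective (res (T.lev_dvd S)) :=
  res_surjective (n'' := T.lev Sᶜ)
    (Finset.prod_mul_prod_compl S (fun i => ofPrime (T.p i))).symm (T.lev_isCoprime_compl S) _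

end PrimeTriple

end

section

namespace PrimeTriple

variable {K : Type*} [Field K] [NumberField K] (T : PrimeTriple K)

/-! ### The relations at the levels dividing `p 0 * p 1 * p 2` -/

/-- The basis element of `Δ` given by the image of `g` in the ray class group of level `S`. -/
def zeta (S : Finset (Fin 3)) (g : RayClassGroup (T.lev Finset.univ)) : Delta K :=
  symb (res (T.lev_dvd S) g)

lemma symb_res_eq_zeta {n : IntIdeal K} {S : Finset (Fin 3)} (h : n = T.lev S)
    (hn : n ∣ T.lev Finset.univ) (g : RayClassGroup (T.lev Finset.univ)) :
    symb (res hn g) = T.zeta S g := by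
  subst h; rfl

lemma isUnit_mk_gen {i j : Fin 3} (h : j ≠ i) :
    IsUnit (Ideal.Quotient.mk (T.p j).asIdeal (T.gen i)) := by
  let _ : Field (𝓞 K ⧸ (T.p j).asIdeal) := Ideal.Quotient.field _
  rw [isUnit_iff_ne_zero, Ne, Ideal.Quotient.eq_zero_iff_mem]
  intro hmem
  have h1 : ofPrime (T.p j) ∣ prin (T.gen i) :=
    dvd_iff_le.2 ((Ideal.span_singleton_le_iff_mem _).2 hmem)
  rw [T.prin_gen, ofPrime_dvd_iff, ord_ofPrime_of_ne (T.inj.ne h)] at h1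
  omega

open Classical in
/-- The residue classes, at the primes other than `p i`, of the generator of `p i`. Their class
under `theta` is the Frobenius at `p i` in the levels prime to `p i`. -/
def frobA (i : Fin 3) : ∀ j, T.A j := fun j =>
  if h : j = i then 1 else (T.isUnit_mk_gen h).unit

variable [HasTrivialUnits K]

lemma frob_eq_res_theta {S : Finset (Fin 3)} {i : Fin 3} (hi : i ∉ S)
    (h : ¬ ofPrime (T.p i) ∣ T.lev S) :
    frob h = res (T.lev_dvd S) (T.theta (T.frobA i)) := by
  have hx : ∀ j ∈ S, Ideal.Quotient.mk (T.p j).asIdeal (T.gen i) = T.frobA i j := fun j hj => by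
    have hji : j ≠ i := fun hji => hi (hji ▸ hj)
    rw [frobA, dif_neg hji]
    exact ((T.isUnit_mk_gen hji).unit_spec).symm
  rw [frob_eq h (isCoprime_ofPrime h), T.res_theta hx]
  congr 1
  exact (T.prin_gen i).symm

/-- The map from `(𝓞 K / p i)ˣ` to the kernel of the restriction from level `S ∪ {i}` to
level `S`. -/
def toKer {n' : IntIdeal K} {S : Finset (Fin 3)} {i : Fin 3} (hi : i ∉ S) (h : T.lev S ∣ n')
    (hn' : n' ∣ T.lev Finset.univ) (t : T.A i) : (res h).ker :=
  ⟨res hn' (T.theta (Pi.mulSingle i t)), by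
    rw [MonoidHom.mem_ker, res_res, ← map_one (res (T.lev_dvd S)), ← map_one T.theta]
    exact T.res_theta_eq_iff.2 (Or.inl fun j hj =>
      Pi.mulSingle_eq_of_ne (fun hji : j = i => hi (hji ▸ hj)) _)⟩

lemma exists_toKer_eq {n' : IntIdeal K} {S : Finset (Fin 3)} {i : Fin 3} (hi : i ∉ S)
    (h : T.lev S ∣ n') (hn' : n' ∣ T.lev Finset.univ) (hS : n' = T.lev (insert i S))
    (k : (res h).ker) : ∃ t, T.toKer hi h hn' t = k ∧ (S = ∅ → t ∈ T.B i) := by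
  subst hS
  have hk := MonoidHom.mem_ker.1 k.2
  have hcl : toClassGroup _ (k : RayClassGroup (T.lev (insert i S))) = 1 := by
    rw [← toClassGroup_res h, hk, map_one]
  obtain ⟨a, ha⟩ := T.toClassGroup_lev_eq_one_iff.1 hcl
  -- After a change of sign, `a` is `1` at the places in `S`, and its coordinate at `i` is in
  -- `B i` if `S` is empty.
  obtain ⟨a, ha, haS, haB⟩ : ∃ a, (k : RayClassGroup (T.lev (insert i S))) =
      res (T.lev_dvd _) (T.theta a) ∧ (∀ j ∈ S, a j = 1) ∧ (S = ∅ → a i ∈ T.B i) := by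
    have hneg : res (T.lev_dvd (insert i S)) (T.theta a) =
        res (T.lev_dvd (insert i S)) (T.theta (-a)) :=
      T.res_theta_eq_iff.2 (Or.inr fun j _ => (neg_neg (a j)).symm)
    rcases Finset.eq_empty_or_nonempty S with rfl | hne
    · by_cases hB : a i ∈ T.B i
      · exact ⟨a, ha, by simp, fun _ => hB⟩
      · refine ⟨-a, ha.trans hneg, by simp, fun _ => ?_⟩
        rw [Pi.neg_apply, ← neg_one_mul]
        exact (T.neg_one_mul_mem_B i _).2 hB
    · have h1 : res (T.lev_dvd S) (T.theta a) = res (T.lev_dvd S) (T.theta 1) := by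
        rw [map_one, map_one, ← res_res h (T.lev_dvd (insert i S)), ← ha]
        exact hk
      rcases T.res_theta_eq_iff.1 h1 with h1 | h1
      · exact ⟨a, ha, h1, fun h => (hne.ne_empty h).elim⟩
      · refine ⟨-a, ha.trans hneg, fun j hj => ?_, fun h => (hne.ne_empty h).elim⟩
        rw [Pi.neg_apply, h1 j hj, Pi.one_apply, neg_neg]
  refine ⟨a i, Subtype.ext ?_, haB⟩
  rw [ha]
  refine T.res_theta_eq_iff.2 (Or.inl fun j hj => ?_)
  rcases Finset.mem_insert.1 hj with rfl | hj
  · exact Pi.mulSingle_eq_same _ _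
  · rw [haS j hj]
    exact Pi.mulSingle_eq_of_ne (fun hji : j = i => hi (hji ▸ hj)) _

lemma toKer_eq_iff {n' : IntIdeal K} {S : Finset (Fin 3)} {i : Fin 3} (hi : i ∉ S)
    (h : T.lev S ∣ n') (hn' : n' ∣ T.lev Finset.univ) (hS : n' = T.lev (insert i S)) {t s : T.A i}
    (hts : T.toKer hi h hn' t = T.toKer hi h hn' s) : t = s ∨ (S = ∅ ∧ t = -s) := by
  subst hS
  have h1 := congrArg Subtype.val hts
  rcases T.res_theta_eq_iff.1 h1 with h1 | h1
  · left
    have := h1 i (Finset.mem_insert_self _ _)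
    rwa [Pi.mulSingle_eq_same, Pi.mulSingle_eq_same] at this
  · right
    constructor
    · rw [Finset.eq_empty_iff_forall_notMem]
      intro j hj
      have hji : j ≠ i := fun hji => hi (hji ▸ hj)
      have := h1 j (Finset.mem_insert_of_mem hj)
      rw [Pi.mulSingle_eq_of_ne hji, Pi.mulSingle_eq_of_ne hji] at this
      exact T.neg_ne j 1 this.symm
    · have := h1 i (Finset.mem_insert_self _ _)
      rwa [Pi.mulSingle_eq_same, Pi.mulSingle_eq_same] at this

lemma finite_ker {n' : IntIdeal K} {S : Finset (Fin 3)} {i : Fin 3} (hi : i ∉ S)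
    (h : T.lev S ∣ n') (hn' : n' ∣ T.lev Finset.univ) (hS : n' = T.lev (insert i S)) :
    Finite (res h).ker :=
  Finite.of_surjective (T.toKer hi h hn') fun k =>
    let ⟨t, ht, _⟩ := T.exists_toKer_eq hi h hn' hS k; ⟨t, ht⟩

/-- If `S` is nonempty, the kernel of the restriction from level `S ∪ {i}` to level `S` is the whole
of `(𝓞 K / p i)ˣ`. -/
lemma normSum_of_nonempty {n' : IntIdeal K} {S : Finset (Fin 3)} {i : Fin 3} (hi : i ∉ S)
    (hne : S.Nonempty) (h : T.lev S ∣ n') (hn' : n' ∣ T.lev Finset.univ)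
    (hS : n' = T.lev (insert i S)) (g : RayClassGroup (T.lev Finset.univ)) :
    normSum h (res hn' g) =
      ∑ t : T.A i, T.zeta (insert i S) (T.theta (Pi.mulSingle i t) * g) := by
  rw [normSum, ← finsum_eq_sum_of_fintype]
  symm
  refine finsum_eq_of_bijective (T.toKer hi h hn') ⟨fun t s hts => ?_, fun k => ?_⟩ fun t => ?_
  · exact (T.toKer_eq_iff hi h hn' hS hts).resolve_right fun h => hne.ne_empty h.1
  · obtain ⟨t, ht, -⟩ := T.exists_toKer_eq hi h hn' hS k
    exact ⟨t, ht⟩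
  · rw [← T.symb_res_eq_zeta hS hn', map_mul]
    rfl

/-- The kernel of the restriction from level `{i}` to level `∅` is `(𝓞 K / p i)ˣ` modulo sign,
which is represented by `B i`. -/
lemma normSum_of_empty {n' : IntIdeal K} {i : Fin 3} (h : T.lev ∅ ∣ n')
    (hn' : n' ∣ T.lev Finset.univ) (hS : n' = T.lev {i})
    (g : RayClassGroup (T.lev Finset.univ)) :
    normSum h (res hn' g) =
      ∑ t : T.B i, T.zeta {i} (T.theta (Pi.mulSingle i (t : T.A i)) * g) := by
  rw [normSum, ← finsum_eq_sum_of_fintype]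
  symm
  refine finsum_eq_of_bijective (fun t : T.B i => T.toKer (Finset.notMem_empty i) h hn' t)
    ⟨fun t s hts => ?_, fun k => ?_⟩ fun t => ?_
  · rcases T.toKer_eq_iff _ h hn' hS hts with h1 | ⟨-, h1⟩
    · exact Subtype.ext h1
    · have h2 := T.neg_one_mul_mem_B i s
      rw [neg_one_mul, ← h1] at h2
      exact (h2.1 t.2 s.2).elim
  · obtain ⟨t, ht, htB⟩ := T.exists_toKer_eq (Finset.notMem_empty i) h hn' hS k
    exact ⟨⟨t, htB rfl⟩, ht⟩
  · rw [← T.symb_res_eq_zeta hS hn', map_mul]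
    rfl

lemma lev_mul_pow {S : Finset (Fin 3)} {i : Fin 3} (hi : i ∉ S) :
    T.lev S * ofPrime (T.p i) ^ 1 = T.lev (insert i S) := by
  rw [pow_one, lev_insert _ hi]

lemma lev_mul_pow_dvd {S : Finset (Fin 3)} {i : Fin 3} (hi : i ∉ S) :
    T.lev S * ofPrime (T.p i) ^ 1 ∣ T.lev Finset.univ := by
  rw [T.lev_mul_pow hi]; exact T.lev_dvd _

lemma not_dvd_lev {S : Finset (Fin 3)} {i : Fin 3} (hi : i ∉ S) :
    ¬ ofPrime (T.p i) ∣ T.lev S := by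
  rw [ofPrime_dvd_lev]
  rintro ⟨j, hj, hji⟩
  exact hi (T.inj hji ▸ hj)

/-- The relation of `U(m)` between the levels `S` and `S ∪ {i}` given by a class `g`. -/
def rel {S : Finset (Fin 3)} {i : Fin 3} (hi : i ∉ S) (g : RayClassGroup (T.lev Finset.univ)) :
    Delta K :=
  relS (T.lev S) (T.p i) 1 (res (T.lev_dvd S) g) (res (T.lev_mul_pow_dvd hi) g)

lemma rel_mem_ULevel {S : Finset (Fin 3)} {i : Fin 3} (hi : i ∉ S)
    (g : RayClassGroup (T.lev Finset.univ)) : T.rel hi g ∈ ULevel (T.lev Finset.univ) :=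
  AddSubgroup.subset_closure ⟨_, _, 1, _, _, le_rfl, T.lev_mul_pow_dvd hi, res_res _ _ _, rfl⟩

/-- As `m` is squarefree, the relations defining `U(m)` are the relations `rel`. -/
lemma ULevel_le {V : AddSubgroup (Delta K)} (hV : ∀ (S : Finset (Fin 3)) (i : Fin 3) (hi : i ∉ S)
    (g : RayClassGroup (T.lev Finset.univ)), T.rel hi g ∈ V) : ULevel (T.lev Finset.univ) ≤ V := by
  rw [ULevel, AddSubgroup.closure_le]
  rintro _ ⟨n, q, e, σ, τ, he, hdvd, hτ, rfl⟩
  obtain ⟨S, rfl⟩ := T.exists_eq_lev ((Dvd.intro _ rfl).trans hdvd)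
  obtain ⟨rfl, i, hi, rfl⟩ := T.of_mul_pow_dvd he hdvd
  obtain ⟨g, rfl⟩ : ∃ g, res (T.lev_mul_pow_dvd hi) g = τ := by
    have : ∀ (n : IntIdeal K) (hn : n = T.lev (insert i S)) (h : n ∣ T.lev Finset.univ),
        Function.Surjective (res h) := by
      rintro n rfl h
      exact T.res_lev_surjective _
    exact this _ (T.lev_mul_pow hi) _ τ
  rw [res_res] at hτ
  subst hτ
  exact hV S i hi g

lemma rel_eq {S : Finset (Fin 3)} {i : Fin 3} (hi : i ∉ S)
    (g : RayClassGroup (T.lev Finset.univ)) : T.rel hi g =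
      symb (res (T.lev_dvd S) g) -
        symb ((frob (T.not_dvd_lev hi))⁻¹ * res (T.lev_dvd S) g) -
        normSum (Dvd.intro _ rfl) (res (T.lev_mul_pow_dvd hi) g) := by
  rw [rel, relS, dif_neg (T.not_dvd_lev hi)]

lemma frob_inv_mul_res {S : Finset (Fin 3)} {i : Fin 3} (hi : i ∉ S)
    (g : RayClassGroup (T.lev Finset.univ)) :
    (frob (T.not_dvd_lev hi))⁻¹ * res (T.lev_dvd S) g =
      res (T.lev_dvd S) (T.theta (T.frobA i)⁻¹ * g) := by
  rw [T.frob_eq_res_theta hi, map_mul]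
  congr 1
  rw [← map_inv]
  exact congrArg _ (map_inv T.theta _).symm

lemma rel_eq_of_nonempty {S : Finset (Fin 3)} {i : Fin 3} (hi : i ∉ S) (hne : S.Nonempty)
    (g : RayClassGroup (T.lev Finset.univ)) : T.rel hi g =
      T.zeta S g - T.zeta S (T.theta (T.frobA i)⁻¹ * g) -
        ∑ t : T.A i, T.zeta (insert i S) (T.theta (Pi.mulSingle i t) * g) := by
  rw [rel_eq, T.normSum_of_nonempty hi hne _ (T.lev_mul_pow_dvd hi) (T.lev_mul_pow hi),
    T.frob_inv_mul_res hi]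
  rfl

lemma zeta_empty_theta_mul (a : ∀ i, T.A i) (g : RayClassGroup (T.lev Finset.univ)) :
    T.zeta ∅ (T.theta a * g) = T.zeta ∅ g := by
  have : res (T.lev_dvd ∅) (T.theta a) = res (T.lev_dvd ∅) (T.theta 1) :=
    T.res_theta_eq_iff.2 (Or.inl (by simp))
  rw [zeta, map_mul, this, map_one, map_one]
  exact congrArg symb (one_mul (M := RayClassGroup (T.lev ∅)) _)

lemma rel_eq_of_empty {i : Fin 3} (hi : i ∉ (∅ : Finset (Fin 3)))
    (g : RayClassGroup (T.lev Finset.univ)) : T.rel hi g =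
      - ∑ t : T.B i, T.zeta {i} (T.theta (Pi.mulSingle i (t : T.A i)) * g) := by
  rw [rel_eq, T.normSum_of_empty _ (T.lev_mul_pow_dvd hi) (T.lev_mul_pow hi),
    T.frob_inv_mul_res hi]
  have := T.zeta_empty_theta_mul (T.frobA i)⁻¹ g
  rw [zeta, zeta] at this
  rw [this, sub_self, zero_sub]

/-! ### The elements over a fixed ideal class -/

/-- The elements `theta a * g` of the ray class groups, which lie over the same ideal class as `g`,
modulo the relations. -/
def levelSystem (g : RayClassGroup (T.lev Finset.univ)) :
    LevelSystem T.B (fun i => (-1 : T.A i)) (Delta K ⧸ ULevel (T.lev Finset.univ)) where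
  eps_mul_eps := T.neg_one_mul_neg_one
  eps_mul_mem := T.neg_one_mul_mem_B
  f := T.frobA
  z S a := QuotientAddGroup.mk (T.zeta S (T.theta a * g))
  z_congr S a b h := by
    rw [zeta, map_mul, T.res_theta_eq_iff.2 (Or.inl h), ← map_mul]
    rfl
  z_eps S a := by
    have : res (T.lev_dvd S) (T.theta ((fun i => (-1 : T.A i)) * a)) =
        res (T.lev_dvd S) (T.theta a) :=
      T.res_theta_eq_iff.2 (Or.inr fun i _ => neg_one_mul _)
    rw [zeta, map_mul, this, ← map_mul]
    rfl
  z_sum S i a hne hi := by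
    have h := (QuotientAddGroup.eq_zero_iff _).2 (T.rel_mem_ULevel hi (T.theta a * g))
    rw [T.rel_eq_of_nonempty hi hne, QuotientAddGroup.mk_sub, QuotientAddGroup.mk_sub,
      QuotientAddGroup.mk_sum, sub_eq_zero] at h
    simp_rw [← mul_assoc, ← map_mul] at h
    exact h.symm
  z_sum_empty i a := by
    have h := (QuotientAddGroup.eq_zero_iff _).2
      (T.rel_mem_ULevel (Finset.notMem_empty i) (T.theta a * g))
    rw [T.rel_eq_of_empty, QuotientAddGroup.mk_neg, QuotientAddGroup.mk_sum, neg_eq_zero] at h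
    simp_rw [← mul_assoc, ← map_mul] at h
    exact h

end PrimeTriple

end

section

/-! ### A criterion for being torsion -/

/-- If `Q` is generated by a subgroup `X` killed by a homomorphism `f` to a rational vector space
and by at most as many elements as the dimension, and if the image of `f` spans, then the kernel of
`f` is contained in `X`: the images of the generators are linearly independent. -/
lemma mem_of_map_eq_zero {Q V : Type*} [AddCommGroup Q] [AddCommGroup V] [Module ℚ V]
    [Module.Finite ℚ V] (f : Q →+ V) {ι : Type*} [Fintype ι] (v : ι → Q) (X : AddSubgroup Q)
    (hX : ∀ x ∈ X, f x = 0) (hcard : Fintype.card ι ≤ Module.finrank ℚ V)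
    (htop : ⊤ ≤ Submodule.span ℚ
      (f '' (AddSubgroup.closure (Set.range v) ⊔ X : AddSubgroup Q)))
    {y : Q} (hy : y ∈ AddSubgroup.closure (Set.range v) ⊔ X) (hfy : f y = 0) : y ∈ X := by
  have hspan : ⊤ ≤ Submodule.span ℚ (Set.range fun i => f (v i)) := by
    refine htop.trans (Submodule.span_le.2 ?_)
    rintro _ ⟨q, hq, rfl⟩
    obtain ⟨s, hs, x, hx, rfl⟩ := AddSubgroup.mem_sup.1 hq
    rw [map_add, hX x hx, add_zero]
    have : AddSubgroup.closure (Set.range v) ≤ (Submodule.span ℚ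
        (Set.range fun i => f (v i))).toAddSubgroup.comap f := by
      rw [AddSubgroup.closure_le]
      rintro _ ⟨i, rfl⟩
      exact Submodule.subset_span ⟨i, rfl⟩
    exact this hs
  have hle : Module.finrank ℚ V ≤ Fintype.card ι := by
    have h := finrank_range_le_card (R := ℚ) (b := fun i => f (v i))
    rwa [Set.finrank, top_le_iff.1 hspan, finrank_top] at h
  have hli := linearIndependent_of_top_le_span_of_card_eq_finrank hspan (hcard.antisymm hle)
  obtain ⟨s, hs, x, hx, rfl⟩ := AddSubgroup.mem_sup.1 hy
  rw [map_add, hX x hx, add_zero] at hfy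
  rw [← Submodule.span_int_eq_addSubgroupClosure, Submodule.mem_toAddSubgroup,
    Submodule.mem_span_range_iff_exists_fun] at hs
  obtain ⟨c, rfl⟩ := hs
  have h0 : ∀ i, c i = 0 := by
    rw [Fintype.linearIndependent_iff] at hli
    intro i
    have := hli (fun i => (c i : ℚ)) (by
      rw [← hfy, map_sum]
      refine Finset.sum_congr rfl fun i _ => ?_
      rw [map_zsmul, Int.cast_smul_eq_zsmul]) i
    exact_mod_cast this
  rw [Finset.sum_eq_zero fun i _ => by rw [h0 i, zero_smul], zero_add]
  exact hx

/-! ### Idempotents and the norm relations -/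

section Idempotents

variable {A : Fin 3 → Type*} [∀ i, CommGroup (A i)] [∀ i, Fintype (A i)]
  {R : Type*} [CommRing R] [Algebra ℚ R] (θ : (∀ i, A i) →* R)

/-- The idempotent of the trivial character of `A i`. -/
def avg (i : Fin 3) : R := (Fintype.card (A i) : ℚ)⁻¹ • ∑ t : A i, θ (Pi.mulSingle i t)

lemma theta_mulSingle_mul_avg (i : Fin 3) (t : A i) : θ (Pi.mulSingle i t) * avg θ i = avg θ i := by
  rw [avg, mul_smul_comm, Finset.mul_sum]
  congr 1
  refine Fintype.sum_equiv (Equiv.mulLeft t) _ _ fun s => ?_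
  rw [Equiv.coe_mulLeft, Pi.mulSingle_mul, map_mul]

lemma card_smul_avg (i : Fin 3) :
    (Fintype.card (A i) : ℚ) • avg θ i = ∑ t : A i, θ (Pi.mulSingle i t) := by
  rw [avg, smul_inv_smul₀]
  exact_mod_cast Fintype.card_ne_zero

lemma avg_mul_avg (i : Fin 3) : avg θ i * avg θ i = avg θ i := by
  nth_rewrite 1 [avg]
  rw [smul_mul_assoc, Finset.sum_mul]
  simp_rw [theta_mulSingle_mul_avg]
  rw [Finset.sum_const, Finset.card_univ, ← Nat.cast_smul_eq_nsmul ℚ, inv_smul_smul₀]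
  exact_mod_cast Fintype.card_ne_zero

variable (f : Fin 3 → ∀ i, A i)

/-- The local factor at a prime dividing the level: `(1 - F_i⁻¹) / |A i|` on the image of the
idempotent, and `1` on its complement. -/
def localFactor (i : Fin 3) : R :=
  (Fintype.card (A i) : ℚ)⁻¹ • ((1 - θ (f i)⁻¹) * avg θ i) + (1 - avg θ i)

/-- The product of the local factors at the primes in `S` and of the idempotents at the other
primes; the image of the class `g` at level `S` in the group algebra is `g` times this element. -/
def levelFactor (S : Finset (Fin 3)) : R := ∏ i, if i ∈ S then localFactor θ f i else avg θ i

lemma avg_mul_levelFactor {S : Finset (Fin 3)} {i : Fin 3} (hi : i ∉ S) :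
    avg θ i * levelFactor θ f S = levelFactor θ f S := by
  rw [levelFactor, ← Finset.mul_prod_erase _ _ (Finset.mem_univ i), if_neg hi, ← mul_assoc,
    avg_mul_avg]

lemma theta_mulSingle_mul_levelFactor {S : Finset (Fin 3)} {i : Fin 3} (hi : i ∉ S) (t : A i) :
    θ (Pi.mulSingle i t) * levelFactor θ f S = levelFactor θ f S := by
  rw [← avg_mul_levelFactor θ f hi, ← mul_assoc, theta_mulSingle_mul_avg]

lemma theta_mul_levelFactor {S : Finset (Fin 3)} {a : ∀ i, A i} (ha : ∀ i ∈ S, a i = 1) :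
    θ a * levelFactor θ f S = levelFactor θ f S := by
  have h : ∀ s : Finset (Fin 3),
      (∏ i ∈ s, θ (Pi.mulSingle i (a i))) * levelFactor θ f S = levelFactor θ f S := by
    intro s
    induction s using Finset.induction_on with
    | empty => rw [Finset.prod_empty, one_mul]
    | insert i s hi ih =>
      rw [Finset.prod_insert hi, mul_assoc, ih]
      by_cases hiS : i ∈ S
      · rw [ha i hiS, Pi.mulSingle_one, map_one, one_mul]
      · exact theta_mulSingle_mul_levelFactor θ f hiS _
  have := h Finset.univ
  rwa [← map_prod, Finset.univ_prod_mulSingle] at this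

lemma avg_mul_localFactor (i : Fin 3) :
    avg θ i * localFactor θ f i = (Fintype.card (A i) : ℚ)⁻¹ • ((1 - θ (f i)⁻¹) * avg θ i) := by
  rw [localFactor, mul_add, mul_sub, mul_one, avg_mul_avg, sub_self, add_zero, mul_smul_comm,
    mul_left_comm, avg_mul_avg]

lemma sum_theta_mul_levelFactor {S : Finset (Fin 3)} {i : Fin 3} (hi : i ∉ S) :
    ∑ t : A i, θ (Pi.mulSingle i t) * levelFactor θ f (insert i S) =
      levelFactor θ f S - θ (f i)⁻¹ * levelFactor θ f S := by
  have h : ∀ j ∈ Finset.univ.erase i, (if j ∈ insert i S then localFactor θ f j else avg θ j) =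
      if j ∈ S then localFactor θ f j else avg θ j := fun j hj => by
    simp only [Finset.mem_insert, Finset.ne_of_mem_erase hj, false_or]
  rw [← Finset.sum_mul, ← card_smul_avg, levelFactor, levelFactor,
    ← Finset.mul_prod_erase _ _ (Finset.mem_univ i),
    ← Finset.mul_prod_erase _ _ (Finset.mem_univ i), if_pos (Finset.mem_insert_self _ _),
    if_neg hi, Finset.prod_congr rfl h, ← mul_assoc, smul_mul_assoc, avg_mul_localFactor,
    smul_inv_smul₀]
  · ring
  · exact_mod_cast Fintype.card_ne_zero

/-- As `ε` acts trivially, so does each `ε i` at level `{i}`, whence the sum over `B i` is half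
the sum over `A i`. -/
lemma sum_subgroup_theta_mul_levelFactor {B : ∀ i, Subgroup (A i)} [∀ i, Fintype (B i)]
    {ε : ∀ i, A i} (h1 : ∀ i, ε i * ε i = 1) (h2 : ∀ i a, ε i * a ∈ B i ↔ a ∉ B i)
    (hε : θ ε = 1) (i : Fin 3) :
    ∑ t : B i, θ (Pi.mulSingle i (t : A i)) * levelFactor θ f {i} = 0 := by
  have h3 : θ (Pi.mulSingle i (ε i)) * levelFactor θ f {i} = levelFactor θ f {i} := by
    have h4 : θ (Pi.mulSingle i (ε i) * ε) * levelFactor θ f {i} = levelFactor θ f {i} :=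
      theta_mul_levelFactor θ f fun j hj => by
        rw [Finset.mem_singleton.1 hj, Pi.mul_apply, Pi.mulSingle_eq_same, h1]
    rwa [map_mul, hε, mul_one] at h4
  have h5 := sum_theta_mul_levelFactor θ f (Finset.notMem_empty i)
  rw [theta_mul_levelFactor θ f (by simp), sub_self, insert_empty_eq,
    sum_eq_sum_subgroup (B := B) h1 h2 i] at h5
  have h6 : ∀ t : B i, θ (Pi.mulSingle i (t : A i)) * levelFactor θ f {i} +
      θ (Pi.mulSingle i (ε i * t)) * levelFactor θ f {i} =
      (2 : ℚ) • (θ (Pi.mulSingle i (t : A i)) * levelFactor θ f {i}) := fun t => by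
    rw [mul_comm (ε i), Pi.mulSingle_mul, map_mul, mul_assoc, h3, two_smul]
  rw [Finset.sum_congr rfl fun t _ => h6 t, ← Finset.smul_sum] at h5
  exact (smul_eq_zero_iff_right (two_ne_zero)).1 h5

/-- The elements `levelFactor S` generate the unit ideal. -/
lemma exists_sum_levelFactor_eq_one :
    ∃ c : Finset (Fin 3) → R, ∑ S, c S * levelFactor θ f S = 1 := by
  have h : ∀ i, (1 - avg θ i) * localFactor θ f i = 1 - avg θ i := fun i => by
    have h1 : (1 - avg θ i) * avg θ i = 0 := by rw [sub_mul, one_mul, avg_mul_avg, sub_self]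
    rw [localFactor, mul_add, mul_smul_comm, mul_left_comm, h1, mul_zero, smul_zero, zero_add,
      mul_sub, mul_one, h1, sub_zero]
  refine ⟨fun S => ∏ i ∈ S, (1 - avg θ i), ?_⟩
  have h2 : ∏ i : Fin 3, ((1 - avg θ i) + avg θ i) = 1 :=
    Finset.prod_eq_one fun i _ => sub_add_cancel _ _
  rw [Finset.prod_add, Finset.powerset_univ] at h2
  refine (Finset.sum_congr rfl fun S _ => ?_).trans h2
  have h3 : levelFactor θ f S =
      (∏ i ∈ S, localFactor θ f i) * ∏ i ∈ Finset.univ \ S, avg θ i := by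
    rw [levelFactor, Finset.prod_ite]
    congr 2
    · ext; simp
    · ext; simp
  rw [h3, ← mul_assoc, ← Finset.prod_mul_distrib, Finset.prod_congr rfl fun i _ => h i]

end Idempotents

end

section

namespace PrimeTriple

variable {K : Type*} [Field K] [NumberField K] (T : PrimeTriple K) [HasTrivialUnits K]

/-! ### Homomorphisms on `Δ` -/

lemma theta_neg (a : ∀ i, T.A i) : T.theta (-a) = T.theta a := by
  have h : T.theta (-1) = 1 := T.theta_eq_one_iff.2 (Or.inr rfl)
  rw [← neg_one_mul, map_mul, h]
  exact one_mul (M := RayClassGroup (T.lev Finset.univ)) _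

lemma theta_neg_one : T.theta (-1) = 1 := T.theta_eq_one_iff.2 (Or.inr rfl)

lemma toClassGroup_theta (a : ∀ i, T.A i) : toClassGroup _ (T.theta a) = 1 :=
  T.toClassGroup_lev_eq_one_iff.2 ⟨a, (T.res_self _).symm⟩

lemma exists_theta_mul_eq {g g' : RayClassGroup (T.lev Finset.univ)}
    (h : toClassGroup _ g = toClassGroup _ g') : ∃ a, g = T.theta a * g' := by
  have h1 : toClassGroup _ (g * g'⁻¹) = 1 := by
    rw [map_mul, map_inv, h]
    exact mul_inv_cancel _
  obtain ⟨a, ha⟩ := T.toClassGroup_lev_eq_one_iff.1 h1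
  rw [res_self] at ha
  refine ⟨a, ?_⟩
  rw [← ha]
  simp only [inv_mul_cancel_right]

/-- Two classes have the same image at level `S` only if they differ by `theta a` with `a` trivial
at the places in `S`. -/
lemma exists_theta_mul_eq_of_res_eq {S : Finset (Fin 3)}
    {g g' : RayClassGroup (T.lev Finset.univ)} (h : res (T.lev_dvd S) g = res (T.lev_dvd S) g') :
    ∃ a, (∀ i ∈ S, a i = 1) ∧ g = T.theta a * g' := by
  obtain ⟨a, rfl⟩ := T.exists_theta_mul_eq (g := g) (g' := g') (by
    rw [← toClassGroup_res (T.lev_dvd S), h, toClassGroup_res])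
  have h1 : res (T.lev_dvd S) (T.theta a) = res (T.lev_dvd S) (T.theta 1) := by
    rw [map_mul] at h
    rw [map_one, map_one]
    calc res (T.lev_dvd S) (T.theta a) =
          res (T.lev_dvd S) (T.theta a) * res (T.lev_dvd S) g' * (res (T.lev_dvd S) g')⁻¹ := by
          simp only [mul_inv_cancel_right]
      _ = res (T.lev_dvd S) g' * (res (T.lev_dvd S) g')⁻¹ := congrArg (· * _) h
      _ = 1 := mul_inv_cancel _
  rcases T.res_theta_eq_iff.1 h1 with h1 | h1
  · exact ⟨a, h1, rfl⟩
  · exact ⟨-a, fun i hi => by rw [Pi.neg_apply, h1 i hi, Pi.one_apply, neg_neg],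
      by rw [theta_neg]⟩

variable {Q : Type*} [AddCommGroup Q]

open Classical in
/-- The homomorphism on `Δ` which vanishes at the levels not dividing `p 0 * p 1 * p 2` and sends
`zeta S g` to `F S g`, provided that `F S` is invariant under `theta a` for `a` trivial at the
places in `S`. -/
def deltaLift (F : Finset (Fin 3) → RayClassGroup (T.lev Finset.univ) → Q) : Delta K →+ Q :=
  Finsupp.liftAddHom fun x => zmultiplesHom Q
    (if h : ∃ y : Finset (Fin 3) × RayClassGroup (T.lev Finset.univ),
      x = ⟨T.lev y.1, res (T.lev_dvd y.1) y.2⟩ then F h.choose.1 h.choose.2 else 0)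

lemma deltaLift_zeta {F : Finset (Fin 3) → RayClassGroup (T.lev Finset.univ) → Q}
    (hF : ∀ S a g, (∀ i ∈ S, a i = 1) → F S (T.theta a * g) = F S g) (S : Finset (Fin 3))
    (g : RayClassGroup (T.lev Finset.univ)) : T.deltaLift F (T.zeta S g) = F S g := by
  have h : ∃ y : Finset (Fin 3) × RayClassGroup (T.lev Finset.univ),
      (⟨T.lev S, res (T.lev_dvd S) g⟩ : Σ n : IntIdeal K, RayClassGroup n) =
        ⟨T.lev y.1, res (T.lev_dvd y.1) y.2⟩ := ⟨(S, g), rfl⟩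
  rw [deltaLift, zeta, symb, Finsupp.liftAddHom_apply_single, dif_pos h, zmultiplesHom_apply,
    one_smul]
  obtain ⟨h1, h2⟩ := Sigma.mk.inj_iff.1 h.choose_spec
  have h1 := T.lev_injective h1
  generalize h.choose = y at h1 h2 ⊢
  obtain ⟨S', g'⟩ := y
  obtain rfl : S = S' := h1
  obtain ⟨a, ha, rfl⟩ := T.exists_theta_mul_eq_of_res_eq (eq_of_heq h2)
  exact (hF _ _ _ ha).symm

lemma DeltaLevel_eq : DeltaLevel (T.lev Finset.univ) =
    AddSubgroup.closure {x | ∃ S g, x = T.zeta S g} := by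
  refine le_antisymm ((AddSubgroup.closure_le _).2 ?_) (AddSubgroup.closure_mono ?_)
  · rintro _ ⟨n, σ, hn, rfl⟩
    obtain ⟨S, rfl⟩ := T.exists_eq_lev hn
    obtain ⟨g, rfl⟩ := T.res_lev_surjective S σ
    exact AddSubgroup.subset_closure ⟨S, g, rfl⟩
  · rintro _ ⟨S, g, rfl⟩
    exact ⟨_, _, T.lev_dvd S, rfl⟩

lemma zeta_mem (S : Finset (Fin 3)) (g : RayClassGroup (T.lev Finset.univ)) :
    T.zeta S g ∈ DeltaLevel (T.lev Finset.univ) :=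
  AddSubgroup.subset_closure ⟨_, _, T.lev_dvd S, rfl⟩

/-- A homomorphism on `Δ` kills `U(m)` if it satisfies the norm relations. -/
lemma ULevel_le_ker {f : Delta K →+ Q}
    (h1 : ∀ (S : Finset (Fin 3)) (i : Fin 3) (g : RayClassGroup (T.lev Finset.univ)),
      S.Nonempty → i ∉ S →
      ∑ t : T.A i, f (T.zeta (insert i S) (T.theta (Pi.mulSingle i t) * g)) =
        f (T.zeta S g) - f (T.zeta S (T.theta (T.frobA i)⁻¹ * g)))
    (h2 : ∀ (i : Fin 3) (g : RayClassGroup (T.lev Finset.univ)),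
      ∑ t : T.B i, f (T.zeta {i} (T.theta (Pi.mulSingle i (t : T.A i)) * g)) = 0) :
    ULevel (T.lev Finset.univ) ≤ f.ker := by
  refine T.ULevel_le fun S i hi g => ?_
  rw [AddMonoidHom.mem_ker]
  rcases S.eq_empty_or_nonempty with rfl | hne
  · rw [T.rel_eq_of_empty, map_neg, map_sum, h2, neg_zero]
  · rw [T.rel_eq_of_nonempty hi hne, map_sub, map_sub, map_sum, h1 S i g hne hi, sub_self]

/-! ### The homomorphism to the group algebra -/

/-- The rational group algebra of the ray class group of full level. -/
def GroupAlg : Type _ := MonoidAlgebra ℚ (RayClassGroup (T.lev Finset.univ))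

instance : CommRing T.GroupAlg :=
  inferInstanceAs (CommRing (MonoidAlgebra ℚ (RayClassGroup (T.lev Finset.univ))))

instance : Algebra ℚ T.GroupAlg :=
  inferInstanceAs (Algebra ℚ (MonoidAlgebra ℚ (RayClassGroup (T.lev Finset.univ))))

/-- The canonical map from the ray class group to its group algebra. -/
def ofAlg : RayClassGroup (T.lev Finset.univ) →* T.GroupAlg :=
  MonoidAlgebra.of ℚ (RayClassGroup (T.lev Finset.univ))

/-- The basis of the group algebra formed by the elements of the group. -/
def basisAlg : Module.Basis (RayClassGroup (T.lev Finset.univ)) ℚ T.GroupAlg :=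
  MonoidAlgebra.basis (RayClassGroup (T.lev Finset.univ)) ℚ

lemma basisAlg_apply (g : RayClassGroup (T.lev Finset.univ)) : T.basisAlg g = T.ofAlg g :=
  MonoidAlgebra.basis_apply ℚ g

lemma span_ofAlg : Submodule.span ℚ (Set.range T.ofAlg) = ⊤ := by
  rw [← T.basisAlg.span_eq, ← funext T.basisAlg_apply]

/-- The homomorphism `theta`, with values in the group algebra. -/
def thetaAlg : (∀ i, T.A i) →* T.GroupAlg := T.ofAlg.comp T.theta

lemma ofAlg_theta_mul (a : ∀ i, T.A i) (g : RayClassGroup (T.lev Finset.univ)) :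
    T.ofAlg (T.theta a * g) = T.ofAlg g * T.thetaAlg a := by
  rw [map_mul, mul_comm]; rfl

/-- The homomorphism from `Δ` to the group algebra which sends `zeta S g` to
`g * levelFactor S`. -/
def toGroupAlg : Delta K →+ T.GroupAlg :=
  T.deltaLift fun S g => T.ofAlg g * levelFactor T.thetaAlg T.frobA S

lemma toGroupAlg_zeta (S : Finset (Fin 3)) (g : RayClassGroup (T.lev Finset.univ)) :
    T.toGroupAlg (T.zeta S g) = T.ofAlg g * levelFactor T.thetaAlg T.frobA S := by
  refine T.deltaLift_zeta (fun S a g ha => ?_) S g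
  rw [ofAlg_theta_mul, mul_assoc, theta_mul_levelFactor T.thetaAlg T.frobA ha]

lemma ULevel_le_ker_toGroupAlg : ULevel (T.lev Finset.univ) ≤ T.toGroupAlg.ker := by
  refine T.ULevel_le_ker (fun S i g _ hi => ?_) fun i g => ?_
  · simp_rw [toGroupAlg_zeta, ofAlg_theta_mul, mul_assoc]
    rw [← Finset.mul_sum, sum_theta_mul_levelFactor T.thetaAlg T.frobA hi, mul_sub]
  · simp_rw [toGroupAlg_zeta, ofAlg_theta_mul, mul_assoc]
    rw [← Finset.mul_sum, sum_subgroup_theta_mul_levelFactor T.thetaAlg T.frobA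
      (B := T.B) (ε := fun i => (-1 : T.A i)) T.neg_one_mul_neg_one T.neg_one_mul_mem_B, mul_zero]
    exact (congrArg T.ofAlg T.theta_neg_one).trans (map_one _)

lemma span_toGroupAlg : ⊤ ≤ Submodule.span ℚ {x | ∃ S g, x = T.toGroupAlg (T.zeta S g)} := by
  obtain ⟨c, hc⟩ := exists_sum_levelFactor_eq_one T.thetaAlg T.frobA
  have h : ∀ (S : Finset (Fin 3)) (y : T.GroupAlg), y * levelFactor T.thetaAlg T.frobA S ∈
      Submodule.span ℚ {x | ∃ S g, x = T.toGroupAlg (T.zeta S g)} := by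
    intro S y
    have hy : y ∈ Submodule.span ℚ (Set.range T.ofAlg) := T.span_ofAlg ▸ Submodule.mem_top
    induction hy using Submodule.span_induction with
    | mem y hy =>
      obtain ⟨g, rfl⟩ := hy
      exact Submodule.subset_span ⟨S, g, (T.toGroupAlg_zeta S g).symm⟩
    | zero => rw [zero_mul]; exact zero_mem _
    | add y z _ _ hy hz => rw [add_mul]; exact add_mem hy hz
    | smul a y _ hy => rw [smul_mul_assoc]; exact Submodule.smul_mem _ _ hy
  intro y _
  rw [← mul_one y, ← hc, Finset.mul_sum]
  refine sum_mem fun S _ => ?_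
  rw [← mul_assoc]
  exact h S _

/-! ### The parity homomorphism -/

open Classical in
/-- The homomorphism from `Δ` which counts, modulo `2`, the elements of full level in each ideal
class. -/
def parity : Delta K →+ (ClassGroup (𝓞 K) → ZMod 2) :=
  T.deltaLift fun S g => if S = Finset.univ then Pi.single (toClassGroup _ g) 1 else 0

open Classical in
lemma parity_zeta (S : Finset (Fin 3)) (g : RayClassGroup (T.lev Finset.univ)) :
    T.parity (T.zeta S g) = if S = Finset.univ then Pi.single (toClassGroup _ g) 1 else 0 := by
  refine T.deltaLift_zeta (fun S a g _ => ?_) S g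
  rw [map_mul, toClassGroup_theta, one_mul]

lemma ULevel_le_ker_parity : ULevel (T.lev Finset.univ) ≤ T.parity.ker := by
  classical
  refine T.ULevel_le_ker (fun S i g _ hi => ?_) fun i g => ?_
  · have hS : S ≠ Finset.univ := fun h => hi (h ▸ Finset.mem_univ i)
    simp_rw [parity_zeta, if_neg hS, map_mul, toClassGroup_theta, one_mul]
    rw [Finset.sum_const, Finset.card_univ, card_A_eq, mul_nsmul', two_nsmul,
      CharTwo.add_self_eq_zero, sub_self]
  · have hS : ({i} : Finset (Fin 3)) ≠ Finset.univ := by revert i; decide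
    simp_rw [parity_zeta, if_neg hS]
    exact Finset.sum_const_zero

/-! ### Cardinalities -/

lemma card_ker_theta : Nat.card T.theta.ker = 2 := by
  have h : (T.theta.ker : Set (∀ i, T.A i)) = {1, -1} := by
    ext a
    rw [SetLike.mem_coe, MonoidHom.mem_ker, theta_eq_one_iff]
    rfl
  have h1 : (1 : ∀ i, T.A i) ≠ -1 := fun h => T.neg_ne 0 1 (congrFun h 0).symm
  rw [← Set.ncard_pair h1, ← h]
  rfl

lemma card_range_theta : Nat.card T.theta.range = 4 * ∏ i, Fintype.card (T.B i) := by
  have h := Subgroup.card_mul_index T.theta.ker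
  rw [Subgroup.index_ker, card_ker_theta, Nat.card_eq_fintype_card (α := ∀ i, T.A i),
    Fintype.card_pi, Fin.prod_univ_three] at h
  simp only [card_A_eq] at h
  rw [Fin.prod_univ_three]
  refine Nat.eq_of_mul_eq_mul_left (two_pos) (h.trans ?_)
  ring

/-- The group `∏ A i` has order `8 ∏ |B i|`, its image under `theta` is its quotient by `±1`, and
the image is the kernel of the map to the ideal class group. -/
lemma card_rayClassGroup : Nat.card (RayClassGroup (T.lev Finset.univ)) =
    Fintype.card (ClassGroup (𝓞 K)) * (4 * ∏ i, Fintype.card (T.B i)) := by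
  have h := Subgroup.card_mul_index (toClassGroup (T.lev Finset.univ)).ker
  have h1 : (toClassGroup (T.lev Finset.univ)).ker = T.theta.range := by
    ext g
    rw [MonoidHom.mem_ker, toClassGroup_lev_eq_one_iff]
    simp_rw [res_self]
    exact exists_congr fun a => eq_comm
  rw [Subgroup.index_ker, MonoidHom.range_eq_top.2 (toClassGroup_surjective _), h1,
    card_range_theta, Subgroup.card_top, Nat.card_eq_fintype_card (α := ClassGroup (𝓞 K)),
    mul_comm] at h
  exact h.symm

instance finite_rayClassGroup : Finite (RayClassGroup (T.lev Finset.univ)) := by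
  refine Nat.finite_of_card_ne_zero ?_
  rw [card_rayClassGroup]
  have h : ∏ i, Fintype.card (T.B i) ≠ 0 := Finset.prod_ne_zero_iff.2 fun i _ =>
    Fintype.card_ne_zero
  have h2 : Fintype.card (ClassGroup (𝓞 K)) ≠ 0 := Fintype.card_ne_zero
  positivity

instance finite_groupAlg : Module.Finite ℚ T.GroupAlg := Module.Finite.of_basis T.basisAlg

lemma finrank_groupAlg : Module.finrank ℚ T.GroupAlg =
    Fintype.card (ClassGroup (𝓞 K)) * (4 * ∏ i, Fintype.card (T.B i)) := by
  rw [Module.finrank_eq_nat_card_basis T.basisAlg, card_rayClassGroup]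

end PrimeTriple

end

section

namespace PrimeTriple

variable {K : Type*} [Field K] [NumberField K] (T : PrimeTriple K) [HasTrivialUnits K]

/-! ### The torsion subgroup of `Δ_m / U(m)` -/

/-- A class of full level over a given ideal class. -/
def classLift (c : ClassGroup (𝓞 K)) : RayClassGroup (T.lev Finset.univ) :=
  (toClassGroup_surjective (T.lev Finset.univ) c).choose

lemma toClassGroup_classLift (c : ClassGroup (𝓞 K)) : toClassGroup _ (T.classLift c) = c :=
  (toClassGroup_surjective (T.lev Finset.univ) c).choose_spec

/-- The torsion element over a given ideal class. -/
def tors (c : ClassGroup (𝓞 K)) : Delta K ⧸ ULevel (T.lev Finset.univ) :=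
  (T.levelSystem (T.classLift c)).fullSum 1 -
    (T.levelSystem (T.classLift c)).exists_torsion.choose

lemma two_nsmul_tors (c : ClassGroup (𝓞 K)) : 2 • T.tors c = 0 :=
  (T.levelSystem (T.classLift c)).exists_torsion.choose_spec.2

/-- The torsion element over `c` is a sum of `∏ |B i|` elements of full level, an odd number, up to
elements of lower level. -/
lemma map_tors {V : Type*} [AddCommGroup V] (c : ClassGroup (𝓞 K))
    (f : Delta K ⧸ ULevel (T.lev Finset.univ) →+ V) {v : V} (hv : v + v = 0)
    (h1 : ∀ a, f (QuotientAddGroup.mk (T.zeta Finset.univ (T.theta a * T.classLift c))) = v)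
    (h2 : ∀ S a, S ≠ Finset.univ →
      f (QuotientAddGroup.mk (T.zeta S (T.theta a * T.classLift c))) = 0) : f (T.tors c) = v := by
  rw [tors, LevelSystem.map_fullSum_sub _ f h1 h2
    (T.levelSystem (T.classLift c)).exists_torsion.choose_spec.1]
  have h : Odd (∏ i, Fintype.card (T.B i)) := by
    rw [Fin.prod_univ_three]
    exact ((T.odd_card_B 0).mul (T.odd_card_B 1)).mul (T.odd_card_B 2)
  obtain ⟨k, hk⟩ := h
  rw [hk, add_smul, one_smul, mul_comm, mul_smul, two_smul, hv, smul_zero, zero_add]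

/-- The image of `Δ_m` modulo `U(m)`. -/
def levelQuot : AddSubgroup (Delta K ⧸ ULevel (T.lev Finset.univ)) :=
  (DeltaLevel (T.lev Finset.univ)).map (QuotientAddGroup.mk' _)

lemma mk_zeta_mem (S : Finset (Fin 3)) (g : RayClassGroup (T.lev Finset.univ)) :
    (QuotientAddGroup.mk (T.zeta S g) : Delta K ⧸ ULevel (T.lev Finset.univ)) ∈ T.levelQuot :=
  AddSubgroup.mem_map_of_mem (QuotientAddGroup.mk' _) (T.zeta_mem S g)

lemma tors_mem (c : ClassGroup (𝓞 K)) : T.tors c ∈ T.levelQuot := by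
  refine sub_mem ?_ ?_
  · exact sumB_mem fun _ _ => sumB_mem fun _ _ => sumB_mem fun _ _ => T.mk_zeta_mem _ _
  · have : (T.levelSystem (T.classLift c)).lower ≤ T.levelQuot := by
      rw [LevelSystem.lower, AddSubgroup.closure_le]
      rintro _ ⟨S, a, -, rfl⟩
      exact T.mk_zeta_mem _ _
    exact this (T.levelSystem (T.classLift c)).exists_torsion.choose_spec.1

/-- The generators of `Δ_m / U(m)`, apart from the torsion elements. -/
def genFamily (x : ClassGroup (𝓞 K) × genIndex T.B (fun i => (-1 : T.A i))) :
    Delta K ⧸ ULevel (T.lev Finset.univ) :=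
  QuotientAddGroup.mk (T.zeta x.2.1.1 (T.theta x.2.1.2 * T.classLift x.1))

lemma mk_zeta_mem_closure (S : Finset (Fin 3)) (g : RayClassGroup (T.lev Finset.univ)) :
    (QuotientAddGroup.mk (T.zeta S g) : Delta K ⧸ ULevel (T.lev Finset.univ)) ∈
      AddSubgroup.closure (Set.range T.genFamily) ⊔ AddSubgroup.closure (Set.range T.tors) := by
  obtain ⟨a, ha⟩ := T.exists_theta_mul_eq (T.toClassGroup_classLift (toClassGroup _ g)).symm
  generalize toClassGroup _ g = c at ha
  subst ha
  refine (T.levelSystem (T.classLift c)).z_mem (fun x hx => ?_)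
    (T.levelSystem (T.classLift c)).exists_torsion.choose_spec.1 ?_ S a
  · exact AddSubgroup.mem_sup_left (AddSubgroup.subset_closure ⟨(c, ⟨x, hx⟩), rfl⟩)
  · exact AddSubgroup.mem_sup_right (AddSubgroup.subset_closure ⟨c, rfl⟩)

lemma levelQuot_le : T.levelQuot ≤
    AddSubgroup.closure (Set.range T.genFamily) ⊔ AddSubgroup.closure (Set.range T.tors) := by
  rw [levelQuot, DeltaLevel_eq, AddMonoidHom.map_closure, AddSubgroup.closure_le]
  rintro _ ⟨_, ⟨S, g, rfl⟩, rfl⟩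
  exact T.mk_zeta_mem_closure S g

/-- A torsion element of `Δ_m / U(m)` is in the kernel of the homomorphism to the group algebra,
hence in the group generated by the elements `tors c`. -/
lemma mem_closure_tors {y : Delta K ⧸ ULevel (T.lev Finset.univ)} (hy : y ∈ T.levelQuot) {n : ℕ}
    (hn : n ≠ 0) (hny : n • y = 0) : y ∈ AddSubgroup.closure (Set.range T.tors) := by
  have h0 : ∀ {n : ℕ} (_ : n ≠ 0) {x : T.GroupAlg}, n • x = 0 → x = 0 := fun hn x hx => by
    rw [← Nat.cast_smul_eq_nsmul ℚ] at hx
    exact (smul_eq_zero_iff_right (Nat.cast_ne_zero.2 hn)).1 hx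
  let f : Delta K ⧸ ULevel (T.lev Finset.univ) →+ T.GroupAlg :=
    QuotientAddGroup.lift _ T.toGroupAlg T.ULevel_le_ker_toGroupAlg
  refine mem_of_map_eq_zero f T.genFamily _ (fun x hx => ?_) ?_ ?_ (T.levelQuot_le hy) (h0 hn ?_)
  · have : AddSubgroup.closure (Set.range T.tors) ≤ f.ker := by
      rw [AddSubgroup.closure_le]
      rintro _ ⟨c, rfl⟩
      refine h0 two_ne_zero ?_
      rw [← map_nsmul, two_nsmul_tors, map_zero]
    exact this hx
  · rw [Fintype.card_prod, Fintype.card_coe, finrank_groupAlg]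
    exact Nat.mul_le_mul_left _ card_genIndex_le
  · refine T.span_toGroupAlg.trans (Submodule.span_mono ?_)
    rintro _ ⟨S, g, rfl⟩
    exact ⟨_, T.mk_zeta_mem_closure S g, rfl⟩
  · rw [← map_nsmul, hny, map_zero]

/-- The parity homomorphism on `Δ / U(m)`. -/
def parityQuot : Delta K ⧸ ULevel (T.lev Finset.univ) →+ (ClassGroup (𝓞 K) → ZMod 2) :=
  QuotientAddGroup.lift _ T.parity T.ULevel_le_ker_parity

open Classical in
lemma parityQuot_tors (c : ClassGroup (𝓞 K)) : T.parityQuot (T.tors c) = Pi.single c 1 := by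
  refine T.map_tors c T.parityQuot (CharTwo.add_self_eq_zero _) (fun a => ?_) fun S a hS => ?_
  · refine (T.parity_zeta _ _).trans ?_
    rw [if_pos rfl, map_mul, toClassGroup_theta, one_mul, toClassGroup_classLift]
  · exact (T.parity_zeta _ _).trans (if_neg hS)

lemma parityQuot_injOn {y : Delta K ⧸ ULevel (T.lev Finset.univ)}
    (hy : y ∈ AddSubgroup.closure (Set.range T.tors)) (h : T.parityQuot y = 0) : y = 0 := by
  classical
  rw [← Submodule.span_int_eq_addSubgroupClosure, Submodule.mem_toAddSubgroup,
    Submodule.mem_span_range_iff_exists_fun] at hy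
  obtain ⟨n, rfl⟩ := hy
  refine Finset.sum_eq_zero fun c _ => ?_
  have h1 : (n c : ZMod 2) = 0 := by
    rw [map_sum] at h
    simp_rw [map_zsmul, parityQuot_tors] at h
    have := congrFun h c
    simpa [Finset.sum_apply, Pi.single_apply] using this
  obtain ⟨k, hk⟩ := (ZMod.intCast_zmod_eq_zero_iff_dvd (n c) 2).1 h1
  have h2 := T.two_nsmul_tors c
  rw [hk, mul_comm, mul_smul, natCast_zsmul, h2, smul_zero]

/-- The torsion subgroup of `Δ_m / U(m)` is the group of functions from the ideal class group to
`ZMod 2`. -/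
theorem nonempty_torsion_equiv : Nonempty (AddCommGroup.torsion
    (DeltaLevel (T.lev Finset.univ) ⧸
      (ULevel (T.lev Finset.univ)).addSubgroupOf (DeltaLevel (T.lev Finset.univ))) ≃+
    (ClassGroup (𝓞 K) → ZMod 2)) := by
  classical
  let j : DeltaLevel (T.lev Finset.univ) ⧸
      (ULevel (T.lev Finset.univ)).addSubgroupOf (DeltaLevel (T.lev Finset.univ)) →+
      Delta K ⧸ ULevel (T.lev Finset.univ) :=
    QuotientAddGroup.map _ _ (DeltaLevel (T.lev Finset.univ)).subtype le_rfl
  have hj : ∀ t, j t = 0 → t = 0 := by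
    intro t ht
    obtain ⟨y, rfl⟩ := QuotientAddGroup.mk_surjective t
    have ht' : (QuotientAddGroup.mk (y : Delta K) : Delta K ⧸ ULevel (T.lev Finset.univ)) = 0 := ht
    have hy := (QuotientAddGroup.eq_zero_iff (y : Delta K)).1 ht'
    exact (QuotientAddGroup.eq_zero_iff y).2 hy
  have hjm : ∀ t, j t ∈ T.levelQuot := by
    intro t
    obtain ⟨y, rfl⟩ := QuotientAddGroup.mk_surjective t
    exact AddSubgroup.mem_map_of_mem (QuotientAddGroup.mk' _) y.2
  have hlift : ∀ c, ∃ t, j t = T.tors c := by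
    intro c
    obtain ⟨y, hy, hyc⟩ := T.tors_mem c
    exact ⟨QuotientAddGroup.mk ⟨y, hy⟩, hyc⟩
  choose t ht using hlift
  refine ⟨AddEquiv.ofBijective ((T.parityQuot.comp j).comp (AddSubgroup.subtype _))
    ⟨(injective_iff_map_eq_zero _).2 ?_, fun F => ?_⟩⟩
  · rintro ⟨x, hx⟩ h
    obtain ⟨n, hn, hnx⟩ := isOfFinAddOrder_iff_nsmul_eq_zero.1 hx
    refine Subtype.ext (hj x (T.parityQuot_injOn (T.mem_closure_tors (hjm x) hn.ne' ?_) h))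
    rw [← map_nsmul, hnx, map_zero]
  · have hs : j (∑ c, (F c).val • t c) = ∑ c, (F c).val • T.tors c := by
      rw [map_sum]
      simp_rw [map_nsmul, ht]
    refine ⟨⟨∑ c, (F c).val • t c, isOfFinAddOrder_iff_nsmul_eq_zero.2 ⟨2, two_pos, hj _ ?_⟩⟩,
      (congrArg T.parityQuot hs).trans ?_⟩
    · rw [map_nsmul, hs, Finset.smul_sum]
      refine Finset.sum_eq_zero fun c _ => ?_
      rw [smul_comm, two_nsmul_tors, smul_zero]
    · rw [map_sum]
      simp_rw [map_nsmul, parityQuot_tors]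
      funext c
      rw [Finset.sum_apply, Finset.sum_eq_single c]
      · rw [Pi.smul_apply, Pi.single_eq_same, nsmul_one, ZMod.natCast_zmod_val]
      · intro b _ hb
        rw [Pi.smul_apply, Pi.single_eq_of_ne hb.symm, smul_zero]
      · exact fun h => (h (Finset.mem_univ c)).elim

/-! ### The torsion of the universal distribution -/

lemma ULevel_le_ker_deltaToDist : ULevel (T.lev Finset.univ) ≤ (deltaToDist K).ker := by
  refine T.ULevel_le fun S i hi g => ?_
  have hn : T.lev S * ofPrime (T.p i) ^ 1 = T.lev S * ofPrime (T.p i) := by rw [pow_one]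
  have := T.finite_ker hi (Dvd.intro _ rfl) (T.lev_mul_pow_dvd hi) (T.lev_mul_pow hi)
  rw [AddMonoidHom.mem_ker, rel_eq]
  exact deltaToDist_normSum (T.not_dvd_lev hi) hn _ (res_res _ _ _)

lemma deltaToDist_zeta_mem (S : Finset (Fin 3)) (g : RayClassGroup (T.lev Finset.univ)) :
    deltaToDist K (T.zeta S g) ∈ level (T.lev Finset.univ) := by
  rw [zeta, deltaToDist_symb]
  generalize classRep (res (T.lev_dvd S) g) = b
  have h : T.lev Finset.univ = T.lev S * T.lev Sᶜ :=
    (Finset.prod_mul_prod_compl S (fun i => ofPrime (T.p i))).symm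
  have h' : toFrac b * (toFrac (T.lev S))⁻¹ =
      toFrac (b * T.lev Sᶜ) * (toFrac (T.lev Finset.univ))⁻¹ := by
    rw [h, map_mul, map_mul, mul_inv, mul_mul_mul_comm, mul_inv_cancel, mul_one]
  exact AddSubgroup.mem_map_of_mem (QuotientAddGroup.mk' _) (AddSubgroup.subset_closure
    ⟨_, congrArg (fun c => Finsupp.single c 1) h'⟩)

/-- The homomorphism to `ZMod 2` detecting denominators divisible by exactly the three primes. -/
def distToZMod : UnivOrdDist K →+ ZMod 2 :=
  univOrdDistToZMod (T := Set.range T.p)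
    (Set.nontrivial_of_mem_mem_ne ⟨0, rfl⟩ ⟨1, rfl⟩ (T.inj.ne (by decide)))
    (by rintro _ ⟨i, rfl⟩; exact T.two_notMem i)

lemma distToZMod_zeta (S : Finset (Fin 3)) (g : RayClassGroup (T.lev Finset.univ)) :
    T.distToZMod (deltaToDist K (T.zeta S g)) = if S = Finset.univ then 1 else 0 := by
  rw [zeta, deltaToDist_symb, distToZMod, univOrdDistToZMod_single, denIndicator_div]
  have hcop := isCoprime_classRep (res (T.lev_dvd S) g)
  generalize classRep (res (T.lev_dvd S) g) = b at hcop
  rw [isCoprime_iff_ord] at hcop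
  refine if_congr ?_ rfl rfl
  have h : ∀ q, ord q b < ord q (T.lev S) ↔ ∃ i ∈ S, T.p i = q := fun q => by
    rw [← T.ofPrime_dvd_lev]
    refine ⟨fun hq => ofPrime_dvd_iff.2 (by omega), fun hq => ?_⟩
    rw [hcop q hq]
    exact ofPrime_dvd_iff.1 hq
  rw [Set.ext_iff]
  simp only [Set.mem_ofPred_eq, h, Set.mem_range]
  constructor
  · intro h1
    refine Finset.eq_univ_of_forall fun i => ?_
    obtain ⟨j, hj, hji⟩ := (h1 (T.p i)).2 ⟨i, rfl⟩
    exact T.inj hji ▸ hj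
  · rintro rfl q
    simp

/-- The image of `tors 1` in the universal distribution is killed by `2` and has odd image under
`distToZMod`. -/
theorem torsion_level_ne_bot : AddCommGroup.torsion (level (T.lev Finset.univ)) ≠ ⊥ := by
  let f : Delta K ⧸ ULevel (T.lev Finset.univ) →+ UnivOrdDist K :=
    QuotientAddGroup.lift _ (deltaToDist K) T.ULevel_le_ker_deltaToDist
  have hmem : f (T.tors 1) ∈ level (T.lev Finset.univ) := by
    have h : T.levelQuot ≤ (level (T.lev Finset.univ)).comap f := by
      rw [levelQuot, DeltaLevel_eq, AddMonoidHom.map_closure, AddSubgroup.closure_le]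
      rintro _ ⟨_, ⟨S, g, rfl⟩, rfl⟩
      exact T.deltaToDist_zeta_mem S g
    exact h (T.tors_mem 1)
  have hne : T.distToZMod (f (T.tors 1)) = 1 := by
    refine T.map_tors 1 (T.distToZMod.comp f) rfl (fun a => ?_) fun S a hS => ?_
    · exact (T.distToZMod_zeta _ _).trans (if_pos rfl)
    · exact (T.distToZMod_zeta _ _).trans (if_neg hS)
  rw [Ne, AddSubgroup.eq_bot_iff_forall, not_forall]
  refine ⟨⟨f (T.tors 1), hmem⟩, fun h => ?_⟩
  have h1 := h (isOfFinAddOrder_iff_nsmul_eq_zero.2 ⟨2, two_pos, Subtype.ext (by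
    change 2 • f (T.tors 1) = 0
    rw [← map_nsmul, two_nsmul_tors, map_zero])⟩)
  rw [show f (T.tors 1) = 0 from congrArg Subtype.val h1, map_zero] at hne
  exact zero_ne_one hne

end PrimeTriple

end

section

/-! ### Imaginary quadratic fields -/

/-- A totally complex quadratic field with two roots of unity has the units `1` and `-1` only. -/
lemma hasTrivialUnits_of_finrank_eq_two {K : Type*} [Field K] [NumberField K]
    (hdeg : Module.finrank ℚ K = 2) (hcomplex : NumberField.IsTotallyComplex K)
    (hw : NumberField.Units.torsionOrder K = 2) : HasTrivialUnits K where
  units u := by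
    have hrank : NumberField.Units.rank K = 0 := by
      have h := NumberField.IsTotallyComplex.finrank K
      have h2 := NumberField.IsTotallyComplex.nrRealPlaces_eq_zero K
      rw [NumberField.Units.rank,
        NumberField.InfinitePlace.card_eq_nrRealPlaces_add_nrComplexPlaces]
      omega
    obtain ⟨⟨ζ, e⟩, h, -⟩ := NumberField.Units.exist_unique_eq_mul_prod K u
    have : IsEmpty (Fin (NumberField.Units.rank K)) := by rw [hrank]; infer_instance
    simp only [Finset.univ_eq_empty, Finset.prod_empty, mul_one] at h
    have hpow : u ^ 2 = 1 := by
      rw [h, ← hw, NumberField.Units.torsionOrder]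
      exact congrArg Subtype.val (pow_card_eq_one' (x := ζ))
    have hsq : (u : 𝓞 K) * u = 1 := by
      rw [← pow_two, ← Units.val_pow_eq_pow_val, hpow, Units.val_one]
    rcases mul_self_eq_one_iff.1 hsq with h | h
    · exact Or.inl (Units.ext h)
    · exact Or.inr (Units.ext h)
  noReal := ⟨fun σ => by
    refine NumberField.IsTotallyComplex.complexEmbedding_not_isReal (Complex.ofRealHom.comp σ) ?_
    ext x
    simp⟩

end

end UnivDist

end

theorem mainTheorem1 (K : Type*) [Field K] [NumberField K]
    (hdeg : Module.finrank ℚ K = 2) (hcomplex : NumberField.IsTotallyComplex K)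
    (hw : NumberField.Units.torsionOrder K = 2)
    (p : Fin 3 → HeightOneSpectrum (𝓞 K)) (hinj : Function.Injective p)
    (hprinc : ∀ i, (p i).asIdeal.IsPrincipal)
    (hnorm : ∀ i, Ideal.absNorm (p i).asIdeal ≡ 3 [MOD 4])
    (m : UnivDist.IntIdeal K) (hm : m = ∏ i, UnivDist.ofPrime (p i)) :
    Nonempty (AddCommGroup.torsion
        (UnivDist.DeltaLevel m ⧸ (UnivDist.ULevel m).addSubgroupOf (UnivDist.DeltaLevel m)) ≃+
      (Fin (NumberField.classNumber K) → ZMod 2)) ∧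
    AddCommGroup.torsion (UnivDist.level m) ≠ ⊥ := by
  have := UnivDist.hasTrivialUnits_of_finrank_eq_two hdeg hcomplex hw
  choose x hx using fun i => (hprinc i).principal
  have hx0 : ∀ i, x i ≠ 0 := fun i h => (p i).ne_bot (by rw [hx i, h]; simp)
  let T : UnivDist.PrimeTriple K :=
    { p := p
      inj := hinj
      gen := fun i => ⟨x i, mem_nonZeroDivisors_of_ne_zero (hx0 i)⟩
      prin_gen := fun i => Subtype.ext (hx i).symm
      card_mod_four := fun i => hnorm i }
  obtain rfl : m = T.lev Finset.univ := hm
  refine ⟨?_, T.torsion_level_ne_bot⟩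
  obtain ⟨e⟩ := T.nonempty_torsion_equiv
  exact ⟨e.trans (LinearEquiv.funCongrLeft ℤ (ZMod 2)
    (Fintype.equivFinOfCardEq (α := ClassGroup (𝓞 K)) rfl).symm).toAddEquiv⟩
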